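/- Let $n\ge 1$, let $B^n\subset\mathbb R^n$ be the Euclidean unit ball and $\mathbb S^n\subset\mathbb R^n\times\mathbb R$ the unit sphere, and for $0<a<\pi/2$ let $$\varphi_a:B^n\to\mathbb S^n,\qquad \varphi_a(x)=\Big(\sin a\,\frac{x}{|x|},\ \cos a\Big).$$ For a map $\varphi$ into $\mathbb S^n$ let $\tau(\varphi)=\operatorname{trace}\nabla d\varphi$ be the tension field, $\overline\Delta=d^*d$ the rough Laplacian on sections of $\varphi^{-1}T\mathbb S^n$, and let $$E(\varphi)=\tfrac12\int_{B^n}|d\varphi|^2,\qquad E^{ES}_r(\varphi)=\tfrac12\int_{B^n}|(d^*+d)^r(\varphi)|^2,$$ $$E_{2s}(\varphi)=\tfrac12\int_{B^n}|\overline\Delta^{\,s-1}\tau(\varphi)|^2,\qquad E_{2s+1}(\varphi)=\tfrac12\int_{B^n}\sum_{j=1}^n|\nabla^{\varphi}_{e_j}\overline\Delta^{\,s-1}\tau(\varphi)|^2\qquad(s\ge 1).$$ A map $\varphi$ is called weakly $r$-harmonic (weakly $ES$-$r$-harmonic) if $\varphi\in W^{r,2}(B^n,\mathbb S^n)$ and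 $\varphi$ is a critical point of $E_r$ (of $E^{ES}_r$) in the sense of distributions, i.e. the first variation vanishes along $\varphi_t=(\varphi+tV)/|\varphi+tV|$ for every $V\in C_c^\infty(B^n,\mathbb R^{n+1})$; it is weakly harmonic if the same holds for $E$ in $W^{1,2}(B^n,\mathbb S^n)$. A weakly $r$-harmonic (weakly $ES$-$r$-harmonic) map is called proper if it is not weakly harmonic. Then: (i) $\varphi_a$ is a proper weakly $ES$-$3$-harmonic map if and only if $$n=7\quad\text{and}\quad a=\tfrac12\arccos\Big(\tfrac19\big(2\sqrt{10}-11\big)\Big),$$ and $\varphi_a$ is a proper weakly $3$-harmonic map if and only if the same condition holds; (ii) $\varphi_a$ is a proper weakly $ES$-$4$-harmonic map if and only if $$n=9\quad\text{and}\quad a=\tfrac12\arccos\Big(\tfrac1{16}\big(\sqrt{105}-19\big)\Big),$$ and $\varphi_a$ is a proper weakly $4$-harmonic map if and only if the same condition holds; (iii) $\varphi_a$ is a proper weakly $ES$-$5$-harmonic map if and only if $$n=11\quad\text{and}\quad a=\tfrac12\arccos\Big(\tfrac1{25}\big(6\sqrt6-29\big)\Big),$$ and $\varphi_a$ is a proper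 weakly $5$-harmonic map if and only if the same condition holds. -/

import Mathlib

open MeasureTheory
open scoped ContDiff

noncomputable section

namespace PolyHarm

variable {n : ℕ} {F : Type*} [NormedAddCommGroup F] [InnerProductSpace ℝ F]

/-! ### Weak derivatives and Sobolev spaces on an open subset of Euclidean space -/

/-- `ψ` is a smooth function with compact support contained in `Ω`. -/
def IsTestFunction {G : Type*} [NormedAddCommGroup G] [NormedSpace ℝ G]
    (Ω : Set (EuclideanSpace ℝ (Fin n))) (ψ : EuclideanSpace ℝ (Fin n) → G) : Prop :=
  ContDiff ℝ ∞ ψ ∧ HasCompactSupport ψ ∧ tsupport ψ ⊆ Ω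

/-- `v` is a weak partial derivative of `u` on `Ω` in the direction of the `i`-th coordinate. -/
def HasWeakPartial (Ω : Set (EuclideanSpace ℝ (Fin n))) (i : Fin n)
    (u v : EuclideanSpace ℝ (Fin n) → F) : Prop :=
  LocallyIntegrableOn u Ω volume ∧ LocallyIntegrableOn v Ω volume ∧
    ∀ ψ : EuclideanSpace ℝ (Fin n) → ℝ, IsTestFunction Ω ψ →
      ∫ x in Ω, (fderiv ℝ ψ x (EuclideanSpace.single i 1)) • u x = -∫ x in Ω, ψ x • v x

open Classical in
/-- The weak partial derivative of `u` (well defined up to almost everywhere equality on an open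
set `Ω`; zero by convention if there is none). -/
def weakPartial (Ω : Set (EuclideanSpace ℝ (Fin n))) (i : Fin n)
    (u : EuclideanSpace ℝ (Fin n) → F) : EuclideanSpace ℝ (Fin n) → F :=
  if h : ∃ v, HasWeakPartial Ω i u v then h.choose else 0

/-- Membership in the Sobolev space `W^{k,2}(Ω, F)`. -/
def MemSobolev (Ω : Set (EuclideanSpace ℝ (Fin n))) :
    ℕ → (EuclideanSpace ℝ (Fin n) → F) → Prop
  | 0, u => MemLp u 2 (volume.restrict Ω)
  | k + 1, u => MemLp u 2 (volume.restrict Ω) ∧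
      ∀ i : Fin n, ∃ v, HasWeakPartial Ω i u v ∧ MemSobolev Ω k v

/-- Membership in `W^{k,2}(Ω, S)`, where `S` is the unit sphere of `F`. -/
def MemSobolevSphere (Ω : Set (EuclideanSpace ℝ (Fin n))) (k : ℕ)
    (φ : EuclideanSpace ℝ (Fin n) → F) : Prop :=
  MemSobolev Ω k φ ∧ ∀ᵐ x ∂(volume.restrict Ω), φ x ∈ Metric.sphere (0 : F) 1

/-! ### Calculus along a map into the unit sphere

Sections of the pull-back of the tangent bundle of the unit sphere `S` of `F` by `φ : Ω → S` are
functions with values in `F` that are pointwise orthogonal to `φ`. The pull-back of the Levi-Civita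
connection is the tangential part of the (weak) derivative. The domain is flat and the frame is the
standard parallel orthonormal one. -/

/-- Orthogonal projection of `v` onto the tangent space of the unit sphere at the point `p`. -/
def tangentProj (p v : F) : F := v - inner ℝ v p • p

/-- The pull-back connection `∇^φ` in the direction of the `i`-th coordinate. -/
def covDeriv (Ω : Set (EuclideanSpace ℝ (Fin n))) (φ : EuclideanSpace ℝ (Fin n) → F) (i : Fin n)
    (W : EuclideanSpace ℝ (Fin n) → F) : EuclideanSpace ℝ (Fin n) → F :=
  fun x => tangentProj (φ x) (weakPartial Ω i W x)

/-- The tension field `τ(φ) = trace ∇dφ`. -/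
def tension (Ω : Set (EuclideanSpace ℝ (Fin n))) (φ : EuclideanSpace ℝ (Fin n) → F) :
    EuclideanSpace ℝ (Fin n) → F :=
  fun x => ∑ i, covDeriv Ω φ i (weakPartial Ω i φ) x

/-- The rough Laplacian `-∑ᵢ ∇ᵢ∇ᵢ` on sections along `φ`. -/
def roughLaplacian (Ω : Set (EuclideanSpace ℝ (Fin n))) (φ : EuclideanSpace ℝ (Fin n) → F)
    (W : EuclideanSpace ℝ (Fin n) → F) : EuclideanSpace ℝ (Fin n) → F :=
  fun x => -∑ i, covDeriv Ω φ i (covDeriv Ω φ i W) x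

/-- The energy `E(φ) = ½ ∫ |dφ|²`. -/
def energy (Ω : Set (EuclideanSpace ℝ (Fin n))) (φ : EuclideanSpace ℝ (Fin n) → F) : ℝ :=
  (1 / 2) * ∫ x in Ω, ∑ i, ‖weakPartial Ω i φ x‖ ^ 2

/-- The `r`-energy, for `r ≥ 2`: with `Δ` the rough Laplacian,
`E_{2s}(φ) = ½ ∫ |Δ^{s-1} τ(φ)|²` and `E_{2s+1}(φ) = ½ ∫ ∑ⱼ |∇ⱼ Δ^{s-1} τ(φ)|²`. -/
def rEnergy (Ω : Set (EuclideanSpace ℝ (Fin n))) (r : ℕ)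
    (φ : EuclideanSpace ℝ (Fin n) → F) : ℝ :=
  if Even r then
    (1 / 2) * ∫ x in Ω, ‖(roughLaplacian Ω φ)^[r / 2 - 1] (tension Ω φ) x‖ ^ 2
  else
    (1 / 2) * ∫ x in Ω, ∑ j,
      ‖covDeriv Ω φ j ((roughLaplacian Ω φ)^[r / 2 - 1] (tension Ω φ)) x‖ ^ 2

/-! ### Differential forms along a map and the Eells–Sampson energies

A differential form of mixed degree with values in the pull-back bundle is given by its components
`η I`, the value of `η` on the frame vectors `e_{i₁}, …, e_{iₚ}` for `I = {i₁ < ⋯ < iₚ}`; its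
squared norm is the sum of the squared norms of these components. -/

/-- Differential forms of mixed degree on `Ω` with values in `F`, in components. -/
abbrev MixedForm (n : ℕ) (F : Type*) := Finset (Fin n) → EuclideanSpace ℝ (Fin n) → F

/-- The sign `(-1)^{#{j ∈ I : j < i}}`. -/
def formSign (i : Fin n) (I : Finset (Fin n)) : ℝ := (-1) ^ (I.filter (fun j => j < i)).card

/-- The exterior covariant derivative `d` on forms along `φ`. -/
def extD (Ω : Set (EuclideanSpace ℝ (Fin n))) (φ : EuclideanSpace ℝ (Fin n) → F)
    (η : MixedForm n F) : MixedForm n F :=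
  fun I x => ∑ i ∈ I, formSign i I • covDeriv Ω φ i (η (I.erase i)) x

/-- The codifferential `d^*` on forms along `φ`,
`(d^*η)(X₂, …, Xₚ) = -∑ᵢ (∇ᵢη)(eᵢ, X₂, …, Xₚ)`. -/
def coD (Ω : Set (EuclideanSpace ℝ (Fin n))) (φ : EuclideanSpace ℝ (Fin n) → F)
    (η : MixedForm n F) : MixedForm n F :=
  fun I x => -∑ i ∈ Iᶜ, formSign i I • covDeriv Ω φ i (η (insert i I)) x

/-- The operator `d^* + d` on forms along `φ`. -/
def hodgeDirac (Ω : Set (EuclideanSpace ℝ (Fin n))) (φ : EuclideanSpace ℝ (Fin n) → F)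
    (η : MixedForm n F) : MixedForm n F :=
  fun I x => coD Ω φ η I x + extD Ω φ η I x

/-- The differential `dφ`, a `1`-form along `φ`. -/
def differential (Ω : Set (EuclideanSpace ℝ (Fin n))) (φ : EuclideanSpace ℝ (Fin n) → F) :
    MixedForm n F :=
  fun I x => ∑ i, if I = {i} then weakPartial Ω i φ x else 0

/-- The Eells–Sampson `r`-energy `½ ∫ |(d^* + d)^r φ|²` for `r ≥ 1`, where `(d^* + d) φ = dφ`. -/
def esEnergy (Ω : Set (EuclideanSpace ℝ (Fin n))) (r : ℕ)
    (φ : EuclideanSpace ℝ (Fin n) → F) : ℝ :=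
  (1 / 2) * ∫ x in Ω, ∑ I, ‖(hodgeDirac Ω φ)^[r - 1] (differential Ω φ) I x‖ ^ 2

/-! ### Weak critical points -/

/-- The variation `(φ + tV) / |φ + tV|` of a sphere-valued map `φ`. -/
def sphereVariation (φ V : EuclideanSpace ℝ (Fin n) → F) (t : ℝ) :
    EuclideanSpace ℝ (Fin n) → F :=
  fun x => ‖φ x + t • V x‖⁻¹ • (φ x + t • V x)

/-- `φ` is a critical point of the functional `En` in `W^{k,2}(Ω, S)`: it lies in this space, and
the first variation of `En` at `φ` exists and vanishes along every variation
`(φ + tV) / |φ + tV|` with `V` smooth and compactly supported in `Ω`. (This is the Euler–Lagrange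
equation of `En` in the sense of distributions.) -/
def IsWeakCriticalPoint (Ω : Set (EuclideanSpace ℝ (Fin n))) (k : ℕ)
    (En : (EuclideanSpace ℝ (Fin n) → F) → ℝ) (φ : EuclideanSpace ℝ (Fin n) → F) : Prop :=
  MemSobolevSphere Ω k φ ∧
    ∀ V : EuclideanSpace ℝ (Fin n) → F, IsTestFunction Ω V →
      HasDerivAt (fun t : ℝ => En (sphereVariation φ V t)) 0 0

/-- Weakly harmonic maps into the unit sphere. -/
def IsWeaklyHarmonic (Ω : Set (EuclideanSpace ℝ (Fin n)))
    (φ : EuclideanSpace ℝ (Fin n) → F) : Prop :=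
  IsWeakCriticalPoint Ω 1 (energy Ω) φ

/-- Proper weakly `r`-harmonic maps into the unit sphere (`r ≥ 2`). -/
def IsProperWeaklyRHarmonic (Ω : Set (EuclideanSpace ℝ (Fin n))) (r : ℕ)
    (φ : EuclideanSpace ℝ (Fin n) → F) : Prop :=
  IsWeakCriticalPoint Ω r (rEnergy Ω r) φ ∧ ¬ IsWeaklyHarmonic Ω φ

/-- Proper weakly `ES`-`r`-harmonic maps into the unit sphere (`r ≥ 2`). -/
def IsProperWeaklyESHarmonic (Ω : Set (EuclideanSpace ℝ (Fin n))) (r : ℕ)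
    (φ : EuclideanSpace ℝ (Fin n) → F) : Prop :=
  IsWeakCriticalPoint Ω r (esEnergy Ω r) φ ∧ ¬ IsWeaklyHarmonic Ω φ

/-- The open unit ball of `ℝⁿ`. -/
def unitBall (n : ℕ) : Set (EuclideanSpace ℝ (Fin n)) := Metric.ball 0 1

/-- The map `φ_a(x) = (sin a · x/|x|, cos a)` into the unit sphere of `ℝⁿ × ℝ`
(with the Euclidean norm). -/
def phi (n : ℕ) (a : ℝ) (x : EuclideanSpace ℝ (Fin n)) :
    WithLp 2 (EuclideanSpace ℝ (Fin n) × ℝ) :=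
  WithLp.toLp 2 (Real.sin a • (‖x‖⁻¹ • x), Real.cos a)

end PolyHarm

end

/-!
The maps `φ_a(x) = (sin a · x/|x|, cos a)` are smooth away from the origin, and so are their
variations `φ_t = (φ_a + tV)/|φ_a + tV|`: in terms of `ρ = |x|` and `θ = x/|x|`, everything that is
formed from them by differentiation is `ρ⁻ᵏ` times a smooth function of `(t, ρ, θ)` (`IsConic`). For
such functions of order `k < n - 1` the classical derivatives are the weak ones and integrals of
derivatives of compactly supported functions vanish (`IsConic.integral_dir_eq_zero`). For `n > 2r`
this reduces the first variation of the energies of order `r` to classical calculus on the punctured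
ball.

Put `ν = (-cos a · x/|x|, sin a)`, a unit section along `φ_a` that is orthogonal to the image of
`dφ_a`, and `N_l = ρ⁻ˡ ν`. The rough Laplacian along `φ_a` maps `N_l` to `λ_l N_{l+2}` with
`λ_l = l(n - 2 - l) + (n - 1) cos² a`, the tension field is `τ(φ_a) = c N₂` with
`c = (n - 1) sin a cos a`, and `|dφ_a|² = S ρ⁻²` with `S = (n - 1) sin² a` (`isModel_radial`).
Integrating by parts, and commuting covariant derivatives by means of the curvature of the sphere
(`IsSphereFamily.cov_cov_sub`), one finds that the first variation of every energy in question is a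
constant times `∫ ⟨V, N_{2r}⟩` (`IsModel.hasDerivAt_rEnergy_three` and its analogues). The
Eells–Sampson energies have the same first variations: `(d^* + d)^r φ` differs from the
corresponding iterate of the rough Laplacian or its derivative by curvature terms which vanish at
`t = 0` and do not contribute to the first variation, by antisymmetry
(`IsModel.hasDerivAt_esEnergy_five`).

Hence for `n > 2r` the map `φ_a` is critical exactly if this constant, a polynomial in `n` and
`cos² a` up to nonzero factors, vanishes (`isWeakCriticalPoint_phi_iff`). For `n > 2r + 1` it is
negative, and for `n = 2r + 1` it has exactly one root `cos² a > 0` (`equation_three_iff`,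
`equation_four_iff`, `equation_five_iff`). For the energy of order one the constant is `-c ≠ 0`, so
that `φ_a` is not weakly harmonic. Finally, for `n ≤ 2r` the map `φ_a` is not in `W^{r,2}`
(`not_memSobolevSphere_phi`): its weak derivatives would have to be the classical ones, but some
derivative of order `⌈n/2⌉` is not square integrable, or, if `n = 1`, the sign function is not
weakly differentiable.
-/

noncomputable section

namespace PolyHarm

/-! ### Families of functions with a conical singularity at the origin -/

section

variable {n : ℕ}
variable {F : Type*} [NormedAddCommGroup F] [InnerProductSpace ℝ F]
variable {G : Type*} [NormedAddCommGroup G] [NormedSpace ℝ G]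
variable {H : Type*} [NormedAddCommGroup H] [NormedSpace ℝ H]

/-- The Euclidean space `ℝⁿ`. -/
abbrev Eucl (n : ℕ) : Type := EuclideanSpace ℝ (Fin n)

/-- The derivative of a function on `ℝ × ℝⁿ` in the constant direction `p`; the first factor is the
parameter of a variation. -/
def dir (p : ℝ × Eucl n) (u : ℝ × Eucl n → G) (y : ℝ × Eucl n) : G := fderiv ℝ u y p

/-- The direction of the parameter. -/
def eT : ℝ × Eucl n := (1, 0)

/-- The direction of the `i`-th coordinate of `ℝⁿ`. -/
def eX (i : Fin n) : ℝ × Eucl n := (0, EuclideanSpace.single i 1)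

/-- A one-parameter family `u (t, ·)` of functions on `ℝⁿ` that, away from the origin, has the form
`|x|⁻ᵏ w(t, |x|, x/|x|)` with `w` smooth up to `|x| = 0`, and that does not depend on `t` outside
`K`. Values at the origin are irrelevant. -/
def IsConic (K : Set (Eucl n)) (k : ℕ) (u : ℝ × Eucl n → G) : Prop :=
  (∃ w : ℝ × ℝ × Eucl n → G, ContDiff ℝ ∞ w ∧
    ∀ t x, x ≠ 0 → u (t, x) = (‖x‖ ^ k)⁻¹ • w (t, ‖x‖, ‖x‖⁻¹ • x)) ∧
  ∀ t x, x ∉ K → x ≠ 0 → u (t, x) = u (0, x)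

theorem hasFDerivAt_norm_of_ne_zero {x : Eucl n} (hx : x ≠ 0) :
    HasFDerivAt (fun z : Eucl n => ‖z‖) (‖x‖⁻¹ • innerSL ℝ x) x := by
  have hx0 : ‖x‖ ≠ 0 := norm_ne_zero_iff.mpr hx
  have h := (hasStrictFDerivAt_norm_sq x).hasFDerivAt.sqrt (by positivity)
  simp only [Real.sqrt_sq (norm_nonneg _)] at h
  refine h.congr_fderiv ?_
  ext v
  simp
  field_simp

theorem hasFDerivAt_norm_pow_inv (k : ℕ) {x : Eucl n} (hx : x ≠ 0) :
    HasFDerivAt (fun z : Eucl n => (‖z‖ ^ k)⁻¹)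
      ((-(k : ℝ) * (‖x‖ ^ (k + 2))⁻¹) • innerSL ℝ x) x := by
  have hx0 : ‖x‖ ≠ 0 := norm_ne_zero_iff.mpr hx
  have h1 : HasFDerivAt (fun z : Eucl n => ‖z‖ ^ k)
      ((k * ‖x‖ ^ (k - 1)) • (‖x‖⁻¹ • innerSL ℝ x)) x :=
    (hasDerivAt_pow k ‖x‖).comp_hasFDerivAt x (hasFDerivAt_norm_of_ne_zero hx)
  refine ((hasDerivAt_inv (pow_ne_zero k hx0)).comp_hasFDerivAt x h1).congr_fderiv ?_
  rw [smul_smul, smul_smul]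
  congr 1
  rcases k with _ | k
  · simp
  · simp only [Nat.add_sub_cancel]
    field_simp
    ring

theorem isOpen_snd_ne_zero : IsOpen {y : ℝ × Eucl n | y.2 ≠ 0} :=
  isOpen_ne_fun continuous_snd continuous_const

theorem dir_congr {u v : ℝ × Eucl n → G} (h : ∀ y, y.2 ≠ 0 → u y = v y) (p : ℝ × Eucl n)
    {y : ℝ × Eucl n} (hy : y.2 ≠ 0) : dir p u y = dir p v y := by
  have : u =ᶠ[nhds y] v := by
    filter_upwards [isOpen_snd_ne_zero.mem_nhds hy] with z hz using h z hz
  rw [dir, dir, this.fderiv_eq]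

theorem dir_slice {u : ℝ × Eucl n → G} {t : ℝ} {x : Eucl n} (h : DifferentiableAt ℝ u (t, x))
    (e : Eucl n) : dir (0, e) u (t, x) = fderiv ℝ (fun z => u (t, z)) x e := by
  have h1 : HasFDerivAt (fun z : Eucl n => ((t, z) : ℝ × Eucl n))
      (ContinuousLinearMap.inr ℝ ℝ (Eucl n)) x := hasFDerivAt_prodMk_right t x
  have h2 := HasFDerivAt.comp x h.hasFDerivAt h1
  have h3 := h2.fderiv
  simp only [Function.comp_def] at h3
  rw [h3]; simp [dir]

theorem dir_time {u : ℝ × Eucl n → G} {t : ℝ} {x : Eucl n} (h : DifferentiableAt ℝ u (t, x)) :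
    HasDerivAt (fun s => u (s, x)) (dir eT u (t, x)) t := by
  have h1 : HasFDerivAt (fun s : ℝ => ((s, x) : ℝ × Eucl n))
      (ContinuousLinearMap.inl ℝ ℝ (Eucl n)) t := hasFDerivAt_prodMk_left t x
  have h2 := (HasFDerivAt.comp t h.hasFDerivAt h1).hasDerivAt
  simpa [dir, eT, Function.comp_def] using h2

/-- Spatial derivatives at a fixed parameter depend only on the values at this parameter. -/
theorem dir_slice_congr {u v : ℝ × Eucl n → G} {t s : ℝ} {x : Eucl n}
    (hu : DifferentiableAt ℝ u (t, x)) (hv : DifferentiableAt ℝ v (s, x))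
    (h : ∀ᶠ z in nhds x, u (t, z) = v (s, z)) (e : Eucl n) :
    dir (0, e) u (t, x) = dir (0, e) v (s, x) := by
  rw [dir_slice hu, dir_slice hv]
  have : (fun z => u (t, z)) =ᶠ[nhds x] fun z => v (s, z) := h
  rw [this.fderiv_eq]

namespace IsConic

variable {K : Set (Eucl n)} {k l : ℕ} {u v : ℝ × Eucl n → G}

theorem contDiffAt (h : IsConic K k u) {y : ℝ × Eucl n} (hy : y.2 ≠ 0) : ContDiffAt ℝ ∞ u y := by
  obtain ⟨⟨w, hw, hu⟩, -⟩ := h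
  have e : u =ᶠ[nhds y] fun z => (‖z.2‖ ^ k)⁻¹ • w (z.1, ‖z.2‖, ‖z.2‖⁻¹ • z.2) := by
    filter_upwards [isOpen_snd_ne_zero.mem_nhds hy] with z hz using hu z.1 z.2 hz
  refine ContDiffAt.congr_of_eventuallyEq ?_ e
  have hn : ContDiffAt ℝ ∞ (fun z : ℝ × Eucl n => ‖z.2‖) y := contDiffAt_snd.norm ℝ hy
  have hn0 : ‖y.2‖ ≠ 0 := norm_ne_zero_iff.mpr hy
  refine ((hn.pow k).inv (pow_ne_zero k hn0)).smul ?_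
  exact hw.contDiffAt.comp y (contDiffAt_fst.prodMk (hn.prodMk ((hn.inv hn0).smul contDiffAt_snd)))

theorem differentiableAt (h : IsConic K k u) {y : ℝ × Eucl n} (hy : y.2 ≠ 0) :
    DifferentiableAt ℝ u y := (h.contDiffAt hy).differentiableAt (by simp)

theorem dir_differentiableAt (h : IsConic K k u) (p : ℝ × Eucl n) {y : ℝ × Eucl n}
    (hy : y.2 ≠ 0) : DifferentiableAt ℝ (dir p u) y := by
  have h1 : ContDiffAt ℝ 1 (fderiv ℝ u) y :=
    (h.contDiffAt hy).fderiv_right (m := 1) (by norm_cast)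
  exact (h1.differentiableAt (by simp)).clm_apply (differentiableAt_const p)

theorem dir_comm (h : IsConic K k u) (p q : ℝ × Eucl n) {y : ℝ × Eucl n} (hy : y.2 ≠ 0) :
    dir p (dir q u) y = dir q (dir p u) y := by
  have h1 : ContDiffAt ℝ 1 (fderiv ℝ u) y :=
    (h.contDiffAt hy).fderiv_right (m := 1) (by norm_cast)
  have h2 := h1.differentiableAt (by simp)
  have key : ∀ p q : ℝ × Eucl n, dir p (dir q u) y = fderiv ℝ (fderiv ℝ u) y p q := by
    intro p q
    have : fderiv ℝ (fun z => fderiv ℝ u z q) y = (fderiv ℝ (fderiv ℝ u) y).flip q := by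
      rw [fderiv_clm_apply h2 (differentiableAt_const q)]; simp
    change fderiv ℝ (fun z => fderiv ℝ u z q) y p = _
    rw [this]; rfl
  rw [key, key]
  exact ((h.contDiffAt hy).isSymmSndFDerivAt (by
    rw [minSmoothness_of_isRCLikeNormedField]; exact WithTop.coe_le_coe.mpr le_top)).eq p q

theorem add (hu : IsConic K k u) (hv : IsConic K k v) : IsConic K k (fun y => u y + v y) := by
  obtain ⟨⟨w, hw, h1⟩, h2⟩ := hu
  obtain ⟨⟨w', hw', h1'⟩, h2'⟩ := hv
  refine ⟨⟨fun y => w y + w' y, hw.add hw', fun t x hx => ?_⟩, fun t x hK hx => ?_⟩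
  · simp only [h1 t x hx, h1' t x hx, smul_add]
  · simp only [h2 t x hK hx, h2' t x hK hx]

theorem clm (hu : IsConic K k u) (L : G →L[ℝ] H) : IsConic K k (fun y => L (u y)) := by
  obtain ⟨⟨w, hw, h1⟩, h2⟩ := hu
  refine ⟨⟨fun y => L (w y), L.contDiff.comp hw, fun t x hx => ?_⟩, fun t x hK hx => ?_⟩
  · simp only [h1 t x hx, map_smul]
  · simp only [h2 t x hK hx]

theorem const_smul (hu : IsConic K k u) (c : ℝ) : IsConic K k (fun y => c • u y) :=
  hu.clm (c • ContinuousLinearMap.id ℝ G)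

theorem neg (hu : IsConic K k u) : IsConic K k (fun y => -u y) :=
  hu.clm (-ContinuousLinearMap.id ℝ G)

theorem sub (hu : IsConic K k u) (hv : IsConic K k v) : IsConic K k (fun y => u y - v y) := by
  simpa only [sub_eq_add_neg] using hu.add hv.neg

theorem zero : IsConic K k (fun _ => (0 : G)) :=
  ⟨⟨fun _ => 0, contDiff_const, fun _ _ _ => by simp⟩, fun _ _ _ _ => rfl⟩

theorem sum {ι : Type*} {s : Finset ι} {f : ι → ℝ × Eucl n → G}
    (hf : ∀ i ∈ s, IsConic K k (f i)) : IsConic K k (fun y => ∑ i ∈ s, f i y) := by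
  classical
  induction s using Finset.induction_on with
  | empty => simpa using zero
  | insert a s ha ih =>
    simp only [Finset.sum_insert ha]
    exact (hf a (Finset.mem_insert_self a s)).add
      (ih fun i hi => hf i (Finset.mem_insert_of_mem hi))

theorem smul {f : ℝ × Eucl n → ℝ} (hf : IsConic K k f) (hu : IsConic K l u) :
    IsConic K (k + l) (fun y => f y • u y) := by
  obtain ⟨⟨w, hw, h1⟩, h2⟩ := hf
  obtain ⟨⟨w', hw', h1'⟩, h2'⟩ := hu
  refine ⟨⟨fun y => w y • w' y, hw.smul hw', fun t x hx => ?_⟩, fun t x hK hx => ?_⟩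
  · simp only [h1 t x hx, h1' t x hx, smul_eq_mul, smul_smul, pow_add, mul_inv]
    congr 1; ring
  · simp only [h2 t x hK hx, h2' t x hK hx]

theorem inner {u v : ℝ × Eucl n → F} (hu : IsConic K k u) (hv : IsConic K l v) :
    IsConic K (k + l) (fun y => inner ℝ (u y) (v y)) := by
  obtain ⟨⟨w, hw, h1⟩, h2⟩ := hu
  obtain ⟨⟨w', hw', h1'⟩, h2'⟩ := hv
  refine ⟨⟨fun y => Inner.inner ℝ (w y) (w' y), hw.inner ℝ hw', fun t x hx => ?_⟩,
    fun t x hK hx => ?_⟩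
  · simp only [h1 t x hx, h1' t x hx, smul_eq_mul, inner_smul_left, inner_smul_right, pow_add,
      mul_inv, RCLike.conj_to_real]
    ring
  · simp only [h2 t x hK hx, h2' t x hK hx]

/-- Outside `K` the derivative in the direction of the parameter vanishes. -/
theorem dir_eT_eq_zero (hu : IsConic K k u) {t : ℝ} {x : Eucl n} (hK : x ∉ K) (hx : x ≠ 0) :
    dir eT u (t, x) = 0 := by
  have := dir_time (hu.differentiableAt (y := (t, x)) hx)
  have e : (fun s => u (s, x)) = fun _ => u (0, x) := funext fun s => hu.2 s x hK hx
  rw [e] at this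
  exact this.unique (hasDerivAt_const t _)

theorem dir_eT (hu : IsConic K k u) : IsConic K k (dir eT u) := by
  have hd := hu
  obtain ⟨⟨w, hw, h1⟩, h2⟩ := hu
  refine ⟨⟨fun z => fderiv ℝ w z (1, 0), (hw.fderiv_right (by simp)).clm_apply contDiff_const,
    fun t x hx => ?_⟩, fun t x hK hx => ?_⟩
  · have h3 := dir_time (hd.differentiableAt (y := (t, x)) hx)
    have e : (fun s => u (s, x)) = fun s => (‖x‖ ^ k)⁻¹ • w (s, ‖x‖, ‖x‖⁻¹ • x) :=
      funext fun s => h1 s x hx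
    rw [e] at h3
    have h4 : HasFDerivAt (fun s : ℝ => ((s, ‖x‖, ‖x‖⁻¹ • x) : ℝ × ℝ × Eucl n))
      (ContinuousLinearMap.inl ℝ ℝ (ℝ × Eucl n)) t := hasFDerivAt_prodMk_left t _
    have h5 := (((hw.differentiable (by simp) _).hasFDerivAt.comp t h4).hasDerivAt).const_smul
      ((‖x‖ ^ k)⁻¹)
    have := h3.unique h5
    rw [this]; simp
  · rw [hd.dir_eT_eq_zero hK hx, hd.dir_eT_eq_zero hK hx]

/-- Derivatives in space raise the order by one: with `ρ = |x|` and `θ = x/|x|`, the derivative of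
`ρ⁻ᵏ w(t, ρ, θ)` is `ρ⁻ᵏ⁻¹` times a smooth function of `(t, ρ, θ)`. -/
theorem dir_space (hK : IsClosed K) (hu : IsConic K k u) (e : Eucl n) :
    IsConic K (k + 1) (dir (0, e) u) := by
  have hd := hu
  obtain ⟨⟨w, hw, h1⟩, h2⟩ := hu
  refine ⟨⟨fun z => fderiv ℝ w z (0, z.2.1 * Inner.inner ℝ z.2.2 e,
      e - Inner.inner ℝ z.2.2 e • z.2.2) - ((k : ℝ) * Inner.inner ℝ z.2.2 e) • w z,
    ?_, fun t x hx => ?_⟩, fun t x hxK hx => ?_⟩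
  · have hi : ContDiff ℝ ∞ (fun z : ℝ × ℝ × Eucl n => Inner.inner ℝ z.2.2 e) :=
      contDiff_snd.snd.inner ℝ contDiff_const
    refine ContDiff.sub ?_ ((contDiff_const.mul hi).smul hw)
    refine (hw.fderiv_right (by simp)).clm_apply ?_
    exact contDiff_const.prodMk ((contDiff_snd.fst.mul hi).prodMk
      (contDiff_const.sub (hi.smul contDiff_snd.snd)))
  · rw [dir_slice (hd.differentiableAt (y := (t, x)) hx)]
    have hx0 : ‖x‖ ≠ 0 := norm_ne_zero_iff.mpr hx
    have he : (fun z => u (t, z)) =ᶠ[nhds x]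
        fun z => (‖z‖ ^ k)⁻¹ • w (t, ‖z‖, ‖z‖⁻¹ • z) := by
      filter_upwards [isOpen_ne.mem_nhds hx] with z hz using h1 t z hz
    rw [he.fderiv_eq]
    have hN := hasFDerivAt_norm_of_ne_zero hx
    have hI : HasFDerivAt (fun z : Eucl n => ‖z‖⁻¹)
        (-(‖x‖ ^ 2)⁻¹ • (‖x‖⁻¹ • innerSL ℝ x)) x := (hasDerivAt_inv hx0).comp_hasFDerivAt x hN
    have hP := hasFDerivAt_norm_pow_inv k hx
    have hq : HasFDerivAt (fun z : Eucl n => ((t, ‖z‖, ‖z‖⁻¹ • z) : ℝ × ℝ × Eucl n)) _ x :=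
      (hasFDerivAt_const t x).prodMk (hN.prodMk (hI.smul (hasFDerivAt_id x)))
    have hW := (hw.differentiable (by simp) (t, ‖x‖, ‖x‖⁻¹ • x)).hasFDerivAt.comp x hq
    have := (hP.smul hW).fderiv
    simp only [Function.comp_def] at this
    erw [this]
    simp only [add_apply, smul_apply,
      ContinuousLinearMap.smulRight_apply, ContinuousLinearMap.comp_apply,
      ContinuousLinearMap.prod_apply, innerSL_apply_apply, smul_eq_mul, inner_smul_left,
      RCLike.conj_to_real, zero_apply, ContinuousLinearMap.id_apply]
    rw [smul_sub, sub_eq_add_neg]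
    congr 1
    · have ex : ((0 : ℝ), ‖x‖⁻¹ * Inner.inner ℝ x e,
          ‖x‖⁻¹ • e + (-(‖x‖ ^ 2)⁻¹ * (‖x‖⁻¹ * Inner.inner ℝ x e)) • x) =
          ‖x‖⁻¹ • ((0 : ℝ), ‖x‖ * (‖x‖⁻¹ * Inner.inner ℝ x e),
            e - (‖x‖⁻¹ * Inner.inner ℝ x e) • ‖x‖⁻¹ • x) := by
        simp only [Prod.smul_mk, smul_eq_mul, mul_zero, smul_sub, smul_smul, Prod.mk.injEq,
          true_and]
        refine ⟨by field_simp, ?_⟩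
        rw [sub_eq_add_neg, ← neg_smul]
        congr 2
        field_simp
      rw [ex, map_smul, smul_smul, pow_succ, mul_inv]
    · rw [smul_smul, ← neg_smul]
      congr 1
      field_simp
      ring
  · have hx' : ∀ᶠ z in nhds x, u (t, z) = u (0, z) := by
      filter_upwards [hK.isOpen_compl.mem_nhds hxK, isOpen_ne.mem_nhds hx] with z hz hz0
        using h2 t z hz hz0
    exact dir_slice_congr (hd.differentiableAt hx) (hd.differentiableAt hx) hx' e

theorem bound (h : IsConic K k u) (R : ℝ) : ∃ C, 0 ≤ C ∧ ∀ t x, |t| ≤ R → x ≠ 0 → ‖x‖ ≤ 1 →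
    ‖u (t, x)‖ ≤ C * (‖x‖ ^ k)⁻¹ := by
  obtain ⟨⟨w, hw, hu⟩, -⟩ := h
  have hc : IsCompact (Metric.closedBall (0 : ℝ × ℝ × Eucl n) (max 1 R)) :=
    isCompact_closedBall _ _
  obtain ⟨C, hC⟩ := hc.exists_bound_of_continuousOn hw.continuous.continuousOn
  refine ⟨max C 0, le_max_right _ _, fun t x ht hx hx1 => ?_⟩
  rw [hu t x hx, norm_smul, norm_inv, norm_pow, norm_norm, mul_comm]
  have hx0 : ‖x‖ ≠ 0 := norm_ne_zero_iff.mpr hx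
  refine mul_le_mul_of_nonneg_right (le_trans (hC _ ?_) (le_max_left _ _)) (by positivity)
  rw [mem_closedBall_zero_iff]
  simp only [Prod.norm_def, norm_smul, norm_inv, norm_norm, inv_mul_cancel₀ hx0]
  simp [hx1, ht]
  exact (le_total 1 R).symm.imp ht.trans id

end IsConic

end

/-! ### Integration of conical families over the unit ball -/

section

variable {n : ℕ}
variable {F : Type*} [NormedAddCommGroup F] [InnerProductSpace ℝ F]
variable {G : Type*} [NormedAddCommGroup G] [NormedSpace ℝ G]
variable {H : Type*} [NormedAddCommGroup H] [NormedSpace ℝ H]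

theorem isOpen_unitBall : IsOpen (unitBall n) := Metric.isOpen_ball

theorem integrableOn_norm_pow_inv_iff (hn : 1 ≤ n) (k : ℕ) :
    IntegrableOn (fun x : Eucl n => (‖x‖ ^ k)⁻¹) (unitBall n) ↔ k < n := by
  have : NeZero n := ⟨by omega⟩
  have : Nonempty (Fin n) := ⟨0⟩
  rw [unitBall, integrableOn_fun_norm_addHaar volume (f := fun s : ℝ => (s ^ k)⁻¹),
    finrank_euclideanSpace,
    Fintype.card_fin]
  have e : ∀ y ∈ Set.Ioo (0 : ℝ) 1, y ^ (n - 1) • (y ^ k)⁻¹ = y ^ ((n : ℝ) - 1 - k) := by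
    intro y hy
    rw [Real.rpow_sub hy.1, Real.rpow_natCast, smul_eq_mul, div_eq_mul_inv, ← Real.rpow_natCast,
      Nat.cast_sub hn, Nat.cast_one]
  rw [integrableOn_congr_fun e measurableSet_Ioo,
    intervalIntegral.integrableOn_Ioo_rpow_iff one_pos]
  constructor
  · intro h
    have : (k : ℝ) < n := by linarith
    exact_mod_cast this
  · intro h
    have : (k : ℝ) < n := by exact_mod_cast h
    linarith

instance nontrivial_eucl [NeZero n] : Nontrivial (Eucl n) := by
  have : Nonempty (Fin n) := ⟨0⟩
  infer_instance

theorem mem_unitBall {x : Eucl n} : x ∈ unitBall n ↔ ‖x‖ < 1 := mem_ball_zero_iff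

theorem ae_unitBall (hn : 1 ≤ n) :
    ∀ᵐ x ∂(volume.restrict (unitBall n)), x ≠ 0 ∧ ‖x‖ < 1 := by
  have : NeZero n := ⟨by omega⟩
  filter_upwards [Measure.ae_ne _ (0 : Eucl n),
    ae_restrict_mem isOpen_unitBall.measurableSet] with x h1 h2
  exact ⟨h1, mem_unitBall.mp h2⟩

namespace IsConic

variable {K : Set (Eucl n)} {k l : ℕ} {u v : ℝ × Eucl n → G}

theorem continuousOn_slice (h : IsConic K k u) (t : ℝ) :
    ContinuousOn (fun x => u (t, x)) {x | x ≠ 0} := fun x hx =>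
  ((h.contDiffAt (y := (t, x)) hx).continuousAt.comp
    (Continuous.prodMk_right t).continuousAt).continuousWithinAt

theorem aestronglyMeasurable (hn : 1 ≤ n) (h : IsConic K k u) (t : ℝ) (s : Set (Eucl n)) :
    AEStronglyMeasurable (fun x => u (t, x)) (volume.restrict s) := by
  have : NeZero n := ⟨by omega⟩
  have h1 : AEStronglyMeasurable (fun x => u (t, x)) (volume.restrict {x : Eucl n | x ≠ 0}) :=
    (h.continuousOn_slice t).aestronglyMeasurable isOpen_ne.measurableSet
  have h2 : (volume : Measure (Eucl n)).restrict {x : Eucl n | x ≠ 0} = volume := by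
    have := restrict_compl_singleton (μ := (volume : Measure (Eucl n))) 0
    exact this
  rw [h2] at h1
  exact h1.restrict

theorem norm_le_ae {E : Type*} [NormedAddCommGroup E] (hn : 1 ≤ n) {C : ℝ} {f : Eucl n → E}
    (hC : ∀ x, x ≠ 0 → ‖x‖ ≤ 1 → ‖f x‖ ≤ C * (‖x‖ ^ k)⁻¹) :
    ∀ᵐ x ∂(volume.restrict (unitBall n)), ‖f x‖ ≤ C * (‖x‖ ^ k)⁻¹ := by
  filter_upwards [ae_unitBall hn] with x hx
  exact hC x hx.1 hx.2.le

theorem integrableOn (h : IsConic K k u) (hk : k < n) (t : ℝ) :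
    IntegrableOn (fun x => u (t, x)) (unitBall n) := by
  obtain ⟨C, -, hC⟩ := h.bound |t|
  have hn : 1 ≤ n := by omega
  exact Integrable.mono' (((integrableOn_norm_pow_inv_iff hn k).mpr hk).const_mul C)
    (h.aestronglyMeasurable hn t _) (norm_le_ae hn fun x => hC t x le_rfl)

theorem memLp_two (h : IsConic K k u) (hk : 2 * k < n) (t : ℝ) :
    MemLp (fun x => u (t, x)) 2 (volume.restrict (unitBall n)) := by
  obtain ⟨C, hC0, hC⟩ := h.bound |t|
  have hn : 1 ≤ n := by omega
  rw [memLp_two_iff_integrable_sq_norm (h.aestronglyMeasurable hn t _)]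
  refine Integrable.mono' (((integrableOn_norm_pow_inv_iff hn (2 * k)).mpr hk).const_mul (C ^ 2))
    ((h.aestronglyMeasurable hn t _).norm.pow 2) ?_
  filter_upwards [norm_le_ae hn fun x => hC t x le_rfl] with x hx
  rw [Real.norm_of_nonneg (by positivity)]
  calc ‖u (t, x)‖ ^ 2 ≤ (C * (‖x‖ ^ k)⁻¹) ^ 2 := by gcongr
    _ = C ^ 2 * (‖x‖ ^ (2 * k))⁻¹ := by rw [mul_pow, inv_pow, ← pow_mul, mul_comm k 2]

/-- Differentiation under the integral sign. -/
theorem hasDerivAt_integral [CompleteSpace G] (h : IsConic K k u) (hk : k < n) :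
    HasDerivAt (fun t => ∫ x in unitBall n, u (t, x)) (∫ x in unitBall n, dir eT u (0, x)) 0 := by
  have hn : 1 ≤ n := by omega
  obtain ⟨C, -, hC⟩ := h.dir_eT.bound 1
  refine (hasDerivAt_integral_of_dominated_loc_of_deriv_le (F := fun t x => u (t, x))
    (F' := fun t x => dir eT u (t, x)) (bound := fun x => C * (‖x‖ ^ k)⁻¹)
    (Metric.ball_mem_nhds (0 : ℝ) one_pos)
    (Filter.Eventually.of_forall fun t => h.aestronglyMeasurable hn t _)
    (h.integrableOn hk 0) (h.dir_eT.aestronglyMeasurable hn 0 _) ?_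
    (((integrableOn_norm_pow_inv_iff hn k).mpr hk).const_mul C) ?_).2
  · filter_upwards [ae_unitBall hn] with x hx t ht
    exact hC t x (by simpa using (mem_ball_zero_iff.mp ht).le) hx.1
      hx.2.le
  · filter_upwards [ae_unitBall hn] with x hx t _
    exact dir_time (h.differentiableAt hx.1)

end IsConic

/-! ### Integration by parts across the singularity -/

/-- A smooth radial cut-off, equal to `0` on the ball of radius `δ` and to `1` outside the ball of
radius `√2 δ`. -/
def radialCutoff (δ : ℝ) (x : Eucl n) : ℝ := Real.smoothTransition (‖x‖ ^ 2 / δ ^ 2 - 1)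

theorem contDiff_radialCutoff (δ : ℝ) : ContDiff ℝ ∞ (radialCutoff (n := n) δ) :=
  Real.smoothTransition.contDiff.comp (((contDiff_norm_sq ℝ).div_const _).sub contDiff_const)

theorem exists_bound_deriv_smoothTransition :
    ∃ C, 0 ≤ C ∧ ∀ s, |deriv Real.smoothTransition s| ≤ C ∧
      (1 < s → deriv Real.smoothTransition s = 0) := by
  have hc : Continuous (deriv Real.smoothTransition) :=
    (Real.smoothTransition.contDiff (n := 1)).continuous_deriv le_rfl
  obtain ⟨C, hC⟩ := (isCompact_Icc (a := (0 : ℝ)) (b := 1)).exists_bound_of_continuousOn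
    hc.continuousOn
  have h1 : ∀ s, 1 < s → deriv Real.smoothTransition s = 0 := by
    intro s hs
    have : Real.smoothTransition =ᶠ[nhds s] fun _ => 1 := by
      filter_upwards [lt_mem_nhds hs] with z hz using Real.smoothTransition.one_of_one_le hz.le
    rw [this.deriv_eq]; simp
  have h0 : ∀ s, s < 0 → deriv Real.smoothTransition s = 0 := by
    intro s hs
    have : Real.smoothTransition =ᶠ[nhds s] fun _ => 0 := by
      filter_upwards [gt_mem_nhds hs] with z hz using Real.smoothTransition.zero_of_nonpos hz.le
    rw [this.deriv_eq]; simp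
  refine ⟨max C 0, le_max_right _ _, fun s => ⟨?_, h1 s⟩⟩
  rcases lt_or_ge s 0 with hs | hs
  · rw [h0 s hs]; simp
  · rcases lt_or_ge 1 s with hs' | hs'
    · rw [h1 s hs']; simp
    · exact (hC s ⟨hs, hs'⟩).trans (le_max_left _ _)

/-- The derivative of the cut-offs is bounded by a multiple of `|x|⁻¹`, uniformly in the radius. -/
theorem exists_bound_fderiv_radialCutoff (e : Eucl n) :
    ∃ C, 0 ≤ C ∧ ∀ δ, 0 < δ → ∀ x : Eucl n, x ≠ 0 →
      |fderiv ℝ (radialCutoff δ) x e| ≤ C * ‖x‖⁻¹ ∧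
      (2 * δ ^ 2 < ‖x‖ ^ 2 → fderiv ℝ (radialCutoff δ) x e = 0) := by
  obtain ⟨C, hC0, hC⟩ := exists_bound_deriv_smoothTransition
  refine ⟨C * (4 * ‖e‖), by positivity, fun δ hδ x hx => ?_⟩
  have h1 : HasFDerivAt (fun z : Eucl n => ‖z‖ ^ 2 / δ ^ 2 - 1)
      ((δ ^ 2)⁻¹ • ((2 : ℕ) • innerSL ℝ x)) x := by
    have := ((hasStrictFDerivAt_norm_sq x).hasFDerivAt.const_mul ((δ ^ 2)⁻¹)).sub_const 1
    refine this.congr_of_eventuallyEq (Filter.Eventually.of_forall fun z => ?_)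
    simp only; ring
  have h2 := ((Real.smoothTransition.contDiff (n := 1)).differentiable (by simp)
    (‖x‖ ^ 2 / δ ^ 2 - 1)).hasDerivAt.comp_hasFDerivAt x h1
  have h3 : fderiv ℝ (radialCutoff δ) x e = deriv Real.smoothTransition (‖x‖ ^ 2 / δ ^ 2 - 1) *
      ((δ ^ 2)⁻¹ * (2 * inner ℝ x e)) := by
    have h2' : HasFDerivAt (radialCutoff δ) _ x := h2
    rw [h2'.fderiv]; simp
  have hx0 : 0 < ‖x‖ := norm_pos_iff.mpr hx
  have hz : 2 * δ ^ 2 < ‖x‖ ^ 2 → deriv Real.smoothTransition (‖x‖ ^ 2 / δ ^ 2 - 1) = 0 := by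
    intro h
    refine (hC _).2 ?_
    rw [lt_sub_iff_add_lt, lt_div_iff₀ (by positivity)]; linarith
  refine ⟨?_, fun h => by rw [h3, hz h, zero_mul]⟩
  rcases lt_or_ge (2 * δ ^ 2) (‖x‖ ^ 2) with h | h
  · rw [h3, hz h]; simp; positivity
  · rw [h3, abs_mul, mul_assoc]
    refine mul_le_mul (hC _).1 ?_ (abs_nonneg _) hC0
    rw [abs_mul, abs_mul, abs_of_pos (by positivity : 0 < (δ ^ 2)⁻¹), abs_two]
    have hd : (δ ^ 2)⁻¹ ≤ 2 * (‖x‖ ^ 2)⁻¹ := by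
      rw [inv_le_comm₀ (by positivity) (by positivity), mul_inv, inv_inv]; linarith
    calc (δ ^ 2)⁻¹ * (2 * |inner ℝ x e|) ≤ (2 * (‖x‖ ^ 2)⁻¹) * (2 * (‖x‖ * ‖e‖)) := by
          gcongr; exact abs_real_inner_le_norm x e
      _ = 4 * ‖e‖ * ‖x‖⁻¹ := by field_simp; ring

theorem integral_fderiv_eq_zero_of_hasCompactSupport [CompleteSpace G] {g : Eucl n → G}
    (hg : ContDiff ℝ 1 g) (hc : HasCompactSupport g) (e : Eucl n) :
    ∫ x, fderiv ℝ g x e = 0 := by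
  have hd : Continuous fun x => fderiv ℝ g x e :=
    (hg.continuous_fderiv (by simp)).clm_apply continuous_const
  have hcd : HasCompactSupport fun x => fderiv ℝ g x e := hc.fderiv_apply ℝ e
  have := integral_smul_fderiv_eq_neg_fderiv_smul_of_integrable (μ := (volume : Measure (Eucl n)))
    (f := fun _ : Eucl n => (1 : ℝ)) (g := g) (v := e) (by simp)
    (by simpa using hd.integrable_of_hasCompactSupport hcd)
    (by simpa using hg.continuous.integrable_of_hasCompactSupport hc)
    (fun x _ => differentiableAt_const _) (fun x _ => hg.differentiable (by simp) x)
  simpa using this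

/-- The integral of a derivative vanishes, even across the singularity at the origin, if the order
of the singularity is less than `n - 1`. -/
theorem IsConic.integral_dir_eq_zero [CompleteSpace G] {K : Set (Eucl n)} {k : ℕ}
    {u : ℝ × Eucl n → G} (hK : IsClosed K) (hu : IsConic K k u) (hk : k + 1 < n) (e : Eucl n)
    (t : ℝ) {S : Set (Eucl n)} (hS : IsCompact S) (hSB : S ⊆ unitBall n)
    (h0 : ∀ x, x ∉ S → x ≠ 0 → u (t, x) = 0) :
    ∫ x in unitBall n, dir (0, e) u (t, x) = 0 := by
  have hn : 1 ≤ n := by omega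
  obtain ⟨C, hC0, hC⟩ := hu.bound |t|
  obtain ⟨C', hC'0, hC'⟩ := (hu.dir_space hK e).bound |t|
  obtain ⟨D, hD0, hD⟩ := exists_bound_fderiv_radialCutoff e
  -- cut off the ball of radius `δ m` and let `m` tend to infinity
  set δ : ℕ → ℝ := fun m => 1 / ((m : ℝ) + 1) with hδ
  have hδ0 : ∀ m, 0 < δ m := fun m => by positivity
  have hδlim : Filter.Tendsto δ Filter.atTop (nhds 0) := tendsto_one_div_add_atTop_nhds_zero_nat
  set g : ℕ → Eucl n → G := fun m x => radialCutoff (δ m) x • u (t, x) with hg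
  have hcut0 : ∀ m, ∀ x ∈ Metric.ball (0 : Eucl n) (δ m), radialCutoff (δ m) x = 0 := by
    intro m x hx
    refine Real.smoothTransition.zero_of_nonpos ?_
    rw [mem_ball_zero_iff] at hx
    rw [sub_nonpos, div_le_one (by have := hδ0 m; positivity)]
    gcongr
  have hgs : ∀ m, ContDiff ℝ 1 (g m) := by
    intro m
    rw [contDiff_iff_contDiffAt]
    intro x
    by_cases hx : x = 0
    · have : g m =ᶠ[nhds x] fun _ => 0 := by
        filter_upwards [Metric.isOpen_ball.mem_nhds (by simpa [hx] using hδ0 m :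
          x ∈ Metric.ball (0 : Eucl n) (δ m))] with z hz
        simp [hg, hcut0 m z hz]
      exact contDiffAt_const.congr_of_eventuallyEq this
    · have h1 : ContDiffAt ℝ 1 u (t, x) := (hu.contDiffAt hx).of_le (by simp)
      have h2 : ContDiffAt ℝ 1 (fun z : Eucl n => ((t, z) : ℝ × Eucl n)) x :=
        (contDiff_prodMk_right t).contDiffAt
      exact ((contDiff_radialCutoff (δ m)).contDiffAt.of_le (by simp)).smul (h1.comp x h2)
  have hgz : ∀ m x, x ∉ S → g m x = 0 := by
    intro m x hx
    by_cases hx0 : x = 0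
    · simp only [hg]; rw [hcut0 m x (by simpa [hx0] using hδ0 m), zero_smul]
    · simp only [hg, h0 x hx hx0, smul_zero]
  have hgc : ∀ m, HasCompactSupport (g m) := fun m => HasCompactSupport.intro hS (hgz m)
  have hgd : ∀ m x, x ≠ 0 → fderiv ℝ (g m) x e =
      fderiv ℝ (radialCutoff (δ m)) x e • u (t, x) +
        radialCutoff (δ m) x • dir (0, e) u (t, x) := by
    intro m x hx
    have hd := hu.differentiableAt (y := (t, x)) hx
    have h1 : HasFDerivAt (fun z => u (t, z)) (fderiv ℝ (fun z => u (t, z)) x) x :=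
      (DifferentiableAt.comp x hd
        (differentiableAt_const t |>.prodMk differentiableAt_id)).hasFDerivAt
    have h2 := (((contDiff_radialCutoff (δ m)).differentiable (by simp)
      x).hasFDerivAt.smul h1).fderiv
    have h3 : fderiv ℝ (g m) x = _ := h2
    rw [h3, dir_slice hd]
    simp [add_comm]
  have hint : ∀ m, ∫ x in unitBall n, fderiv ℝ (g m) x e = 0 := by
    intro m
    rw [setIntegral_eq_integral_of_forall_compl_eq_zero]
    · exact integral_fderiv_eq_zero_of_hasCompactSupport (hgs m) (hgc m) e
    · intro x hx
      have : x ∉ tsupport (g m) := fun h =>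
        hx (hSB ((closure_minimal (fun y hy => by
          by_contra hyS; exact hy (hgz m y hyS)) hS.isClosed) h))
      rw [fderiv_of_notMem_tsupport ℝ this]; simp
  have hlim : Filter.Tendsto (fun m => ∫ x in unitBall n, fderiv ℝ (g m) x e) Filter.atTop
      (nhds (∫ x in unitBall n, dir (0, e) u (t, x))) := by
    -- the term with the derivative of the cut-off is dominated as `|x| |∇χ|` is bounded
    refine tendsto_integral_of_dominated_convergence
      (fun x => (D * C + C') * (‖x‖ ^ (k + 1))⁻¹)
      (fun m => (((hgs m).continuous_fderiv (by simp)).clm_apply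
        continuous_const).aestronglyMeasurable)
      (((integrableOn_norm_pow_inv_iff hn (k + 1)).mpr hk).const_mul _) (fun m => ?_) ?_
    · filter_upwards [ae_unitBall hn] with x hx
      have hx1 : ‖x‖ ≤ 1 := hx.2.le
      rw [hgd m x hx.1]
      refine (norm_add_le _ _).trans ?_
      rw [norm_smul, norm_smul, add_mul]
      refine add_le_add ?_ ?_
      · calc _ ≤ (D * ‖x‖⁻¹) * (C * (‖x‖ ^ k)⁻¹) :=
            mul_le_mul (hD _ (hδ0 m) x hx.1).1 (hC t x le_rfl hx.1 hx1) (norm_nonneg _)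
              (by positivity)
          _ = _ := by rw [pow_succ, mul_inv]; ring
      · calc _ ≤ 1 * (C' * (‖x‖ ^ (k + 1))⁻¹) := by
              refine mul_le_mul ?_ (hC' t x le_rfl hx.1 hx1) (norm_nonneg _) zero_le_one
              rw [radialCutoff, Real.norm_of_nonneg (Real.smoothTransition.nonneg _)]
              exact Real.smoothTransition.le_one _
          _ = _ := one_mul _
    · filter_upwards [ae_unitBall hn] with x hx
      refine Filter.Tendsto.congr' ?_ tendsto_const_nhds
      have hx0 : 0 < ‖x‖ := norm_pos_iff.mpr hx.1
      have : Filter.Tendsto (fun m => 2 * δ m ^ 2) Filter.atTop (nhds 0) := by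
        simpa using (hδlim.pow 2).const_mul 2
      filter_upwards [this.eventually (gt_mem_nhds (by positivity : 0 < ‖x‖ ^ 2))] with m hm
      rw [hgd m x hx.1, (hD _ (hδ0 m) x hx.1).2 hm, zero_smul, zero_add, radialCutoff,
        Real.smoothTransition.one_of_one_le, one_smul]
      rw [le_sub_iff_add_le, le_div_iff₀ (by have := hδ0 m; positivity)]
      linarith
  simp only [hint] at hlim
  exact (tendsto_nhds_unique tendsto_const_nhds hlim).symm

end

/-! ### Weak derivatives -/

section

variable {n : ℕ}
variable {F : Type*} [NormedAddCommGroup F] [InnerProductSpace ℝ F]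
variable {G : Type*} [NormedAddCommGroup G] [NormedSpace ℝ G]
variable {H : Type*} [NormedAddCommGroup H] [InnerProductSpace ℝ H]

theorem IsTestFunction.fderiv_apply {Ω : Set (Eucl n)} {ψ : Eucl n → G} (h : IsTestFunction Ω ψ)
    (e : Eucl n) : IsTestFunction Ω (fun x => fderiv ℝ ψ x e) := by
  refine ⟨(h.1.fderiv_right (by simp)).clm_apply contDiff_const, h.2.1.fderiv_apply ℝ e, ?_⟩
  exact (tsupport_fderiv_apply_subset ℝ e).trans h.2.2

theorem IsTestFunction.mono {Ω Ω' : Set (Eucl n)} {ψ : Eucl n → G} (h : IsTestFunction Ω ψ)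
    (hs : Ω ⊆ Ω') : IsTestFunction Ω' ψ := ⟨h.1, h.2.1, h.2.2.trans hs⟩

theorem IsTestFunction.eq_zero {Ω : Set (Eucl n)} {ψ : Eucl n → G} (h : IsTestFunction Ω ψ)
    {x : Eucl n} (hx : x ∉ Ω) : ψ x = 0 := image_eq_zero_of_notMem_tsupport fun h' => hx (h.2.2 h')

theorem IsTestFunction.integrable_smul {Ω : Set (Eucl n)} {ψ : Eucl n → ℝ}
    (h : IsTestFunction Ω ψ) {v : Eucl n → G} (hv : LocallyIntegrableOn v Ω) :
    Integrable (fun x => ψ x • v x) := by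
  have h1 : IntegrableOn v (tsupport ψ) := hv.integrableOn_compact_subset h.2.2 h.2.1
  have h2 : IntegrableOn (fun x => ψ x • v x) (tsupport ψ) :=
    h1.continuousOn_smul h.1.continuous.continuousOn h.2.1
  refine h2.integrable_of_forall_notMem_eq_zero fun x hx => ?_
  rw [image_eq_zero_of_notMem_tsupport hx, zero_smul]

theorem IsTestFunction.setIntegral_smul {Ω : Set (Eucl n)} {ψ : Eucl n → ℝ}
    (h : IsTestFunction Ω ψ) (v : Eucl n → G) : ∫ x in Ω, ψ x • v x = ∫ x, ψ x • v x :=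
  setIntegral_eq_integral_of_forall_compl_eq_zero fun x hx => by rw [h.eq_zero hx, zero_smul]

namespace HasWeakPartial

variable {Ω : Set (Eucl n)} {i : Fin n} {u v v' u' : Eucl n → F}

theorem ae_unique [CompleteSpace F] (hΩ : IsOpen Ω) (h : HasWeakPartial Ω i u v)
    (h' : HasWeakPartial Ω i u v') : v =ᵐ[volume.restrict Ω] v' := by
  have := hΩ.ae_eq_zero_of_integral_contDiff_smul_eq_zero (μ := volume) (f := v - v')
    (h.2.1.sub h'.2.1) (fun ψ h1 h2 h3 => ?_)
  · filter_upwards [(ae_restrict_iff' hΩ.measurableSet).mpr this] with x hx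
    exact sub_eq_zero.mp hx
  · have hψ : IsTestFunction Ω ψ := ⟨h1, h2, h3⟩
    have e1 := h.2.2 ψ hψ
    rw [h'.2.2 ψ hψ, neg_inj, hψ.setIntegral_smul, hψ.setIntegral_smul] at e1
    simp only [Pi.sub_apply, smul_sub]
    rw [integral_sub (hψ.integrable_smul h.2.1) (hψ.integrable_smul h'.2.1), e1, sub_self]

theorem congr_left (h : HasWeakPartial Ω i u v) (e : u =ᵐ[volume.restrict Ω] u') :
    HasWeakPartial Ω i u' v := by
  refine ⟨h.1.congr e, h.2.1, fun ψ hψ => ?_⟩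
  rw [← h.2.2 ψ hψ]
  refine integral_congr_ae ?_
  filter_upwards [e] with x hx
  rw [hx]

theorem mono (h : HasWeakPartial Ω i u v) {Ω' : Set (Eucl n)} (hs : Ω' ⊆ Ω) :
    HasWeakPartial Ω' i u v := by
  refine ⟨h.1.mono_set hs, h.2.1.mono_set hs, fun ψ hψ => ?_⟩
  have := h.2.2 ψ (hψ.mono hs)
  rwa [(hψ.mono hs).setIntegral_smul, ((hψ.mono hs).fderiv_apply _).setIntegral_smul,
    ← hψ.setIntegral_smul, ← (hψ.fderiv_apply _).setIntegral_smul] at this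

theorem add (h : HasWeakPartial Ω i u v) (h' : HasWeakPartial Ω i u' v') :
    HasWeakPartial Ω i (fun x => u x + u' x) (fun x => v x + v' x) := by
  refine ⟨h.1.add h'.1, h.2.1.add h'.2.1, fun ψ hψ => ?_⟩
  have hd := hψ.fderiv_apply (EuclideanSpace.single i 1)
  simp only [smul_add]
  rw [integral_add (hd.integrable_smul h.1).integrableOn (hd.integrable_smul h'.1).integrableOn,
    integral_add (hψ.integrable_smul h.2.1).integrableOn (hψ.integrable_smul h'.2.1).integrableOn,
    h.2.2 ψ hψ, h'.2.2 ψ hψ, neg_add]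

theorem clm [CompleteSpace F] [CompleteSpace H] (h : HasWeakPartial Ω i u v) (L : F →L[ℝ] H) :
    HasWeakPartial Ω i (fun x => L (u x)) (fun x => L (v x)) := by
  refine ⟨L.locallyIntegrableOn_comp h.1, L.locallyIntegrableOn_comp h.2.1, fun ψ hψ => ?_⟩
  have hd := hψ.fderiv_apply (EuclideanSpace.single i 1)
  simp only [← map_smul]
  rw [L.integral_comp_comm (hd.integrable_smul h.1).integrableOn,
    L.integral_comp_comm (hψ.integrable_smul h.2.1).integrableOn, h.2.2 ψ hψ, map_neg]

end HasWeakPartial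

/-- The classical derivative of a conical family of order `k < n - 1` is its weak derivative. -/
theorem IsConic.hasWeakPartial [CompleteSpace F] {K : Set (Eucl n)} {k : ℕ} {u : ℝ × Eucl n → F}
    (hK : IsClosed K) (hu : IsConic K k u) (hk : k + 1 < n) (t : ℝ) (i : Fin n) :
    HasWeakPartial (unitBall n) i (fun x => u (t, x)) (fun x => dir (eX i) u (t, x)) := by
  have hn : 1 ≤ n := by omega
  refine ⟨(hu.integrableOn (by omega) t).locallyIntegrableOn,
    ((hu.dir_space hK _).integrableOn hk t).locallyIntegrableOn, fun ψ hψ => ?_⟩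
  have hψc : IsConic K 0 (fun y : ℝ × Eucl n => ψ y.2) := by
    refine ⟨⟨fun z => ψ (z.2.1 • z.2.2), hψ.1.comp (contDiff_snd.fst.smul contDiff_snd.snd),
      fun t x hx => ?_⟩, fun _ _ _ _ => rfl⟩
    simp [smul_smul, mul_inv_cancel₀ (norm_ne_zero_iff.mpr hx)]
  have hc := (hψc.smul hu)
  have h0 := hc.integral_dir_eq_zero hK (by omega) (EuclideanSpace.single i 1) t hψ.2.1 hψ.2.2
    (fun x hx _ => by simp [image_eq_zero_of_notMem_tsupport hx])
  have hd := hψ.fderiv_apply (EuclideanSpace.single i 1)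
  have i1 := hd.integrable_smul (hu.integrableOn (by omega) t).locallyIntegrableOn
  have i2 := hψ.integrable_smul ((hu.dir_space hK (EuclideanSpace.single i 1)).integrableOn hk
    t).locallyIntegrableOn
  rw [eq_neg_iff_add_eq_zero]
  change (∫ x in unitBall n, fderiv ℝ ψ x (EuclideanSpace.single i 1) • u (t, x)) +
    ∫ x in unitBall n, ψ x • dir (0, EuclideanSpace.single i 1) u (t, x) = 0
  rw [← integral_add i1.integrableOn i2.integrableOn]
  refine Eq.trans (integral_congr_ae ?_) h0
  filter_upwards [ae_unitBall hn] with x hx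
  have hdu := hu.differentiableAt (y := (t, x)) hx.1
  have h1 : HasFDerivAt (fun z => u (t, z)) (fderiv ℝ (fun z => u (t, z)) x) x :=
    (DifferentiableAt.comp x hdu
      (differentiableAt_const t |>.prodMk differentiableAt_id)).hasFDerivAt
  have h2 := ((hψ.1.differentiable (by simp) x).hasFDerivAt.smul h1).fderiv
  have h3 : fderiv ℝ (fun z => ψ z • u (t, z)) x = _ := h2
  rw [dir_slice (hc.differentiableAt (y := (t, x)) hx.1), h3, dir_slice hdu]
  simp [add_comm]

theorem IsConic.weakPartial_ae_eq [CompleteSpace F] {K : Set (Eucl n)} {k : ℕ}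
    {u : ℝ × Eucl n → F} (hK : IsClosed K) (hu : IsConic K k u) (hk : k + 1 < n) {t : ℝ}
    {f : Eucl n → F} (hf : f =ᵐ[volume.restrict (unitBall n)] fun x => u (t, x)) (i : Fin n) :
    weakPartial (unitBall n) i f =ᵐ[volume.restrict (unitBall n)]
      fun x => dir (eX i) u (t, x) := by
  have h := (hu.hasWeakPartial hK hk t i).congr_left hf.symm
  have hex : ∃ v, HasWeakPartial (unitBall n) i f v := ⟨_, h⟩
  rw [weakPartial, dif_pos hex]
  exact hex.choose_spec.ae_unique isOpen_unitBall h

/-! ### Sobolev spaces -/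

theorem MemSobolev.mono {Ω : Set (Eucl n)} {k l : ℕ} (hlk : l ≤ k) {u : Eucl n → F}
    (h : MemSobolev Ω k u) : MemSobolev Ω l u := by
  induction k generalizing l u with
  | zero => rwa [Nat.le_zero.mp hlk]
  | succ k ih =>
    rcases l with _ | l
    · exact h.1
    · refine ⟨h.1, fun i => ?_⟩
      obtain ⟨v, hv, hv'⟩ := h.2 i
      exact ⟨v, hv, ih (by omega) hv'⟩

theorem MemSobolev.memLp {Ω : Set (Eucl n)} {k : ℕ} {u : Eucl n → F}
    (h : MemSobolev Ω k u) : MemLp u 2 (volume.restrict Ω) := h.mono (Nat.zero_le k)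

theorem MemSobolev.congr {Ω : Set (Eucl n)} {k : ℕ} {u u' : Eucl n → F}
    (h : MemSobolev Ω k u) (e : u =ᵐ[volume.restrict Ω] u') : MemSobolev Ω k u' := by
  rcases k with _ | k
  · exact (memLp_congr_ae e).mp h
  · refine ⟨(memLp_congr_ae e).mp h.1, fun i => ?_⟩
    obtain ⟨v, hv, hv'⟩ := h.2 i
    exact ⟨v, hv.congr_left e, hv'⟩

theorem MemSobolev.add {Ω : Set (Eucl n)} {k : ℕ} {u u' : Eucl n → F}
    (h : MemSobolev Ω k u) (h' : MemSobolev Ω k u') : MemSobolev Ω k (fun x => u x + u' x) := by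
  induction k generalizing u u' with
  | zero => exact MemLp.add h h'
  | succ k ih =>
    refine ⟨h.1.add h'.1, fun i => ?_⟩
    obtain ⟨v, hv, hv2⟩ := h.2 i
    obtain ⟨v', hv', hv2'⟩ := h'.2 i
    exact ⟨_, hv.add hv', ih hv2 hv2'⟩

theorem MemSobolev.clm [CompleteSpace F] [CompleteSpace H] {Ω : Set (Eucl n)} {k : ℕ}
    {u : Eucl n → F} (h : MemSobolev Ω k u) (L : F →L[ℝ] H) :
    MemSobolev Ω k (fun x => L (u x)) := by
  induction k generalizing u with
  | zero => exact L.comp_memLp' h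
  | succ k ih =>
    refine ⟨L.comp_memLp' h.1, fun i => ?_⟩
    obtain ⟨v, hv, hv2⟩ := h.2 i
    exact ⟨_, hv.clm L, ih hv2⟩

theorem MemSobolev.zero {Ω : Set (Eucl n)} {k : ℕ} : MemSobolev Ω k (fun _ => (0 : F)) := by
  induction k with
  | zero => exact MemLp.zero
  | succ k ih =>
    exact ⟨MemLp.zero, fun i => ⟨fun _ => 0, ⟨locallyIntegrableOn_zero, locallyIntegrableOn_zero,
      fun ψ _ => by simp⟩, ih⟩⟩

theorem MemSobolev.sum {Ω : Set (Eucl n)} {k : ℕ} {ι : Type*} (s : Finset ι)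
    {f : ι → Eucl n → F} (h : ∀ i ∈ s, MemSobolev Ω k (f i)) :
    MemSobolev Ω k (fun x => ∑ i ∈ s, f i x) := by
  classical
  induction s using Finset.induction_on with
  | empty => simpa using MemSobolev.zero
  | insert a s ha ih =>
    simp only [Finset.sum_insert ha]
    exact (h a (Finset.mem_insert_self a s)).add
      (ih fun i hi => h i (Finset.mem_insert_of_mem hi))

theorem IsConic.memSobolev [CompleteSpace F] {K : Set (Eucl n)} {k j : ℕ} {u : ℝ × Eucl n → F}
    (hK : IsClosed K) (hu : IsConic K k u) (hk : 2 * (k + j) < n) (t : ℝ) :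
    MemSobolev (unitBall n) j (fun x => u (t, x)) := by
  induction j generalizing k u with
  | zero => exact hu.memLp_two (by omega) t
  | succ j ih =>
    exact ⟨hu.memLp_two (by omega) t, fun i => ⟨_, hu.hasWeakPartial hK (by omega) t i,
      ih (hu.dir_space hK _) (by omega)⟩⟩

end

/-! ### Covariant calculus along a family of sphere-valued maps -/

section

variable {n : ℕ}
variable {F : Type*} [NormedAddCommGroup F] [InnerProductSpace ℝ F]

/-- The covariant derivative along the family `Φ` of maps into the unit sphere, in the direction `p`
of `ℝ × ℝⁿ`. It treats the parameter and the coordinates of `ℝⁿ` on the same footing. -/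
def cov (Φ : ℝ × Eucl n → F) (p : ℝ × Eucl n) (A : ℝ × Eucl n → F) (y : ℝ × Eucl n) : F :=
  tangentProj (Φ y) (dir p A y)

/-- A conical family of order `0` of maps into the unit sphere. -/
structure IsSphereFamily (K : Set (Eucl n)) (Φ : ℝ × Eucl n → F) : Prop where
  conic : IsConic K 0 Φ
  norm_eq : ∀ y, y.2 ≠ 0 → ‖Φ y‖ = 1

/-- `A` is a section of the pull-back of the tangent bundle of the sphere by `Φ`. -/
def IsTangent (Φ A : ℝ × Eucl n → F) : Prop := ∀ y, y.2 ≠ 0 → inner ℝ (A y) (Φ y) = 0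

theorem inner_tangentProj_self {p : F} (hp : ‖p‖ = 1) (v : F) :
    inner ℝ (tangentProj p v) p = 0 := by
  rw [tangentProj, inner_sub_left, inner_smul_left, real_inner_self_eq_norm_sq, hp]; simp

theorem inner_tangentProj_of_orthogonal {p b : F} (hb : inner ℝ b p = 0) (v : F) :
    inner ℝ (tangentProj p v) b = inner ℝ v b := by
  rw [tangentProj, inner_sub_left, inner_smul_left, real_inner_comm b p, hb]; simp

theorem tangentProj_of_orthogonal {p b : F} (hb : inner ℝ b p = 0) : tangentProj p b = b := by
  rw [tangentProj, hb, zero_smul, sub_zero]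

theorem tangentProj_add (p v w : F) :
    tangentProj p (v + w) = tangentProj p v + tangentProj p w := by
  simp only [tangentProj, inner_add_left, add_smul]; abel

theorem tangentProj_smul (p v : F) (c : ℝ) : tangentProj p (c • v) = c • tangentProj p v := by
  simp only [tangentProj, inner_smul_left, smul_sub, smul_smul, RCLike.conj_to_real]

theorem tangentProj_self {p : F} (hp : ‖p‖ = 1) : tangentProj p p = 0 := by
  rw [tangentProj, real_inner_self_eq_norm_sq, hp]; simp

theorem tangentProj_zero (p : F) : tangentProj p 0 = 0 := by simp [tangentProj]

theorem tangentProj_neg (p v : F) : tangentProj p (-v) = -tangentProj p v := by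
  simpa using tangentProj_smul p v (-1)

theorem tangentProj_sum {ι : Type*} (s : Finset ι) (p : F) (f : ι → F) :
    tangentProj p (∑ i ∈ s, f i) = ∑ i ∈ s, tangentProj p (f i) := by
  simp only [tangentProj, sum_inner, Finset.sum_smul, Finset.sum_sub_distrib]

section Pointwise

variable {p q y : ℝ × Eucl n} {Φ A B : ℝ × Eucl n → F}

theorem dir_inner (hA : DifferentiableAt ℝ A y) (hB : DifferentiableAt ℝ B y) :
    dir p (fun z => (inner ℝ (A z) (B z) : ℝ)) y =
      inner ℝ (dir p A y) (B y) + inner ℝ (A y) (dir p B y) := by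
  rw [dir, fderiv_inner_apply ℝ hA hB, add_comm]; rfl

theorem dir_smul {f : ℝ × Eucl n → ℝ} (hf : DifferentiableAt ℝ f y) (hB : DifferentiableAt ℝ B y) :
    dir p (fun z => f z • B z) y = dir p f y • B y + f y • dir p B y := by
  rw [dir, fderiv_fun_smul hf hB]; simp [dir, add_comm]

theorem dir_add (hA : DifferentiableAt ℝ A y) (hB : DifferentiableAt ℝ B y) :
    dir p (fun z => A z + B z) y = dir p A y + dir p B y := by
  rw [dir, fderiv_fun_add hA hB]; rfl

theorem dir_sum {ι : Type*} {s : Finset ι} {f : ι → ℝ × Eucl n → F}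
    (hf : ∀ i ∈ s, DifferentiableAt ℝ (f i) y) :
    dir p (fun z => ∑ i ∈ s, f i z) y = ∑ i ∈ s, dir p (f i) y := by
  rw [dir, fderiv_fun_sum hf]; simp [dir]

theorem dir_const_smul (c : ℝ) (hA : DifferentiableAt ℝ A y) :
    dir p (fun z => c • A z) y = c • dir p A y := by
  rw [dir, fderiv_fun_const_smul hA]; rfl

theorem cov_add (hA : DifferentiableAt ℝ A y) (hB : DifferentiableAt ℝ B y) :
    cov Φ p (fun z => A z + B z) y = cov Φ p A y + cov Φ p B y := by
  rw [cov, dir_add hA hB, tangentProj_add]; rfl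

theorem cov_sum {ι : Type*} {s : Finset ι} {f : ι → ℝ × Eucl n → F}
    (hf : ∀ i ∈ s, DifferentiableAt ℝ (f i) y) :
    cov Φ p (fun z => ∑ i ∈ s, f i z) y = ∑ i ∈ s, cov Φ p (f i) y := by
  rw [cov, dir_sum hf, tangentProj_sum]; rfl

theorem cov_const_smul (c : ℝ) (hA : DifferentiableAt ℝ A y) :
    cov Φ p (fun z => c • A z) y = c • cov Φ p A y := by
  rw [cov, dir_const_smul c hA, tangentProj_smul]; rfl

theorem cov_neg : cov Φ p (fun z => -A z) y = -cov Φ p A y := by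
  rw [cov, dir, fderiv_fun_neg]; exact tangentProj_neg _ _

theorem cov_congr (h : ∀ y, y.2 ≠ 0 → A y = B y) (hy : y.2 ≠ 0) : cov Φ p A y = cov Φ p B y := by
  rw [cov, cov, dir_congr h p hy]

theorem inner_cov (hB : inner ℝ (B y) (Φ y) = 0) :
    inner ℝ (cov Φ p A y) (B y) = inner ℝ (dir p A y) (B y) := inner_tangentProj_of_orthogonal hB _

/-- Metric compatibility, at a point where both sections are tangent. -/
theorem dir_inner_eq_cov (hA : DifferentiableAt ℝ A y) (hB : DifferentiableAt ℝ B y)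
    (hAT : inner ℝ (A y) (Φ y) = 0) (hBT : inner ℝ (B y) (Φ y) = 0) :
    dir p (fun z => (inner ℝ (A z) (B z) : ℝ)) y =
      inner ℝ (cov Φ p A y) (B y) + inner ℝ (A y) (cov Φ p B y) := by
  rw [dir_inner hA hB, inner_cov hBT, real_inner_comm (cov Φ p B y), inner_cov hAT,
    real_inner_comm (A y)]

end Pointwise

namespace IsSphereFamily

variable {K : Set (Eucl n)} {k : ℕ} {Φ A : ℝ × Eucl n → F} {p q y : ℝ × Eucl n}

theorem cov_tangent (hΦ : IsSphereFamily K Φ) (p : ℝ × Eucl n) (A : ℝ × Eucl n → F) :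
    IsTangent Φ (cov Φ p A) := fun y hy => inner_tangentProj_self (hΦ.norm_eq y hy) _

theorem conic_tangentProj (hΦ : IsSphereFamily K Φ) (hA : IsConic K k A) :
    IsConic K k (fun y => tangentProj (Φ y) (A y)) := by
  have := hA.sub ((hA.inner hΦ.conic).smul hΦ.conic)
  exact this

theorem conic_cov_eX (hK : IsClosed K) (hΦ : IsSphereFamily K Φ) (hA : IsConic K k A)
    (i : Fin n) : IsConic K (k + 1) (cov Φ (eX i) A) := hΦ.conic_tangentProj (hA.dir_space hK _)

theorem conic_cov_eT (hΦ : IsSphereFamily K Φ) (hA : IsConic K k A) :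
    IsConic K k (cov Φ eT A) := hΦ.conic_tangentProj hA.dir_eT

theorem inner_dir_self (hΦ : IsSphereFamily K Φ) (p : ℝ × Eucl n) (hy : y.2 ≠ 0) :
    inner ℝ (dir p Φ y) (Φ y) = 0 := by
  have h1 : dir p (fun z => (inner ℝ (Φ z) (Φ z) : ℝ)) y = dir p (fun _ => (1 : ℝ)) y :=
    dir_congr (fun z hz => by rw [real_inner_self_eq_norm_sq, hΦ.norm_eq z hz, one_pow]) p hy
  have hd := hΦ.conic.differentiableAt hy
  rw [dir_inner hd hd, real_inner_comm (dir p Φ y)] at h1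
  simp only [dir, fderiv_fun_const] at h1
  simp only [Pi.zero_apply, zero_apply] at h1
  rw [dir]
  linarith

theorem cov_eq (hΦ : IsSphereFamily K Φ) (hA : IsConic K k A) (hT : IsTangent Φ A)
    (p : ℝ × Eucl n) (hy : y.2 ≠ 0) :
    cov Φ p A y = dir p A y + (inner ℝ (A y) (dir p Φ y) : ℝ) • Φ y := by
  have h1 : dir p (fun z => (inner ℝ (A z) (Φ z) : ℝ)) y = dir p (fun _ => (0 : ℝ)) y :=
    dir_congr hT p hy
  rw [dir_inner (hA.differentiableAt hy) (hΦ.conic.differentiableAt hy)] at h1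
  have h2 : dir p (fun _ => (0 : ℝ)) y = 0 := by simp [dir]
  rw [h2] at h1
  rw [cov, tangentProj, eq_neg_of_add_eq_zero_left h1, neg_smul, sub_neg_eq_add]

/-- The pull-back connection has no torsion. -/
theorem cov_dir_comm (hΦ : IsSphereFamily K Φ) (p q : ℝ × Eucl n) (hy : y.2 ≠ 0) :
    cov Φ p (dir q Φ) y = cov Φ q (dir p Φ) y := by
  rw [cov, cov, hΦ.conic.dir_comm p q hy]

/-- The curvature of the pull-back connection is that of the unit sphere. -/
theorem cov_cov_sub (hΦ : IsSphereFamily K Φ) (hA : IsConic K k A) (hT : IsTangent Φ A)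
    (p q : ℝ × Eucl n) (hy : y.2 ≠ 0) :
    cov Φ p (cov Φ q A) y - cov Φ q (cov Φ p A) y =
      (inner ℝ (dir q Φ y) (A y) : ℝ) • dir p Φ y -
        (inner ℝ (dir p Φ y) (A y) : ℝ) • dir q Φ y := by
  have key : ∀ p q : ℝ × Eucl n, cov Φ p (cov Φ q A) y =
      tangentProj (Φ y) (dir p (dir q A) y) + (inner ℝ (dir q Φ y) (A y) : ℝ) • dir p Φ y := by
    intro p q
    have hAd := hA.differentiableAt hy
    have hΦd := hΦ.conic.differentiableAt hy
    have hqA := hA.dir_differentiableAt q hy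
    have hqΦ := hΦ.conic.dir_differentiableAt q hy
    have hin : DifferentiableAt ℝ (fun z => (inner ℝ (A z) (dir q Φ z) : ℝ)) y := hAd.inner ℝ hqΦ
    rw [cov_congr (B := fun z => dir q A z + (inner ℝ (A z) (dir q Φ z) : ℝ) • Φ z)
      (fun z hz => hΦ.cov_eq hA hT q hz) hy, cov, dir_add hqA (hin.fun_smul hΦd), dir_smul hin hΦd,
      tangentProj_add, tangentProj_add, tangentProj_smul, tangentProj_smul,
      tangentProj_self (hΦ.norm_eq y hy),
      tangentProj_of_orthogonal (hΦ.inner_dir_self p hy), smul_zero, zero_add, real_inner_comm]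
  rw [key, key, hA.dir_comm p q hy]
  abel

end IsSphereFamily

end

/-! ### First variation formulas -/

section

variable {n : ℕ}
variable {F : Type*} [NormedAddCommGroup F] [InnerProductSpace ℝ F]

theorem cov_slice_congr {Φ A B : ℝ × Eucl n → F} {c : ℝ} {K : Set (Eucl n)} {k l : ℕ}
    (hA : IsConic K k A) (hB : IsConic K l B) {t : ℝ}
    (h : ∀ x, x ≠ 0 → A (t, x) = c • B (t, x)) (i : Fin n) {x : Eucl n} (hx : x ≠ 0) :
    cov Φ (eX i) A (t, x) = c • cov Φ (eX i) B (t, x) := by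
  rw [cov, cov, ← tangentProj_smul, ← dir_const_smul c (hB.differentiableAt (y := (t, x)) hx), eX]
  congr 1
  refine dir_slice_congr (hA.differentiableAt (y := (t, x)) hx)
    ((hB.const_smul c).differentiableAt (y := (t, x)) hx) ?_ _
  filter_upwards [isOpen_ne.mem_nhds hx] with z hz using h z hz

theorem cov_slice_eq_zero {Φ A : ℝ × Eucl n → F} {K : Set (Eucl n)} {k : ℕ}
    (hA : IsConic K k A) {t : ℝ} {S : Set (Eucl n)} (hS : IsOpen S)
    (h : ∀ x ∈ S, x ≠ 0 → A (t, x) = 0) (i : Fin n) {x : Eucl n} (hx : x ≠ 0) (hxS : x ∈ S) :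
    cov Φ (eX i) A (t, x) = 0 := by
  have : dir (eX i) A (t, x) = 0 := by
    rw [eX, dir_slice_congr (v := fun _ => 0) (s := t) (hA.differentiableAt (y := (t, x)) hx)
      (differentiableAt_const _) ?_ _]
    · simp [dir]
    · filter_upwards [isOpen_ne.mem_nhds hx, hS.mem_nhds hxS] with z hz hz' using h z hz' hz
  rw [cov, this, tangentProj_zero]

/-- Integration by parts for the covariant derivative, at the parameter `0`. -/
theorem integral_inner_cov {K : Set (Eucl n)} (hK : IsCompact K) (hKB : K ⊆ unitBall n)
    {Φ A B : ℝ × Eucl n → F} {k l : ℕ} (hΦ : IsSphereFamily K Φ) (hA : IsConic K k A)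
    (hB : IsConic K l B) (hAT : ∀ x, x ≠ 0 → inner ℝ (A (0, x)) (Φ (0, x)) = 0)
    (hBT : ∀ x, x ≠ 0 → inner ℝ (B (0, x)) (Φ (0, x)) = 0)
    (hA0 : ∀ x, x ∉ K → x ≠ 0 → A (0, x) = 0) (hkl : k + l + 1 < n) (i : Fin n) :
    ∫ x in unitBall n, (inner ℝ (cov Φ (eX i) A (0, x)) (B (0, x)) : ℝ) =
      -∫ x in unitBall n, (inner ℝ (A (0, x)) (cov Φ (eX i) B (0, x)) : ℝ) := by
  have hn : 1 ≤ n := by omega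
  have h0 := (hA.inner hB).integral_dir_eq_zero hK.isClosed hkl (EuclideanSpace.single i 1) 0
    hK hKB (fun x hx hx0 => by rw [hA0 x hx hx0, inner_zero_left])
  have i1 := ((hΦ.conic_cov_eX hK.isClosed hA i).inner hB).integrableOn (by omega) 0
  have i2 := (hA.inner (hΦ.conic_cov_eX hK.isClosed hB i)).integrableOn (by omega) 0
  rw [eq_neg_iff_add_eq_zero, ← integral_add i1 i2]
  refine Eq.trans (integral_congr_ae ?_) h0
  filter_upwards [ae_unitBall hn] with x hx
  exact (dir_inner_eq_cov (hA.differentiableAt (y := (0, x)) hx.1)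
    (hB.differentiableAt (y := (0, x)) hx.1) (hAT x hx.1) (hBT x hx.1)).symm

/-- The derivative of `½ ∫ ∑ⱼ |Aⱼ|²` for families `Aⱼ` of sections along `Φ`. -/
theorem hasDerivAt_half_integral_sq {K : Set (Eucl n)} {ι : Type*} {s : Finset ι} {k : ℕ}
    {A : ι → ℝ × Eucl n → F} {Φ : ℝ × Eucl n → F} (hA : ∀ j ∈ s, IsConic K k (A j))
    (hT : ∀ j ∈ s, IsTangent Φ (A j)) (hk : 2 * k < n) :
    HasDerivAt (fun t => (1 / 2) * ∫ x in unitBall n, ∑ j ∈ s, ‖A j (t, x)‖ ^ 2)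
      (∫ x in unitBall n, ∑ j ∈ s, (inner ℝ (cov Φ eT (A j) (0, x)) (A j (0, x)) : ℝ)) 0 := by
  have hn : 1 ≤ n := by omega
  have hc : IsConic K (k + k) (fun y => ∑ j ∈ s, (inner ℝ (A j y) (A j y) : ℝ)) :=
    IsConic.sum fun j hj => (hA j hj).inner (hA j hj)
  have h := (hc.hasDerivAt_integral (by omega)).const_mul (1 / 2)
  simp only [real_inner_self_eq_norm_sq] at h
  refine h.congr_deriv ?_
  rw [← integral_const_mul]
  refine integral_congr_ae ?_
  filter_upwards [ae_unitBall hn] with x hx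
  have hd : ∀ j ∈ s, DifferentiableAt ℝ (A j) (0, x) := fun j hj => (hA j hj).differentiableAt hx.1
  have e : dir eT (fun y => ∑ j ∈ s, ‖A j y‖ ^ 2) (0, x) =
      ∑ j ∈ s, dir eT (fun y => (inner ℝ (A j y) (A j y) : ℝ)) (0, x) := by
    simp only [← real_inner_self_eq_norm_sq]
    exact dir_sum fun j hj => (hd j hj).inner ℝ (hd j hj)
  rw [e, Finset.mul_sum]
  refine Finset.sum_congr rfl fun j hj => ?_
  rw [dir_inner (hd j hj) (hd j hj), inner_cov (hT j hj (0, x) hx.1),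
    real_inner_comm (dir eT (A j) (0, x))]
  ring

/-- The tension field of a family of sphere-valued maps. -/
def tau (Φ : ℝ × Eucl n → F) (y : ℝ × Eucl n) : F := ∑ i, cov Φ (eX i) (dir (eX i) Φ) y

/-- The trace of the second covariant derivative, which is minus the rough Laplacian. -/
def lap (Φ A : ℝ × Eucl n → F) (y : ℝ × Eucl n) : F := ∑ i, cov Φ (eX i) (cov Φ (eX i) A) y

/-- The differential of `φ` at parameter `0` and the behaviour of the sections `N l`, of order `l`,
under covariant differentiation there, as satisfied by a family of maps passing through `φ_a` with
`N l = |x|⁻ˡ ν`, where `ν` is a unit normal section: the tension field is `c N₂`, the rough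
Laplacian of `N l` is `lam l • N (l + 2)`, `|dφ|² = S |x|⁻²` and `⟨dφ, ∇N l⟩ = -c |x|⁻ˡ⁻²`. -/
structure IsModel (K : Set (Eucl n)) (Φ : ℝ × Eucl n → F) (N : ℕ → ℝ × Eucl n → F) (c S : ℝ)
    (lam : ℕ → ℝ) : Prop where
  compact : IsCompact K
  subset : K ⊆ unitBall n
  sphere : IsSphereFamily K Φ
  conic : ∀ l, IsConic K l (N l)
  shift : ∀ k l x, x ≠ 0 → (‖x‖ ^ k)⁻¹ • N l (0, x) = N (k + l) (0, x)
  tangent : ∀ l x, x ≠ 0 → inner ℝ (N l (0, x)) (Φ (0, x)) = 0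
  orthogonal : ∀ l x i, x ≠ 0 → inner ℝ (dir (eX i) Φ (0, x)) (N l (0, x)) = 0
  sum_sq : ∀ x, x ≠ 0 →
    ∑ i, (inner ℝ (dir (eX i) Φ (0, x)) (dir (eX i) Φ (0, x)) : ℝ) = S * (‖x‖ ^ 2)⁻¹
  sum_inner_cov : ∀ l x, x ≠ 0 →
    ∑ i, (inner ℝ (dir (eX i) Φ (0, x)) (cov Φ (eX i) (N l) (0, x)) : ℝ) =
      -c * (‖x‖ ^ (l + 2))⁻¹
  lap_eq : ∀ l x, x ≠ 0 → lap Φ (N l) (0, x) = -lam l • N (l + 2) (0, x)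
  tau_eq : ∀ x, x ≠ 0 → tau Φ (0, x) = c • N 2 (0, x)

namespace IsSphereFamily

variable {K : Set (Eucl n)} {k : ℕ} {Φ A : ℝ × Eucl n → F}

theorem tangent_dir (hΦ : IsSphereFamily K Φ) (p : ℝ × Eucl n) : IsTangent Φ (dir p Φ) :=
  fun _ hy => hΦ.inner_dir_self p hy

theorem tangent_tau (hΦ : IsSphereFamily K Φ) : IsTangent Φ (tau Φ) := fun y hy => by
  rw [tau, sum_inner]
  exact Finset.sum_eq_zero fun i _ => hΦ.cov_tangent _ _ y hy

theorem tangent_lap (hΦ : IsSphereFamily K Φ) (A : ℝ × Eucl n → F) : IsTangent Φ (lap Φ A) :=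
  fun y hy => by
    rw [lap, sum_inner]
    exact Finset.sum_eq_zero fun i _ => hΦ.cov_tangent _ _ y hy

theorem conic_dir (hK : IsClosed K) (hΦ : IsSphereFamily K Φ) (i : Fin n) :
    IsConic K 1 (dir (eX i) Φ) := hΦ.conic.dir_space hK _

theorem conic_tau (hK : IsClosed K) (hΦ : IsSphereFamily K Φ) : IsConic K 2 (tau Φ) :=
  IsConic.sum fun i _ => hΦ.conic_cov_eX hK (hΦ.conic_dir hK i) i

theorem conic_lap (hK : IsClosed K) (hΦ : IsSphereFamily K Φ) (hA : IsConic K k A) :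
    IsConic K (k + 2) (lap Φ A) :=
  IsConic.sum fun i _ => hΦ.conic_cov_eX hK (hΦ.conic_cov_eX hK hA i) i

end IsSphereFamily

theorem lap_slice_congr {K : Set (Eucl n)} {k l : ℕ} {Φ A B : ℝ × Eucl n → F} {c : ℝ}
    (hK : IsClosed K) (hΦ : IsSphereFamily K Φ) (hA : IsConic K k A) (hB : IsConic K l B) {t : ℝ}
    (h : ∀ x, x ≠ 0 → A (t, x) = c • B (t, x)) {x : Eucl n} (hx : x ≠ 0) :
    lap Φ A (t, x) = c • lap Φ B (t, x) := by
  rw [lap, lap, Finset.smul_sum]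
  refine Finset.sum_congr rfl fun i _ => ?_
  exact cov_slice_congr (hΦ.conic_cov_eX hK hA i) (hΦ.conic_cov_eX hK hB i)
    (fun z hz => cov_slice_congr hA hB h i hz) i hx

namespace IsModel

variable {K : Set (Eucl n)} {Φ : ℝ × Eucl n → F} {N : ℕ → ℝ × Eucl n → F} {c S : ℝ}
  {lam : ℕ → ℝ}

/-- The pairing of the variation field with `N l`; all first variations are multiples of it. -/
def pairing (Φ : ℝ × Eucl n → F) (N : ℕ → ℝ × Eucl n → F) (l : ℕ) : ℝ :=
  ∫ x in unitBall n, (inner ℝ (dir eT Φ (0, x)) (N l (0, x)) : ℝ)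

theorem inner_shift (M : IsModel K Φ N c S lam) (k l : ℕ) {x : Eucl n} (hx : x ≠ 0) (w : F) :
    (‖x‖ ^ k)⁻¹ * (inner ℝ w (N l (0, x)) : ℝ) = inner ℝ w (N (k + l) (0, x)) := by
  rw [← M.shift k l x hx, inner_smul_right]

/-- Two integrations by parts move the rough Laplacian onto the eigensection `N l`. -/
theorem integral_inner_lap (M : IsModel K Φ N c S lam) {A : ℝ × Eucl n → F} {k l : ℕ}
    (hA : IsConic K k A) (hAT : ∀ x, x ≠ 0 → inner ℝ (A (0, x)) (Φ (0, x)) = 0)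
    (hA0 : ∀ x, x ∉ K → x ≠ 0 → A (0, x) = 0) (hkl : k + l + 2 < n) :
    ∫ x in unitBall n, (inner ℝ (lap Φ A (0, x)) (N l (0, x)) : ℝ) =
      -lam l * ∫ x in unitBall n, (inner ℝ (A (0, x)) (N (l + 2) (0, x)) : ℝ) := by
  have hn : 1 ≤ n := by omega
  have hKc := M.compact.isClosed
  have hΦ := M.sphere
  have c1 : ∀ i, IsConic K (k + 1) (cov Φ (eX i) A) := hΦ.conic_cov_eX hKc hA
  have c2 : ∀ i, IsConic K (l + 1) (cov Φ (eX i) (N l)) := hΦ.conic_cov_eX hKc (M.conic l)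
  have e1 : ∀ i, ∫ x in unitBall n,
      (inner ℝ (cov Φ (eX i) (cov Φ (eX i) A) (0, x)) (N l (0, x)) : ℝ) =
      ∫ x in unitBall n, (inner ℝ (A (0, x)) (cov Φ (eX i) (cov Φ (eX i) (N l)) (0, x)) : ℝ) := by
    intro i
    rw [integral_inner_cov M.compact M.subset hΦ (c1 i) (M.conic l)
      (fun x hx => hΦ.cov_tangent _ _ (0, x) hx) (M.tangent l)
      (fun x hx hx0 => cov_slice_eq_zero hA hKc.isOpen_compl hA0 i hx0 hx) (by omega),
      integral_inner_cov M.compact M.subset hΦ hA (c2 i) hAT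
      (fun x hx => hΦ.cov_tangent _ _ (0, x) hx) hA0 (by omega), neg_neg]
  simp only [lap, sum_inner]
  rw [integral_finsetSum _ fun i _ =>
    ((hΦ.conic_cov_eX hKc (c1 i) i).inner (M.conic l)).integrableOn (by omega) 0]
  simp only [e1]
  rw [← integral_finsetSum _ fun i _ =>
    (hA.inner (hΦ.conic_cov_eX hKc (c2 i) i)).integrableOn (by omega) 0, ← integral_const_mul]
  refine integral_congr_ae ?_
  filter_upwards [ae_unitBall hn] with x hx
  have := M.lap_eq l x hx.1
  rw [lap] at this
  rw [← inner_sum, this, inner_smul_right]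

/-- First variation of the tension field. -/
theorem integral_cov_tau (M : IsModel K Φ N c S lam) {l : ℕ} (hl : l + 2 < n) :
    ∫ x in unitBall n, (inner ℝ (cov Φ eT (tau Φ) (0, x)) (N l (0, x)) : ℝ) =
      (S - lam l) * pairing Φ N (l + 2) := by
  have hn : 1 ≤ n := by omega
  have hKc := M.compact.isClosed
  have hΦ := M.sphere
  have hv : IsConic K 0 (dir eT Φ) := hΦ.conic.dir_eT
  have hpt : ∀ x : Eucl n, x ≠ 0 → (inner ℝ (cov Φ eT (tau Φ) (0, x)) (N l (0, x)) : ℝ) =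
      inner ℝ (lap Φ (dir eT Φ) (0, x)) (N l (0, x)) +
        S * inner ℝ (dir eT Φ (0, x)) (N (l + 2) (0, x)) := by
    -- commuting `∇ₜ` with `∇ᵢ` yields a curvature term, whose part along `∂ᵢΦ` is orthogonal
    -- to `N l`
    intro x hx
    have hy : ((0, x) : ℝ × Eucl n).2 ≠ 0 := hx
    have e : ∀ i, cov Φ eT (cov Φ (eX i) (dir (eX i) Φ)) (0, x) =
        cov Φ (eX i) (cov Φ (eX i) (dir eT Φ)) (0, x) +
        ((inner ℝ (dir (eX i) Φ (0, x)) (dir (eX i) Φ (0, x)) : ℝ) • dir eT Φ (0, x) -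
          (inner ℝ (dir eT Φ (0, x)) (dir (eX i) Φ (0, x)) : ℝ) • dir (eX i) Φ (0, x)) := by
      intro i
      rw [← hΦ.cov_cov_sub (hΦ.conic_dir hKc i) (hΦ.tangent_dir _) eT (eX i) hy,
        cov_congr (A := cov Φ (eX i) (dir eT Φ)) (B := cov Φ eT (dir (eX i) Φ))
          (fun z hz => hΦ.cov_dir_comm _ _ hz) hy]
      abel
    have e2 : cov Φ eT (tau Φ) (0, x) = ∑ i, cov Φ eT (cov Φ (eX i) (dir (eX i) Φ)) (0, x) :=
      cov_sum fun i _ => (hΦ.conic_cov_eX hKc (hΦ.conic_dir hKc i) i).differentiableAt hy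
    rw [e2, sum_inner, lap, sum_inner]
    simp only [e, inner_add_left, inner_sub_left, inner_smul_left, RCLike.conj_to_real,
      M.orthogonal l x _ hx, mul_zero, sub_zero]
    rw [Finset.sum_add_distrib, ← Finset.sum_mul, M.sum_sq x hx, mul_assoc, M.inner_shift 2 l hx,
      add_comm 2 l]
  have i1 := ((hΦ.conic_lap hKc hv).inner (M.conic l)).integrableOn (by omega) 0
  have i2 := (hv.inner (M.conic (l + 2))).integrableOn (by omega) 0
  have e3 := M.integral_inner_lap (l := l) hv (fun x hx => hΦ.inner_dir_self eT (y := (0, x)) hx)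
    (fun x hx hx0 => hΦ.conic.dir_eT_eq_zero hx hx0) (by omega)
  rw [pairing, sub_mul, sub_eq_add_neg, add_comm, ← neg_mul, ← e3, ← integral_const_mul,
    ← integral_add i1 (i2.const_mul S)]
  refine integral_congr_ae ?_
  filter_upwards [ae_unitBall hn] with x hx using hpt x hx.1

/-- The curvature term `R(∂ₜΦ, ∂ᵢΦ) W`. -/
def curv (Φ W : ℝ × Eucl n → F) (i : Fin n) (y : ℝ × Eucl n) : F :=
  (inner ℝ (dir (eX i) Φ y) (W y) : ℝ) • dir eT Φ y -
    (inner ℝ (dir eT Φ y) (W y) : ℝ) • dir (eX i) Φ y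

theorem conic_curv (M : IsModel K Φ N c S lam) {W : ℝ × Eucl n → F} {k : ℕ} (hW : IsConic K k W)
    (i : Fin n) : IsConic K (k + 1) (curv Φ W i) := by
  have hKc := M.compact.isClosed
  have h1 := ((M.sphere.conic_dir hKc i).inner hW).smul M.sphere.conic.dir_eT
  have h2 := (M.sphere.conic.dir_eT.inner hW).smul (M.sphere.conic_dir hKc i)
  rw [show 1 + k + 0 = k + 1 by ring] at h1
  rw [show 0 + k + 1 = k + 1 by ring] at h2
  exact h1.sub h2

theorem cov_eT_cov (M : IsModel K Φ N c S lam) {W : ℝ × Eucl n → F} {k : ℕ} (hW : IsConic K k W)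
    (hWT : IsTangent Φ W) (i : Fin n) {y : ℝ × Eucl n} (hy : y.2 ≠ 0) :
    cov Φ eT (cov Φ (eX i) W) y = cov Φ (eX i) (cov Φ eT W) y + curv Φ W i y := by
  rw [curv, ← M.sphere.cov_cov_sub hW hWT eT (eX i) hy]; abel

theorem curv_eq_zero (M : IsModel K Φ N c S lam) (W : ℝ × Eucl n → F) (i : Fin n)
    {x : Eucl n} (hx : x ∉ K) (hx0 : x ≠ 0) : curv Φ W i (0, x) = 0 := by
  rw [curv, M.sphere.conic.dir_eT_eq_zero hx hx0]; simp

theorem curv_tangent (M : IsModel K Φ N c S lam) (W : ℝ × Eucl n → F) (i : Fin n) :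
    IsTangent Φ (curv Φ W i) := fun y hy => by
  rw [curv, inner_sub_left, inner_smul_left, inner_smul_left, M.sphere.inner_dir_self _ hy,
    M.sphere.inner_dir_self _ hy]; simp

theorem sum_inner_curv (M : IsModel K Φ N c S lam) {W : ℝ × Eucl n → F} {k : ℕ} {α : ℝ}
    (hW0 : ∀ x, x ≠ 0 → W (0, x) = α • N k (0, x)) (l : ℕ) {x : Eucl n} (hx : x ≠ 0) :
    ∑ i, (inner ℝ (curv Φ W i (0, x)) (cov Φ (eX i) (N l) (0, x)) : ℝ) =
      c * α * inner ℝ (dir eT Φ (0, x)) (N (k + l + 2) (0, x)) := by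
  simp only [curv, hW0 x hx, inner_smul_right, M.orthogonal k x _ hx, mul_zero, zero_smul,
    zero_sub, inner_neg_left, inner_smul_left, RCLike.conj_to_real]
  rw [Finset.sum_neg_distrib, ← Finset.mul_sum, M.sum_inner_cov l x hx,
    show k + l + 2 = l + 2 + k by ring, ← M.shift (l + 2) k x hx, inner_smul_right]
  ring

theorem integral_sum_inner_curv (M : IsModel K Φ N c S lam) (hn : 1 ≤ n) {W : ℝ × Eucl n → F}
    {k : ℕ} {α : ℝ} (hW0 : ∀ x, x ≠ 0 → W (0, x) = α • N k (0, x)) (l : ℕ) :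
    ∫ x in unitBall n, ∑ i, (inner ℝ (curv Φ W i (0, x)) (cov Φ (eX i) (N l) (0, x)) : ℝ) =
      c * α * pairing Φ N (k + l + 2) := by
  rw [pairing, ← integral_const_mul]
  refine integral_congr_ae ?_
  filter_upwards [ae_unitBall hn] with x hx using M.sum_inner_curv hW0 l hx.1

/-- First variation of the covariant derivative of a family of sections. -/
theorem integral_cov_cov (M : IsModel K Φ N c S lam) {W : ℝ × Eucl n → F} {k l : ℕ} {α : ℝ}
    (hW : IsConic K k W) (hWT : IsTangent Φ W) (hW0 : ∀ x, x ≠ 0 → W (0, x) = α • N k (0, x))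
    (hkl : k + l + 2 < n) :
    ∫ x in unitBall n,
        ∑ i, (inner ℝ (cov Φ eT (cov Φ (eX i) W) (0, x)) (cov Φ (eX i) (N l) (0, x)) : ℝ) =
      lam l * (∫ x in unitBall n, (inner ℝ (cov Φ eT W (0, x)) (N (l + 2) (0, x)) : ℝ)) +
        c * α * pairing Φ N (k + l + 2) := by
  have hn : 1 ≤ n := by omega
  have hKc := M.compact.isClosed
  have hΦ := M.sphere
  have cW := hΦ.conic_cov_eT hW
  have cN : ∀ i, IsConic K (l + 1) (cov Φ (eX i) (N l)) := hΦ.conic_cov_eX hKc (M.conic l)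
  have hsup : ∀ x, x ∉ K → x ≠ 0 → cov Φ eT W (0, x) = 0 := fun x hx hx0 => by
    rw [cov, hW.dir_eT_eq_zero hx hx0, tangentProj_zero]
  have e1 : ∀ i, ∫ x in unitBall n,
      (inner ℝ (cov Φ (eX i) (cov Φ eT W) (0, x)) (cov Φ (eX i) (N l) (0, x)) : ℝ) =
      -∫ x in unitBall n,
        (inner ℝ (cov Φ eT W (0, x)) (cov Φ (eX i) (cov Φ (eX i) (N l)) (0, x)) : ℝ) := fun i =>
    integral_inner_cov M.compact M.subset hΦ cW (cN i)
      (fun x hx => hΦ.cov_tangent _ _ (0, x) hx) (fun x hx => hΦ.cov_tangent _ _ (0, x) hx) hsup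
      (by omega) i
  have j1 : ∀ i, IntegrableOn (fun x =>
      (inner ℝ (cov Φ (eX i) (cov Φ eT W) (0, x)) (cov Φ (eX i) (N l) (0, x)) : ℝ)) (unitBall n) :=
    fun i => ((hΦ.conic_cov_eX hKc cW i).inner (cN i)).integrableOn (by omega) 0
  have j2 : ∀ i, IntegrableOn (fun x =>
      (inner ℝ (curv Φ W i (0, x)) (cov Φ (eX i) (N l) (0, x)) : ℝ)) (unitBall n) :=
    fun i => ((M.conic_curv hW i).inner (cN i)).integrableOn (by omega) 0
  have e2 : ∫ x in unitBall n,
        ∑ i, (inner ℝ (cov Φ eT (cov Φ (eX i) W) (0, x)) (cov Φ (eX i) (N l) (0, x)) : ℝ) =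
      (∫ x in unitBall n, ∑ i,
        (inner ℝ (cov Φ (eX i) (cov Φ eT W) (0, x)) (cov Φ (eX i) (N l) (0, x)) : ℝ)) +
      ∫ x in unitBall n, ∑ i,
        (inner ℝ (curv Φ W i (0, x)) (cov Φ (eX i) (N l) (0, x)) : ℝ) := by
    rw [← integral_add (integrable_finsetSum _ fun i _ => j1 i)
      (integrable_finsetSum _ fun i _ => j2 i)]
    refine integral_congr_ae ?_
    filter_upwards [ae_unitBall hn] with x hx
    rw [← Finset.sum_add_distrib]
    refine Finset.sum_congr rfl fun i _ => ?_
    rw [M.cov_eT_cov hW hWT i (y := (0, x)) hx.1, inner_add_left]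
  rw [e2, M.integral_sum_inner_curv hn hW0, integral_finsetSum _ fun i _ => j1 i]
  simp only [e1]
  rw [Finset.sum_neg_distrib, ← integral_finsetSum _ fun i _ =>
    (cW.inner (hΦ.conic_cov_eX hKc (cN i) i)).integrableOn (by omega) 0, ← integral_neg,
    ← integral_const_mul]
  congr 1
  refine integral_congr_ae ?_
  filter_upwards [ae_unitBall hn] with x hx
  have := M.lap_eq l x hx.1
  rw [lap] at this
  rw [← inner_sum, this, inner_smul_right]; ring

/-- First variation of the rough Laplacian of a family of sections. The two curvature terms, from
commuting `∇ₜ` with each of the two covariant derivatives, contribute equally. -/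
theorem integral_cov_lap (M : IsModel K Φ N c S lam) {W : ℝ × Eucl n → F} {k l : ℕ} {α : ℝ}
    (hW : IsConic K k W) (hWT : IsTangent Φ W) (hW0 : ∀ x, x ≠ 0 → W (0, x) = α • N k (0, x))
    (hkl : k + l + 2 < n) :
    ∫ x in unitBall n, (inner ℝ (cov Φ eT (lap Φ W) (0, x)) (N l (0, x)) : ℝ) =
      -lam l * (∫ x in unitBall n, (inner ℝ (cov Φ eT W (0, x)) (N (l + 2) (0, x)) : ℝ)) -
        2 * (c * α) * pairing Φ N (k + l + 2) := by
  have hn : 1 ≤ n := by omega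
  have hKc := M.compact.isClosed
  have hΦ := M.sphere
  have cW := hΦ.conic_cov_eT hW
  have hsup : ∀ x, x ∉ K → x ≠ 0 → cov Φ eT W (0, x) = 0 := fun x hx hx0 => by
    rw [cov, hW.dir_eT_eq_zero hx hx0, tangentProj_zero]
  have hpt : ∀ x : Eucl n, x ≠ 0 → (inner ℝ (cov Φ eT (lap Φ W) (0, x)) (N l (0, x)) : ℝ) =
      inner ℝ (lap Φ (cov Φ eT W) (0, x)) (N l (0, x)) +
      ∑ i, (inner ℝ (cov Φ (eX i) (curv Φ W i) (0, x)) (N l (0, x)) : ℝ) +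
      -(c * α) * inner ℝ (dir eT Φ (0, x)) (N (k + l + 2) (0, x)) := by
    intro x hx
    have hy : ((0, x) : ℝ × Eucl n).2 ≠ 0 := hx
    have e : ∀ i, cov Φ eT (cov Φ (eX i) (cov Φ (eX i) W)) (0, x) =
        cov Φ (eX i) (cov Φ (eX i) (cov Φ eT W)) (0, x) + cov Φ (eX i) (curv Φ W i) (0, x) +
          curv Φ (cov Φ (eX i) W) i (0, x) := by
      intro i
      rw [M.cov_eT_cov (hΦ.conic_cov_eX hKc hW i) (hΦ.cov_tangent _ _) i hy,
        cov_congr (fun z hz => M.cov_eT_cov hW hWT i hz) hy,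
        cov_add ((hΦ.conic_cov_eX hKc cW i).differentiableAt hy)
          ((M.conic_curv hW i).differentiableAt hy)]
    have e2 : cov Φ eT (lap Φ W) (0, x) =
        ∑ i, cov Φ eT (cov Φ (eX i) (cov Φ (eX i) W)) (0, x) :=
      cov_sum fun i _ =>
        (hΦ.conic_cov_eX hKc (hΦ.conic_cov_eX hKc hW i) i).differentiableAt hy
    have e3 : ∀ i, (inner ℝ (curv Φ (cov Φ (eX i) W) i (0, x)) (N l (0, x)) : ℝ) =
        α * inner ℝ (dir (eX i) Φ (0, x)) (cov Φ (eX i) (N k) (0, x)) *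
          inner ℝ (dir eT Φ (0, x)) (N l (0, x)) := by
      intro i
      rw [curv, inner_sub_left, inner_smul_left, inner_smul_left, M.orthogonal l x i hx,
        cov_slice_congr hW (M.conic k) hW0 i hx, inner_smul_right]
      simp
    rw [e2, sum_inner, lap, sum_inner]
    simp only [e, inner_add_left, e3]
    rw [Finset.sum_add_distrib, Finset.sum_add_distrib, ← Finset.sum_mul, ← Finset.mul_sum,
      M.sum_inner_cov k x hx, show k + l + 2 = k + 2 + l by ring, ← M.inner_shift (k + 2) l hx]
    ring
  have j1 := ((hΦ.conic_lap hKc cW).inner (M.conic l)).integrableOn (by omega) 0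
  have j2 : ∀ i, IntegrableOn (fun x =>
      (inner ℝ (cov Φ (eX i) (curv Φ W i) (0, x)) (N l (0, x)) : ℝ)) (unitBall n) := fun i =>
    ((hΦ.conic_cov_eX hKc (M.conic_curv hW i) i).inner (M.conic l)).integrableOn (by omega) 0
  have j3 := (hΦ.conic.dir_eT.inner (M.conic (k + l + 2))).integrableOn (by omega) 0
  have e4 : ∀ i, ∫ x in unitBall n,
      (inner ℝ (cov Φ (eX i) (curv Φ W i) (0, x)) (N l (0, x)) : ℝ) =
      -∫ x in unitBall n, (inner ℝ (curv Φ W i (0, x)) (cov Φ (eX i) (N l) (0, x)) : ℝ) := fun i =>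
    integral_inner_cov M.compact M.subset hΦ (M.conic_curv hW i) (M.conic l)
      (fun x hx => M.curv_tangent W i (0, x) hx) (M.tangent l)
      (fun x hx hx0 => M.curv_eq_zero W i hx hx0) (by omega) i
  have e5 : ∫ x in unitBall n, (inner ℝ (cov Φ eT (lap Φ W) (0, x)) (N l (0, x)) : ℝ) =
      (∫ x in unitBall n, (inner ℝ (lap Φ (cov Φ eT W) (0, x)) (N l (0, x)) : ℝ)) +
      (∫ x in unitBall n,
        ∑ i, (inner ℝ (cov Φ (eX i) (curv Φ W i) (0, x)) (N l (0, x)) : ℝ)) +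
      -(c * α) * pairing Φ N (k + l + 2) := by
    have j2' := integrable_finsetSum (μ := volume.restrict (unitBall n)) Finset.univ fun i _ => j2 i
    rw [pairing, ← integral_const_mul, ← integral_add j1 j2', ← integral_add (j1.fun_add j2')
      (j3.const_mul _)]
    refine integral_congr_ae ?_
    filter_upwards [ae_unitBall hn] with x hx using hpt x hx.1
  rw [e5, M.integral_inner_lap cW (fun x hx => hΦ.cov_tangent _ _ (0, x) hx) hsup (by omega),
    integral_finsetSum _ fun i _ => j2 i]
  simp only [e4]
  rw [Finset.sum_neg_distrib, ← integral_finsetSum _ fun i _ =>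
    ((M.conic_curv hW i).inner (hΦ.conic_cov_eX hKc (M.conic l) i)).integrableOn (by omega) 0,
    M.integral_sum_inner_curv hn hW0]
  ring

end IsModel

end

/-! ### Energies of families of sphere-valued maps -/

section

variable {n : ℕ}
variable {F : Type*} [NormedAddCommGroup F] [InnerProductSpace ℝ F]

section Ae

variable [CompleteSpace F] {K : Set (Eucl n)} {k : ℕ} {Φ A : ℝ × Eucl n → F} {t : ℝ}
  {f w : Eucl n → F}

theorem covDeriv_ae_eq (hK : IsClosed K) (hA : IsConic K k A) (hk : k + 1 < n)
    (hf : f =ᵐ[volume.restrict (unitBall n)] fun x => Φ (t, x))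
    (hw : w =ᵐ[volume.restrict (unitBall n)] fun x => A (t, x)) (i : Fin n) :
    covDeriv (unitBall n) f i w =ᵐ[volume.restrict (unitBall n)]
      fun x => cov Φ (eX i) A (t, x) := by
  filter_upwards [hf, hA.weakPartial_ae_eq hK hk hw i] with x h1 h2
  rw [covDeriv, h1, h2]; rfl

theorem tension_ae_eq (hK : IsClosed K) (hΦ : IsSphereFamily K Φ) (hn : 2 < n)
    (hf : f =ᵐ[volume.restrict (unitBall n)] fun x => Φ (t, x)) :
    tension (unitBall n) f =ᵐ[volume.restrict (unitBall n)] fun x => tau Φ (t, x) := by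
  have h := fun i : Fin n => covDeriv_ae_eq hK (hΦ.conic_dir hK i) hn hf
    (hΦ.conic.weakPartial_ae_eq hK (by omega) hf i) i
  filter_upwards [ae_all_iff.mpr h] with x hx
  rw [tension, tau]
  exact Finset.sum_congr rfl fun i _ => hx i

theorem roughLaplacian_ae_eq (hK : IsClosed K) (hΦ : IsSphereFamily K Φ) (hA : IsConic K k A)
    (hk : k + 2 < n) (hf : f =ᵐ[volume.restrict (unitBall n)] fun x => Φ (t, x))
    (hw : w =ᵐ[volume.restrict (unitBall n)] fun x => A (t, x)) :
    roughLaplacian (unitBall n) f w =ᵐ[volume.restrict (unitBall n)]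
      fun x => -lap Φ A (t, x) := by
  have h := fun i : Fin n => covDeriv_ae_eq hK (hΦ.conic_cov_eX hK hA i) hk hf
    (covDeriv_ae_eq hK hA (by omega) hf hw i) i
  filter_upwards [ae_all_iff.mpr h] with x hx
  rw [roughLaplacian, lap]
  exact congrArg Neg.neg (Finset.sum_congr rfl fun i _ => hx i)

theorem energy_eq (hK : IsClosed K) (hΦ : IsSphereFamily K Φ) (hn : 1 < n)
    (hf : f =ᵐ[volume.restrict (unitBall n)] fun x => Φ (t, x)) :
    energy (unitBall n) f = (1 / 2) * ∫ x in unitBall n, ∑ i, ‖dir (eX i) Φ (t, x)‖ ^ 2 := by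
  rw [energy]
  congr 1
  refine integral_congr_ae ?_
  filter_upwards [ae_all_iff.mpr fun i => hΦ.conic.weakPartial_ae_eq hK hn hf i] with x hx
  simp only [hx]

theorem rEnergy_three_eq (hK : IsClosed K) (hΦ : IsSphereFamily K Φ) (hn : 3 < n)
    (hf : f =ᵐ[volume.restrict (unitBall n)] fun x => Φ (t, x)) :
    rEnergy (unitBall n) 3 f =
      (1 / 2) * ∫ x in unitBall n, ∑ i, ‖cov Φ (eX i) (tau Φ) (t, x)‖ ^ 2 := by
  rw [rEnergy, if_neg (by decide)]
  congr 1
  refine integral_congr_ae ?_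
  filter_upwards [ae_all_iff.mpr fun i => covDeriv_ae_eq hK (hΦ.conic_tau hK) hn hf
    (tension_ae_eq hK hΦ (by omega) hf) i] with x hx
  exact Finset.sum_congr rfl fun i _ => congrArg (fun z => ‖z‖ ^ 2) (hx i)

theorem rEnergy_four_eq (hK : IsClosed K) (hΦ : IsSphereFamily K Φ) (hn : 4 < n)
    (hf : f =ᵐ[volume.restrict (unitBall n)] fun x => Φ (t, x)) :
    rEnergy (unitBall n) 4 f = (1 / 2) * ∫ x in unitBall n, ‖lap Φ (tau Φ) (t, x)‖ ^ 2 := by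
  rw [rEnergy, if_pos (by decide)]
  congr 1
  refine integral_congr_ae ?_
  filter_upwards [roughLaplacian_ae_eq hK hΦ (hΦ.conic_tau hK) hn hf
    (tension_ae_eq hK hΦ (by omega) hf)] with x hx
  refine congrArg (fun z => ‖z‖ ^ 2) hx |>.trans ?_
  simp only [norm_neg]

theorem rEnergy_five_eq (hK : IsClosed K) (hΦ : IsSphereFamily K Φ) (hn : 5 < n)
    (hf : f =ᵐ[volume.restrict (unitBall n)] fun x => Φ (t, x)) :
    rEnergy (unitBall n) 5 f =
      (1 / 2) * ∫ x in unitBall n, ∑ i, ‖cov Φ (eX i) (lap Φ (tau Φ)) (t, x)‖ ^ 2 := by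
  rw [rEnergy, if_neg (by decide)]
  congr 1
  refine integral_congr_ae ?_
  have hL := hΦ.conic_lap hK (hΦ.conic_tau hK)
  filter_upwards [ae_all_iff.mpr fun i => covDeriv_ae_eq hK hL.neg hn hf
    (roughLaplacian_ae_eq hK hΦ (hΦ.conic_tau hK) (by omega) hf
      (tension_ae_eq hK hΦ (by omega) hf)) i] with x hx
  refine Finset.sum_congr rfl fun i _ => congrArg (fun z => ‖z‖ ^ 2) (hx i) |>.trans ?_
  simp only [cov_neg, norm_neg]

end Ae

namespace IsModel

variable {K : Set (Eucl n)} {Φ : ℝ × Eucl n → F} {N : ℕ → ℝ × Eucl n → F} {c S : ℝ}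
  {lam : ℕ → ℝ}

theorem lap_tau_eq (M : IsModel K Φ N c S lam) {x : Eucl n} (hx : x ≠ 0) :
    lap Φ (tau Φ) (0, x) = -(c * lam 2) • N 4 (0, x) := by
  have hKc := M.compact.isClosed
  rw [lap_slice_congr hKc M.sphere (M.sphere.conic_tau hKc) (M.conic 2) M.tau_eq hx,
    M.lap_eq 2 x hx, smul_smul]
  congr 1; ring

theorem integral_variation_one (M : IsModel K Φ N c S lam) (hn : 2 < n) :
    ∫ x in unitBall n,
      ∑ i, (inner ℝ (cov Φ eT (dir (eX i) Φ) (0, x)) (dir (eX i) Φ (0, x)) : ℝ) =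
      -c * pairing Φ N 2 := by
  have hKc := M.compact.isClosed
  have hΦ := M.sphere
  have hv := hΦ.conic.dir_eT
  have e1 : ∀ i, ∫ x in unitBall n,
      (inner ℝ (cov Φ eT (dir (eX i) Φ) (0, x)) (dir (eX i) Φ (0, x)) : ℝ) =
      -∫ x in unitBall n, (inner ℝ (dir eT Φ (0, x)) (cov Φ (eX i) (dir (eX i) Φ) (0, x)) : ℝ) := by
    intro i
    rw [← integral_inner_cov M.compact M.subset hΦ hv (hΦ.conic_dir hKc i)
      (fun x hx => hΦ.inner_dir_self eT (y := (0, x)) hx)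
      (fun x hx => hΦ.inner_dir_self (eX i) (y := (0, x)) hx)
      (fun x hx hx0 => hΦ.conic.dir_eT_eq_zero hx hx0) (by omega) i]
    refine integral_congr_ae ?_
    filter_upwards [ae_unitBall (by omega : 1 ≤ n)] with x hx
    rw [hΦ.cov_dir_comm eT (eX i) (y := (0, x)) hx.1]
  rw [integral_finsetSum _ fun i _ => ((hΦ.conic_cov_eT (hΦ.conic_dir hKc i)).inner
    (hΦ.conic_dir hKc i)).integrableOn (by omega) 0]
  simp only [e1]
  rw [Finset.sum_neg_distrib, ← integral_finsetSum _ fun i _ =>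
    (hv.inner (hΦ.conic_cov_eX hKc (hΦ.conic_dir hKc i) i)).integrableOn (by omega) 0, pairing,
    ← integral_const_mul, ← integral_neg]
  refine integral_congr_ae ?_
  filter_upwards [ae_unitBall (by omega : 1 ≤ n)] with x hx
  have := M.tau_eq x hx.1
  rw [tau] at this
  rw [← inner_sum, this, inner_smul_right]; ring

/-- At the parameter `0` the second factor is `c ∇N₂`; hence the first variation formulas for the
covariant derivative of `τ` and for `τ` itself apply in turn. The cases below are analogous. -/
theorem integral_variation_three (M : IsModel K Φ N c S lam) (hn : 6 < n) :
    ∫ x in unitBall n, ∑ i, (inner ℝ (cov Φ eT (cov Φ (eX i) (tau Φ)) (0, x))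
      (cov Φ (eX i) (tau Φ) (0, x)) : ℝ) =
      c * (lam 2 * (S - lam 4) + c ^ 2) * pairing Φ N 6 := by
  have hKc := M.compact.isClosed
  have hT := M.sphere.conic_tau hKc
  have e := M.integral_cov_cov (l := 2) hT M.sphere.tangent_tau M.tau_eq hn
  rw [M.integral_cov_tau (l := 4) (by omega)] at e
  calc _ = c * ∫ x in unitBall n, ∑ i, (inner ℝ (cov Φ eT (cov Φ (eX i) (tau Φ)) (0, x))
      (cov Φ (eX i) (N 2) (0, x)) : ℝ) := by
        rw [← integral_const_mul]
        refine integral_congr_ae ?_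
        filter_upwards [ae_unitBall (by omega : 1 ≤ n)] with x hx
        rw [Finset.mul_sum]
        refine Finset.sum_congr rfl fun i _ => ?_
        rw [cov_slice_congr hT (M.conic 2) M.tau_eq i hx.1, inner_smul_right]
    _ = _ := by rw [e]; ring

theorem integral_variation_four (M : IsModel K Φ N c S lam) (hn : 8 < n) :
    ∫ x in unitBall n, (inner ℝ (cov Φ eT (lap Φ (tau Φ)) (0, x)) (lap Φ (tau Φ) (0, x)) : ℝ) =
      c * lam 2 * (lam 4 * (S - lam 6) + 2 * c ^ 2) * pairing Φ N 8 := by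
  have hKc := M.compact.isClosed
  have hT := M.sphere.conic_tau hKc
  have e := M.integral_cov_lap (l := 4) hT M.sphere.tangent_tau M.tau_eq hn
  rw [M.integral_cov_tau (l := 6) (by omega)] at e
  calc _ = -(c * lam 2) *
        ∫ x in unitBall n, (inner ℝ (cov Φ eT (lap Φ (tau Φ)) (0, x)) (N 4 (0, x)) : ℝ) := by
        rw [← integral_const_mul]
        refine integral_congr_ae ?_
        filter_upwards [ae_unitBall (by omega : 1 ≤ n)] with x hx
        rw [M.lap_tau_eq hx.1, inner_smul_right]
    _ = _ := by rw [e]; ring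

theorem integral_variation_five (M : IsModel K Φ N c S lam) (hn : 10 < n) :
    ∫ x in unitBall n, ∑ i, (inner ℝ (cov Φ eT (cov Φ (eX i) (lap Φ (tau Φ))) (0, x))
      (cov Φ (eX i) (lap Φ (tau Φ)) (0, x)) : ℝ) =
      c * lam 2 * (lam 4 * (lam 6 * (S - lam 8) + 2 * c ^ 2) + c ^ 2 * lam 2) *
        pairing Φ N 10 := by
  have hKc := M.compact.isClosed
  have hT := M.sphere.conic_tau hKc
  have hL := M.sphere.conic_lap hKc hT
  have e := M.integral_cov_cov (l := 4) hL (M.sphere.tangent_lap _) (fun x hx => M.lap_tau_eq hx)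
    hn
  rw [M.integral_cov_lap (l := 6) hT M.sphere.tangent_tau M.tau_eq (by omega),
    M.integral_cov_tau (l := 8) (by omega)] at e
  calc _ = -(c * lam 2) * ∫ x in unitBall n,
      ∑ i, (inner ℝ (cov Φ eT (cov Φ (eX i) (lap Φ (tau Φ))) (0, x))
      (cov Φ (eX i) (N 4) (0, x)) : ℝ) := by
        rw [← integral_const_mul]
        refine integral_congr_ae ?_
        filter_upwards [ae_unitBall (by omega : 1 ≤ n)] with x hx
        rw [Finset.mul_sum]
        refine Finset.sum_congr rfl fun i _ => ?_
        rw [cov_slice_congr hL (M.conic 4) (fun x hx => M.lap_tau_eq hx) i hx.1, inner_smul_right]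
    _ = _ := by rw [e]; ring

variable [CompleteSpace F] {f : ℝ → Eucl n → F}

theorem hasDerivAt_energy (M : IsModel K Φ N c S lam) (hn : 2 < n)
    (hf : ∀ᶠ t in nhds 0, f t =ᵐ[volume.restrict (unitBall n)] fun x => Φ (t, x)) :
    HasDerivAt (fun t => energy (unitBall n) (f t)) (-c * pairing Φ N 2) 0 := by
  have hKc := M.compact.isClosed
  rw [← M.integral_variation_one hn]
  refine (hasDerivAt_half_integral_sq (s := Finset.univ)
    (fun i _ => M.sphere.conic_dir hKc i) (fun i _ => M.sphere.tangent_dir _)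
    (by omega)).congr_of_eventuallyEq ?_
  filter_upwards [hf] with t ht using energy_eq hKc M.sphere (by omega) ht

theorem hasDerivAt_rEnergy_three (M : IsModel K Φ N c S lam) (hn : 6 < n)
    (hf : ∀ᶠ t in nhds 0, f t =ᵐ[volume.restrict (unitBall n)] fun x => Φ (t, x)) :
    HasDerivAt (fun t => rEnergy (unitBall n) 3 (f t))
      (c * (lam 2 * (S - lam 4) + c ^ 2) * pairing Φ N 6) 0 := by
  have hKc := M.compact.isClosed
  rw [← M.integral_variation_three hn]
  refine (hasDerivAt_half_integral_sq (s := Finset.univ)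
    (fun i _ => M.sphere.conic_cov_eX hKc (M.sphere.conic_tau hKc) i)
    (fun i _ => M.sphere.cov_tangent _ _) (by omega)).congr_of_eventuallyEq ?_
  filter_upwards [hf] with t ht using rEnergy_three_eq hKc M.sphere (by omega) ht

theorem hasDerivAt_rEnergy_four (M : IsModel K Φ N c S lam) (hn : 8 < n)
    (hf : ∀ᶠ t in nhds 0, f t =ᵐ[volume.restrict (unitBall n)] fun x => Φ (t, x)) :
    HasDerivAt (fun t => rEnergy (unitBall n) 4 (f t))
      (c * lam 2 * (lam 4 * (S - lam 6) + 2 * c ^ 2) * pairing Φ N 8) 0 := by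
  have hKc := M.compact.isClosed
  rw [← M.integral_variation_four hn]
  have h := hasDerivAt_half_integral_sq (s := ({()} : Finset Unit))
    (fun _ _ => M.sphere.conic_lap hKc (M.sphere.conic_tau hKc))
    (fun _ _ => M.sphere.tangent_lap _) (by omega)
  simp only [Finset.sum_singleton] at h
  refine h.congr_of_eventuallyEq ?_
  filter_upwards [hf] with t ht using rEnergy_four_eq hKc M.sphere (by omega) ht

theorem hasDerivAt_rEnergy_five (M : IsModel K Φ N c S lam) (hn : 10 < n)
    (hf : ∀ᶠ t in nhds 0, f t =ᵐ[volume.restrict (unitBall n)] fun x => Φ (t, x)) :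
    HasDerivAt (fun t => rEnergy (unitBall n) 5 (f t))
      (c * lam 2 * (lam 4 * (lam 6 * (S - lam 8) + 2 * c ^ 2) + c ^ 2 * lam 2) *
        pairing Φ N 10) 0 := by
  have hKc := M.compact.isClosed
  rw [← M.integral_variation_five hn]
  refine (hasDerivAt_half_integral_sq (s := Finset.univ)
    (fun i _ => M.sphere.conic_cov_eX hKc (M.sphere.conic_lap hKc (M.sphere.conic_tau hKc)) i)
    (fun i _ => M.sphere.cov_tangent _ _) (by omega)).congr_of_eventuallyEq ?_
  filter_upwards [hf] with t ht using rEnergy_five_eq hKc M.sphere (by omega) ht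

end IsModel

end

/-! ### The Eells–Sampson energies -/

section

variable {n : ℕ}
variable {F : Type*} [NormedAddCommGroup F] [InnerProductSpace ℝ F]

/-- The operator `d^* + d` on families of forms along `Φ`. -/
def dirac (Φ : ℝ × Eucl n → F) (H : Finset (Fin n) → ℝ × Eucl n → F) (I : Finset (Fin n))
    (y : ℝ × Eucl n) : F :=
  -∑ i ∈ Iᶜ, formSign i I • cov Φ (eX i) (H (insert i I)) y +
    ∑ i ∈ I, formSign i I • cov Φ (eX i) (H (I.erase i)) y

/-- The differential of the family `Φ` in the directions of `ℝⁿ`, as a family of forms. -/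
def dform (Φ : ℝ × Eucl n → F) (I : Finset (Fin n)) (y : ℝ × Eucl n) : F :=
  ∑ i, if I = {i} then dir (eX i) Φ y else 0

theorem cov_slice_eq_zero' {Φ A : ℝ × Eucl n → F} {K : Set (Eucl n)} {k : ℕ}
    (hA : IsConic K k A) {t : ℝ} (h : ∀ x, x ≠ 0 → A (t, x) = 0) (i : Fin n) {x : Eucl n}
    (hx : x ≠ 0) : cov Φ (eX i) A (t, x) = 0 :=
  cov_slice_eq_zero hA isOpen_univ (fun z _ hz => h z hz) i hx (Set.mem_univ x)

section Signs

theorem formSign_self_singleton (j : Fin n) : formSign j {j} = 1 := by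
  simp [formSign, Finset.filter_singleton]

theorem formSign_empty (j : Fin n) : formSign j ∅ = 1 := by simp [formSign]

theorem formSign_singleton_antisymm {i j : Fin n} (h : i ≠ j) :
    formSign i {j} = -formSign j {i} := by
  rcases lt_or_gt_of_ne h with h' | h' <;>
    simp [formSign, Finset.filter_singleton, h', not_lt_of_gt h']

theorem formSign_pair {i j : Fin n} : formSign i {i, j} = formSign i {j} := by
  rw [formSign, formSign, Finset.filter_insert, if_neg (lt_irrefl i)]

theorem sum_singletons {M : Type*} [AddCommMonoid M] {f : Finset (Fin n) → M}
    (h : ∀ I, (∀ j, I ≠ {j}) → f I = 0) : ∑ I, f I = ∑ j, f {j} := by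
  have e := Finset.sum_map Finset.univ ⟨fun j : Fin n => ({j} : Finset (Fin n)),
    Finset.singleton_injective⟩ f
  simp only [Function.Embedding.coeFn_mk] at e
  rw [← e]
  symm
  refine Finset.sum_subset (Finset.subset_univ _) fun I _ hI => h I fun j hj => hI ?_
  simp only [Finset.mem_map, Finset.mem_univ, true_and]
  exact ⟨j, hj.symm⟩

theorem sum_antisymm_eq_zero {g : Fin n → Fin n → ℝ} (h : ∀ i j, i ≠ j → g i j = -g j i) :
    ∑ j, ∑ i ∈ ({j} : Finset (Fin n))ᶜ, g i j = 0 := by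
  have e : ∀ j, ∑ i ∈ ({j} : Finset (Fin n))ᶜ, g i j = ∑ i, if i = j then 0 else g i j := by
    intro j
    rw [Finset.sum_ite, Finset.sum_const_zero, zero_add]
    refine Finset.sum_congr ?_ fun _ _ => rfl
    ext i; simp
  simp only [e]
  have h2 : ∑ j, ∑ i, (if i = j then 0 else g i j) = -∑ j, ∑ i, (if i = j then 0 else g i j) := by
    conv_lhs => rw [Finset.sum_comm]
    rw [← Finset.sum_neg_distrib]
    refine Finset.sum_congr rfl fun j _ => ?_
    rw [← Finset.sum_neg_distrib]
    refine Finset.sum_congr rfl fun i _ => ?_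
    by_cases hij : i = j
    · simp [hij]
    · simp [hij, Ne.symm hij, h i j hij]
  linarith

end Signs

section Dirac

variable {K : Set (Eucl n)} {k : ℕ} {Φ : ℝ × Eucl n → F} {H : Finset (Fin n) → ℝ × Eucl n → F}
  {t : ℝ} {x : Eucl n}

theorem IsSphereFamily.conic_dirac (hK : IsClosed K) (hΦ : IsSphereFamily K Φ)
    (hH : ∀ I, IsConic K k (H I)) (I : Finset (Fin n)) : IsConic K (k + 1) (dirac Φ H I) :=
  (IsConic.sum fun i _ => (hΦ.conic_cov_eX hK (hH _) i).const_smul _).neg.add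
    (IsConic.sum fun i _ => (hΦ.conic_cov_eX hK (hH _) i).const_smul _)

theorem IsSphereFamily.tangent_dirac (hΦ : IsSphereFamily K Φ)
    (H : Finset (Fin n) → ℝ × Eucl n → F) (I : Finset (Fin n)) : IsTangent Φ (dirac Φ H I) :=
  fun y hy => by
    have h : ∀ i (A : ℝ × Eucl n → F), inner ℝ (cov Φ (eX i) A y) (Φ y) = 0 := fun i A =>
      hΦ.cov_tangent _ _ y hy
    simp [dirac, inner_add_left, inner_neg_left, sum_inner, inner_smul_left, h]

/-- `d^* + d` maps a `0`-form to a `1`-form. -/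
theorem dirac_of_degree_zero (hH : ∀ I, IsConic K k (H I))
    (h0 : ∀ I, I ≠ ∅ → ∀ x, x ≠ 0 → H I (t, x) = 0) {I : Finset (Fin n)} (hI : ∀ j, I ≠ {j})
    (hx : x ≠ 0) : dirac Φ H I (t, x) = 0 := by
  rw [dirac, Finset.sum_eq_zero, Finset.sum_eq_zero, neg_zero, zero_add]
  · intro i hi
    rw [cov_slice_eq_zero' (hH _) (h0 _ fun h => ?_) i hx, smul_zero]
    exact hI i (by rw [← Finset.insert_erase hi, h, insert_empty_eq])
  · intro i hi
    rw [cov_slice_eq_zero' (hH _) (h0 _ (Finset.insert_ne_empty _ _)) i hx, smul_zero]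

theorem dirac_singleton (H : Finset (Fin n) → ℝ × Eucl n → F) (j : Fin n) (y : ℝ × Eucl n) :
    dirac Φ H {j} y = -∑ i ∈ ({j} : Finset (Fin n))ᶜ,
      formSign i {j} • cov Φ (eX i) (H {i, j}) y + cov Φ (eX j) (H ∅) y := by
  rw [dirac, Finset.sum_singleton, formSign_self_singleton, one_smul, Finset.erase_singleton]

theorem dirac_singleton_of_degree_zero (hH : ∀ I, IsConic K k (H I))
    (h0 : ∀ I, I ≠ ∅ → ∀ x, x ≠ 0 → H I (t, x) = 0) (j : Fin n) (hx : x ≠ 0) :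
    dirac Φ H {j} (t, x) = cov Φ (eX j) (H ∅) (t, x) := by
  rw [dirac_singleton, Finset.sum_eq_zero, neg_zero, zero_add]
  intro i _
  rw [cov_slice_eq_zero' (hH _) (h0 _ (Finset.insert_ne_empty _ _)) i hx, smul_zero]

theorem dirac_empty (H : Finset (Fin n) → ℝ × Eucl n → F) (y : ℝ × Eucl n) :
    dirac Φ H ∅ y = -∑ i, cov Φ (eX i) (H {i}) y := by
  simp [dirac, formSign_empty]

/-- `d^* + d` maps a `1`-form with symmetric covariant derivative to a `0`-form. -/
theorem dirac_of_degree_one (hH : ∀ I, IsConic K k (H I))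
    (h0 : ∀ I, (∀ j, I ≠ {j}) → ∀ x, x ≠ 0 → H I (t, x) = 0) (hx : x ≠ 0)
    (hs : ∀ a b, cov Φ (eX a) (H {b}) (t, x) = cov Φ (eX b) (H {a}) (t, x))
    {I : Finset (Fin n)} (hI : I ≠ ∅) : dirac Φ H I (t, x) = 0 := by
  have h1 : ∑ i ∈ Iᶜ, formSign i I • cov Φ (eX i) (H (insert i I)) (t, x) = 0 := by
    refine Finset.sum_eq_zero fun i hi => ?_
    rw [cov_slice_eq_zero' (hH _) (h0 _ fun j hj => ?_) i hx, smul_zero]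
    have hc := congrArg Finset.card hj
    rw [Finset.card_insert_of_notMem (Finset.mem_compl.mp hi), Finset.card_singleton] at hc
    exact hI (Finset.card_eq_zero.mp (by omega))
  rw [dirac, h1, neg_zero, zero_add]
  by_cases h2 : I.card = 2
  · obtain ⟨a, b, hab, rfl⟩ := Finset.card_eq_two.mp h2
    have ea : ({a, b} : Finset (Fin n)).erase a = {b} := by
      rw [Finset.erase_insert]; simpa using hab
    have eb : ({a, b} : Finset (Fin n)).erase b = {a} := by
      rw [Finset.pair_comm, Finset.erase_insert]; simpa using hab.symm
    have sb : formSign b {a, b} = -formSign a {b} := by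
      rw [Finset.pair_comm, formSign_pair, formSign_singleton_antisymm hab.symm]
    rw [Finset.sum_pair hab, ea, eb, hs a b, sb, formSign_pair, neg_smul, add_neg_cancel]
  · refine Finset.sum_eq_zero fun i hi => ?_
    rw [cov_slice_eq_zero' (hH _) (h0 _ fun j hj => ?_) i hx, smul_zero]
    have hc := congrArg Finset.card hj
    rw [Finset.card_erase_of_mem hi, Finset.card_singleton] at hc
    omega

theorem dform_singleton (j : Fin n) (y : ℝ × Eucl n) : dform Φ {j} y = dir (eX j) Φ y := by
  simp [dform, Finset.singleton_inj]

theorem dform_eq_zero {I : Finset (Fin n)} (hI : ∀ j, I ≠ {j}) (y : ℝ × Eucl n) :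
    dform Φ I y = 0 := by
  simp [dform, hI]

theorem IsSphereFamily.conic_dform (hK : IsClosed K) (hΦ : IsSphereFamily K Φ)
    (I : Finset (Fin n)) : IsConic K 1 (dform Φ I) := by
  refine IsConic.sum fun i _ => ?_
  split_ifs
  · exact hΦ.conic_dir hK i
  · exact IsConic.zero

theorem IsSphereFamily.conic_iterate (hK : IsClosed K) (hΦ : IsSphereFamily K Φ) (m : ℕ)
    (I : Finset (Fin n)) : IsConic K (m + 1) ((dirac Φ)^[m] (dform Φ) I) := by
  induction m generalizing I with
  | zero => exact hΦ.conic_dform hK I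
  | succ m ih =>
    rw [Function.iterate_succ_apply']
    exact hΦ.conic_dirac hK ih I

/-- The second iterate of `d^* + d` on `Φ` is minus the tension field. -/
theorem IsSphereFamily.dirac_dform (hK : IsClosed K) (hΦ : IsSphereFamily K Φ) {y : ℝ × Eucl n}
    (hy : y.2 ≠ 0) : dirac Φ (dform Φ) ∅ y = -tau Φ y ∧
      ∀ I, I ≠ ∅ → dirac Φ (dform Φ) I y = 0 := by
  have hc : ∀ a b, cov Φ (eX a) (dform Φ {b}) y = cov Φ (eX a) (dir (eX b) Φ) y := fun a b =>
    cov_congr (fun z _ => dform_singleton b z) hy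
  refine ⟨?_, fun I hI => ?_⟩
  · rw [dirac_empty, tau]
    simp only [hc]
  · refine dirac_of_degree_one (t := y.1) (x := y.2) (hΦ.conic_dform hK)
      (fun J hJ x _ => dform_eq_zero hJ _) hy (fun a b => ?_) hI
    rw [hc, hc, hΦ.cov_dir_comm _ _ hy]

theorem IsSphereFamily.dirac_dirac_dform (hK : IsClosed K) (hΦ : IsSphereFamily K Φ)
    {y : ℝ × Eucl n} (hy : y.2 ≠ 0) :
    (∀ j, dirac Φ (dirac Φ (dform Φ)) {j} y = -cov Φ (eX j) (tau Φ) y) ∧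
      ∀ I, (∀ j, I ≠ {j}) → dirac Φ (dirac Φ (dform Φ)) I y = 0 := by
  have hH := hΦ.conic_dirac hK (hΦ.conic_dform hK)
  have h0 : ∀ I, I ≠ ∅ → ∀ x, x ≠ 0 → dirac Φ (dform Φ) I (y.1, x) = 0 := fun I hI x hx =>
    (hΦ.dirac_dform hK (y := (y.1, x)) hx).2 I hI
  refine ⟨fun j => ?_, fun I hI => dirac_of_degree_zero (t := y.1) (x := y.2) hH h0 hI hy⟩
  have := dirac_singleton_of_degree_zero (Φ := Φ) (t := y.1) (x := y.2) hH h0 j hy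
  refine this.trans ?_
  rw [← cov_neg]
  exact cov_congr (fun z hz => (hΦ.dirac_dform hK hz).1) hy

/-- The fourth iterate of `d^* + d` on `Φ`, in degree `0`. -/
theorem IsSphereFamily.iterate_three_empty (hK : IsClosed K) (hΦ : IsSphereFamily K Φ)
    {y : ℝ × Eucl n} (hy : y.2 ≠ 0) :
    dirac Φ (dirac Φ (dirac Φ (dform Φ))) ∅ y = lap Φ (tau Φ) y := by
  rw [dirac_empty, lap, ← Finset.sum_neg_distrib]
  refine Finset.sum_congr rfl fun i _ => ?_
  rw [cov_congr (fun z hz => (hΦ.dirac_dirac_dform hK hz).1 i) hy, cov_neg, neg_neg]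

end Dirac

section Ae

variable [CompleteSpace F] {K : Set (Eucl n)} {k : ℕ} {Φ : ℝ × Eucl n → F} {t : ℝ}
  {f : Eucl n → F}

theorem hodgeDirac_ae_eq {H : Finset (Fin n) → ℝ × Eucl n → F} {η : MixedForm n F}
    (hK : IsClosed K) (hH : ∀ I, IsConic K k (H I)) (hk : k + 1 < n)
    (hf : f =ᵐ[volume.restrict (unitBall n)] fun x => Φ (t, x))
    (hη : ∀ I, η I =ᵐ[volume.restrict (unitBall n)] fun x => H I (t, x)) (I : Finset (Fin n)) :
    hodgeDirac (unitBall n) f η I =ᵐ[volume.restrict (unitBall n)]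
      fun x => dirac Φ H I (t, x) := by
  have h := fun (J : Finset (Fin n)) (i : Fin n) => covDeriv_ae_eq hK (hH J) hk hf (hη J) i
  filter_upwards [ae_all_iff.mpr fun J => ae_all_iff.mpr fun i => h J i] with x hx
  simp only [hodgeDirac, coD, extD, dirac, hx]

theorem iterate_hodgeDirac_ae_eq (hK : IsClosed K) (hΦ : IsSphereFamily K Φ) {m : ℕ}
    (hm : m + 1 < n) (hf : f =ᵐ[volume.restrict (unitBall n)] fun x => Φ (t, x))
    (I : Finset (Fin n)) :
    (hodgeDirac (unitBall n) f)^[m] (differential (unitBall n) f) I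
      =ᵐ[volume.restrict (unitBall n)] fun x => (dirac Φ)^[m] (dform Φ) I (t, x) := by
  induction m generalizing I with
  | zero =>
    filter_upwards [ae_all_iff.mpr fun i => hΦ.conic.weakPartial_ae_eq hK (by omega) hf i]
      with x hx
    simp only [Function.iterate_zero, id, differential, dform, hx]
  | succ m ih =>
    simp only [Function.iterate_succ_apply']
    exact hodgeDirac_ae_eq hK (hΦ.conic_iterate hK m) hm hf (ih (by omega)) I

theorem IsSphereFamily.hasDerivAt_esEnergy (hK : IsClosed K) (hΦ : IsSphereFamily K Φ) {m : ℕ}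
    (hm : 2 * (m + 2) < n) {f : ℝ → Eucl n → F}
    (hf : ∀ᶠ t in nhds 0, f t =ᵐ[volume.restrict (unitBall n)] fun x => Φ (t, x)) :
    HasDerivAt (fun t => esEnergy (unitBall n) (m + 2) (f t))
      (∫ x in unitBall n, ∑ I, (inner ℝ (cov Φ eT ((dirac Φ)^[m + 1] (dform Φ) I) (0, x))
        ((dirac Φ)^[m + 1] (dform Φ) I (0, x)) : ℝ)) 0 := by
  refine (hasDerivAt_half_integral_sq (s := Finset.univ) (Φ := Φ)
    (fun I _ => hΦ.conic_iterate hK (m + 1) I) (fun I _ => ?_)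
    (by omega)).congr_of_eventuallyEq ?_
  · rw [Function.iterate_succ_apply']
    exact hΦ.tangent_dirac _ I
  · filter_upwards [hf] with t ht
    rw [esEnergy]
    congr 1
    refine integral_congr_ae ?_
    filter_upwards [ae_all_iff.mpr fun I =>
      iterate_hodgeDirac_ae_eq hK hΦ (m := m + 1) (by omega) ht I] with x hx
    exact Finset.sum_congr rfl fun I _ => congrArg (fun z => ‖z‖ ^ 2) (hx I)

end Ae

namespace IsModel

variable {K : Set (Eucl n)} {Φ : ℝ × Eucl n → F} {N : ℕ → ℝ × Eucl n → F} {c S : ℝ}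
  {lam : ℕ → ℝ}

/-- On sections that are multiples of `N k` at the parameter `0`, the curvature of the pull-back
connection vanishes there. -/
theorem cov_cov_comm (M : IsModel K Φ N c S lam) {W : ℝ × Eucl n → F} {k l : ℕ} {α : ℝ}
    (hW : IsConic K l W) (hWT : IsTangent Φ W) (hW0 : ∀ x, x ≠ 0 → W (0, x) = α • N k (0, x))
    (a b : Fin n) {x : Eucl n} (hx : x ≠ 0) :
    cov Φ (eX a) (cov Φ (eX b) W) (0, x) = cov Φ (eX b) (cov Φ (eX a) W) (0, x) := by
  have h := M.sphere.cov_cov_sub hW hWT (eX a) (eX b) (y := (0, x)) hx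
  rw [hW0 x hx, inner_smul_right, inner_smul_right, M.orthogonal k x a hx, M.orthogonal k x b hx]
    at h
  simpa [sub_eq_zero] using h

/-- At the parameter `0` the fourth iterate of `d^* + d` on `Φ` is of degree `0`, as there the
second covariant derivative of the tension field is symmetric. -/
theorem iterate_three_eq_zero (M : IsModel K Φ N c S lam) {I : Finset (Fin n)} (hI : I ≠ ∅)
    {x : Eucl n} (hx : x ≠ 0) : dirac Φ (dirac Φ (dirac Φ (dform Φ))) I (0, x) = 0 := by
  have hKc := M.compact.isClosed
  have hΦ := M.sphere
  refine dirac_of_degree_one (hΦ.conic_iterate hKc 2)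
    (fun J hJ z hz => (hΦ.dirac_dirac_dform hKc (y := (0, z)) hz).2 J hJ) hx (fun a b => ?_) hI
  change cov Φ (eX a) (dirac Φ (dirac Φ (dform Φ)) {b}) (0, x) =
    cov Φ (eX b) (dirac Φ (dirac Φ (dform Φ)) {a}) (0, x)
  rw [cov_congr (fun z hz => (hΦ.dirac_dirac_dform hKc hz).1 b) hx,
    cov_congr (fun z hz => (hΦ.dirac_dirac_dform hKc hz).1 a) hx, cov_neg, cov_neg,
    M.cov_cov_comm (hΦ.conic_tau hKc) hΦ.tangent_tau M.tau_eq a b hx]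

variable [CompleteSpace F] {f : ℝ → Eucl n → F}

theorem hasDerivAt_esEnergy_three (M : IsModel K Φ N c S lam) (hn : 6 < n)
    (hf : ∀ᶠ t in nhds 0, f t =ᵐ[volume.restrict (unitBall n)] fun x => Φ (t, x)) :
    HasDerivAt (fun t => esEnergy (unitBall n) 3 (f t))
      (c * (lam 2 * (S - lam 4) + c ^ 2) * pairing Φ N 6) 0 := by
  have hKc := M.compact.isClosed
  have hΦ := M.sphere
  rw [← M.integral_variation_three hn]
  refine (hΦ.hasDerivAt_esEnergy hKc (m := 1) (by omega) hf).congr_deriv ?_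
  refine integral_congr_ae ?_
  filter_upwards [ae_unitBall (by omega : 1 ≤ n)] with x hx
  have h := hΦ.dirac_dirac_dform hKc (y := (0, x)) hx.1
  change ∑ I, (inner ℝ (cov Φ eT (dirac Φ (dirac Φ (dform Φ)) I) (0, x))
    (dirac Φ (dirac Φ (dform Φ)) I (0, x)) : ℝ) = _
  rw [sum_singletons fun I hI => by rw [h.2 I hI, inner_zero_right]]
  refine Finset.sum_congr rfl fun j _ => ?_
  rw [h.1 j, cov_congr (fun z hz => (hΦ.dirac_dirac_dform hKc hz).1 j) (y := (0, x)) hx.1, cov_neg,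
    inner_neg_neg]

theorem hasDerivAt_esEnergy_four (M : IsModel K Φ N c S lam) (hn : 8 < n)
    (hf : ∀ᶠ t in nhds 0, f t =ᵐ[volume.restrict (unitBall n)] fun x => Φ (t, x)) :
    HasDerivAt (fun t => esEnergy (unitBall n) 4 (f t))
      (c * lam 2 * (lam 4 * (S - lam 6) + 2 * c ^ 2) * pairing Φ N 8) 0 := by
  have hKc := M.compact.isClosed
  have hΦ := M.sphere
  rw [← M.integral_variation_four hn]
  refine (hΦ.hasDerivAt_esEnergy hKc (m := 2) (by omega) hf).congr_deriv ?_
  refine integral_congr_ae ?_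
  filter_upwards [ae_unitBall (by omega : 1 ≤ n)] with x hx
  change ∑ I, (inner ℝ (cov Φ eT (dirac Φ (dirac Φ (dirac Φ (dform Φ))) I) (0, x))
    (dirac Φ (dirac Φ (dirac Φ (dform Φ))) I (0, x)) : ℝ) = _
  rw [Finset.sum_eq_single ∅ (fun I _ hI => by
      rw [M.iterate_three_eq_zero hI hx.1, inner_zero_right])
      (fun h => absurd (Finset.mem_univ _) h),
    hΦ.iterate_three_empty hKc (y := (0, x)) hx.1,
    cov_congr (fun z hz => hΦ.iterate_three_empty hKc hz) (y := (0, x)) hx.1]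

/-- The curvature terms in the fifth Eells–Sampson energy do not contribute to its first
variation: they vanish at the parameter `0`, and their linearization is an alternating form which
is paired with a symmetric one. -/
theorem hasDerivAt_esEnergy_five (M : IsModel K Φ N c S lam) (hn : 10 < n)
    (hf : ∀ᶠ t in nhds 0, f t =ᵐ[volume.restrict (unitBall n)] fun x => Φ (t, x)) :
    HasDerivAt (fun t => esEnergy (unitBall n) 5 (f t))
      (c * lam 2 * (lam 4 * (lam 6 * (S - lam 8) + 2 * c ^ 2) + c ^ 2 * lam 2) *
        pairing Φ N 10) 0 := by
  have hKc := M.compact.isClosed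
  have hΦ := M.sphere
  rw [← M.integral_variation_five hn]
  refine (hΦ.hasDerivAt_esEnergy hKc (m := 3) (by omega) hf).congr_deriv ?_
  set H : Finset (Fin n) → ℝ × Eucl n → F := dirac Φ (dirac Φ (dirac Φ (dform Φ))) with hHdef
  change ∫ x in unitBall n, ∑ I, (inner ℝ (cov Φ eT (dirac Φ H I) (0, x))
    (dirac Φ H I (0, x)) : ℝ) = _
  have hH : ∀ I, IsConic K 4 (H I) := hΦ.conic_iterate hKc 3
  have hHT : ∀ I, IsTangent Φ (H I) := hΦ.tangent_dirac _
  have hH0 : ∀ I, I ≠ ∅ → ∀ x, x ≠ 0 → H I (0, x) = 0 := fun I hI x hx =>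
    M.iterate_three_eq_zero hI hx
  have hL := hΦ.conic_lap hKc (hΦ.conic_tau hKc)
  have hY : ∀ j, IsConic K 5 (cov Φ (eX j) (lap Φ (tau Φ))) := hΦ.conic_cov_eX hKc hL
  have cB : ∀ I i, IsConic K 5 (cov Φ (eX i) (cov Φ eT (H I))) := fun I i =>
    hΦ.conic_cov_eX hKc (hΦ.conic_cov_eT (hH I)) i
  -- the pointwise density of the first variation; the last sum comes from the `2`-forms `H {i, j}`,
  -- which vanish for the parameter `0` but not for nearby ones
  have hpt : ∀ x : Eucl n, x ≠ 0 → ∑ I, (inner ℝ (cov Φ eT (dirac Φ H I) (0, x))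
      (dirac Φ H I (0, x)) : ℝ) =
      ∑ j, (inner ℝ (cov Φ eT (cov Φ (eX j) (lap Φ (tau Φ))) (0, x))
        (cov Φ (eX j) (lap Φ (tau Φ)) (0, x)) : ℝ) +
      -∑ j, ∑ i ∈ ({j} : Finset (Fin n))ᶜ, formSign i {j} *
        (inner ℝ (cov Φ (eX i) (cov Φ eT (H {i, j})) (0, x))
          (cov Φ (eX j) (lap Φ (tau Φ)) (0, x)) : ℝ) := by
    intro x hx
    have hy : ((0, x) : ℝ × Eucl n).2 ≠ 0 := hx
    rw [sum_singletons fun I hI => by rw [dirac_of_degree_zero hH hH0 hI hx, inner_zero_right],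
      ← Finset.sum_neg_distrib, ← Finset.sum_add_distrib]
    refine Finset.sum_congr rfl fun j _ => ?_
    have hd : ∀ i, DifferentiableAt ℝ (fun z => formSign i {j} • cov Φ (eX i) (H {i, j}) z)
        (0, x) := fun i => ((hΦ.conic_cov_eX hKc (hH _) i).const_smul _).differentiableAt hy
    have e1 : ∀ z : ℝ × Eucl n, z.2 ≠ 0 → cov Φ (eX j) (H ∅) z =
        cov Φ (eX j) (lap Φ (tau Φ)) z := fun z hz =>
      cov_congr (fun z hz => hΦ.iterate_three_empty hKc hz) hz
    have e2 : ∀ i ∈ ({j} : Finset (Fin n))ᶜ,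
        cov Φ eT (fun z => formSign i {j} • cov Φ (eX i) (H {i, j}) z) (0, x) =
        formSign i {j} • cov Φ (eX i) (cov Φ eT (H {i, j})) (0, x) := by
      intro i _
      rw [cov_const_smul _ ((hΦ.conic_cov_eX hKc (hH _) i).differentiableAt hy),
        M.cov_eT_cov (hH _) (hHT _) i hy, curv, hH0 _ (Finset.insert_ne_empty _ _) x hx]
      simp
    have e3 : cov Φ eT (dirac Φ H {j}) (0, x) =
        cov Φ eT (cov Φ (eX j) (lap Φ (tau Φ))) (0, x) +
        -∑ i ∈ ({j} : Finset (Fin n))ᶜ,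
          formSign i {j} • cov Φ (eX i) (cov Φ eT (H {i, j})) (0, x) := by
      rw [cov_congr (B := fun z => cov Φ (eX j) (lap Φ (tau Φ)) z +
          (-∑ i ∈ ({j} : Finset (Fin n))ᶜ, formSign i {j} • cov Φ (eX i) (H {i, j}) z))
          (fun z hz => by rw [dirac_singleton, e1 z hz, add_comm]) hy,
        cov_add ((hY j).differentiableAt hy)
          (DifferentiableAt.fun_sum fun i _ => hd i).fun_neg, cov_neg,
        cov_sum fun i _ => hd i, Finset.sum_congr rfl e2]
    rw [dirac_singleton_of_degree_zero hH hH0 j hx, e1 _ hy, e3, inner_add_left, inner_neg_left,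
      sum_inner]
    simp only [inner_smul_left, RCLike.conj_to_real]
  have i1 := (IsConic.sum (s := Finset.univ) fun j _ =>
    (hΦ.conic_cov_eT (hY j)).inner (hY j)).integrableOn (by omega) 0
  have i3 : ∀ i j, IntegrableOn (fun x => formSign i {j} *
      (inner ℝ (cov Φ (eX i) (cov Φ eT (H {i, j})) (0, x))
        (cov Φ (eX j) (lap Φ (tau Φ)) (0, x)) : ℝ)) (unitBall n) := fun i j =>
    (((cB {i, j} i).inner (hY j)).integrableOn (by omega) 0).const_mul _
  have i2 := integrable_finsetSum (μ := volume.restrict (unitBall n)) Finset.univ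
    fun j _ => integrable_finsetSum ({j} : Finset (Fin n))ᶜ fun i _ => i3 i j
  have e5 : ∀ i j, ∫ x in unitBall n, formSign i {j} *
      (inner ℝ (cov Φ (eX i) (cov Φ eT (H {i, j})) (0, x))
        (cov Φ (eX j) (lap Φ (tau Φ)) (0, x)) : ℝ) =
      formSign i {j} * -∫ x in unitBall n, (inner ℝ (cov Φ eT (H {i, j}) (0, x))
        (cov Φ (eX i) (cov Φ (eX j) (lap Φ (tau Φ))) (0, x)) : ℝ) := by
    intro i j
    rw [integral_const_mul, integral_inner_cov M.compact M.subset hΦ (hΦ.conic_cov_eT (hH _)) (hY j)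
      (fun x hx => hΦ.cov_tangent _ _ (0, x) hx) (fun x hx => hΦ.cov_tangent _ _ (0, x) hx)
      (fun x hx hx0 => by rw [cov, (hH _).dir_eT_eq_zero hx hx0, tangentProj_zero]) (by omega) i]
  -- integrated by parts, the summand is antisymmetric in `i` and `j`
  have e6 : ∫ x in unitBall n, ∑ j, ∑ i ∈ ({j} : Finset (Fin n))ᶜ, formSign i {j} *
        (inner ℝ (cov Φ (eX i) (cov Φ eT (H {i, j})) (0, x))
          (cov Φ (eX j) (lap Φ (tau Φ)) (0, x)) : ℝ) = 0 := by
    rw [integral_finsetSum _ fun j _ => integrable_finsetSum _ fun i _ => i3 i j]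
    simp only [integral_finsetSum _ fun i _ => i3 i _, e5]
    refine sum_antisymm_eq_zero fun i j hij => ?_
    rw [formSign_singleton_antisymm hij, Finset.pair_comm i j, neg_mul]
    congr 3
    refine integral_congr_ae ?_
    filter_upwards [ae_unitBall (by omega : 1 ≤ n)] with x hx
    rw [M.cov_cov_comm hL (hΦ.tangent_lap _) (fun x hx => M.lap_tau_eq hx) i j hx.1]
  calc _ = (∫ x in unitBall n,
        ∑ j, (inner ℝ (cov Φ eT (cov Φ (eX j) (lap Φ (tau Φ))) (0, x))
        (cov Φ (eX j) (lap Φ (tau Φ)) (0, x)) : ℝ)) +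
      -∫ x in unitBall n, ∑ j, ∑ i ∈ ({j} : Finset (Fin n))ᶜ, formSign i {j} *
        (inner ℝ (cov Φ (eX i) (cov Φ eT (H {i, j})) (0, x))
          (cov Φ (eX j) (lap Φ (tau Φ)) (0, x)) : ℝ) := by
        rw [← integral_neg, ← integral_add i1 i2.fun_neg]
        refine integral_congr_ae ?_
        filter_upwards [ae_unitBall (by omega : 1 ≤ n)] with x hx using hpt x hx.1
    _ = _ := by rw [e6, neg_zero, add_zero]

end IsModel

end

/-! ### The maps `φ_a` and their normal sections -/

section

variable {n : ℕ}

/-- The Euclidean space `ℝⁿ × ℝ`. -/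
abbrev Target (n : ℕ) : Type := WithLp 2 (Eucl n × ℝ)

/-- The identification of `ℝⁿ × ℝ` with `Target n`. -/
abbrev toTarget (n : ℕ) : (Eucl n × ℝ) ≃L[ℝ] Target n :=
  (WithLp.prodContinuousLinearEquiv 2 ℝ (Eucl n) ℝ).symm

theorem inner_toTarget (p p' : Eucl n) (q q' : ℝ) :
    (inner ℝ (toTarget n (p, q)) (toTarget n (p', q')) : ℝ) = inner ℝ p p' + q * q' := by
  rw [WithLp.prod_inner_apply]
  simp [mul_comm]

/-- The family, constant in the parameter, `x ↦ |x|⁻ᵐ (α x/|x|, β)`. With `α = sin a`, `β = cos a`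
and `m = 0` this is `φ_a`. -/
def radial (α β : ℝ) (m : ℕ) (y : ℝ × Eucl n) : Target n :=
  toTarget n ((α * (‖y.2‖ ^ (m + 1))⁻¹) • y.2, β * (‖y.2‖ ^ m)⁻¹)

theorem conic_radial (K : Set (Eucl n)) (α β : ℝ) (m : ℕ) :
    IsConic K m (radial (n := n) α β m) := by
  have hw : ContDiff ℝ ∞ (fun z : ℝ × ℝ × Eucl n => ((α • z.2.2, β) : Eucl n × ℝ)) := by fun_prop
  refine ⟨⟨fun z => toTarget n (α • z.2.2, β), (toTarget n).contDiff.comp hw,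
    fun t x hx => ?_⟩, fun _ _ _ _ => rfl⟩
  rw [radial, ← map_smul]
  congr 1
  simp only [Prod.smul_mk, smul_smul, smul_eq_mul, Prod.mk.injEq, pow_succ, mul_inv]
  exact ⟨by congr 1; ring, by ring⟩

theorem dir_comp_snd {G : Type*} [NormedAddCommGroup G] [NormedSpace ℝ G] {a : Eucl n → G}
    {a' : Eucl n →L[ℝ] G} {y : ℝ × Eucl n}
    (h : HasFDerivAt a a' y.2) (i : Fin n) :
    dir (eX i) (fun z : ℝ × Eucl n => a z.2) y = a' (EuclideanSpace.single i 1) := by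
  have h1 : HasFDerivAt (fun z : ℝ × Eucl n => a z.2) _ y := h.comp y hasFDerivAt_snd
  rw [dir, h1.fderiv]
  simp [eX]

theorem inner_single_right (x : Eucl n) (i : Fin n) :
    (inner ℝ x (EuclideanSpace.single i (1 : ℝ)) : ℝ) = x i := by
  simp [EuclideanSpace.inner_single_right]

theorem hasFDerivAt_toTarget {f : Eucl n → Eucl n} {g : Eucl n → ℝ} {f' : Eucl n →L[ℝ] Eucl n}
    {g' : Eucl n →L[ℝ] ℝ} {x : Eucl n} (hf : HasFDerivAt f f' x) (hg : HasFDerivAt g g' x) :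
    HasFDerivAt (fun z => toTarget n (f z, g z))
      ((toTarget n : (Eucl n × ℝ) →L[ℝ] Target n).comp (f'.prod g')) x :=
  (toTarget n).hasFDerivAt.comp x (hf.prodMk hg)

theorem dir_radial (α β : ℝ) (m : ℕ) (i : Fin n) {y : ℝ × Eucl n} (hy : y.2 ≠ 0) :
    dir (eX i) (radial α β m) y =
      toTarget n ((α * (‖y.2‖ ^ (m + 1))⁻¹) • EuclideanSpace.single i 1 -
          (α * (m + 1) * y.2 i * (‖y.2‖ ^ (m + 3))⁻¹) • y.2,
        -(β * m * y.2 i * (‖y.2‖ ^ (m + 2))⁻¹)) := by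
  have h1 := (((hasFDerivAt_norm_pow_inv (m + 1) hy).const_mul α).smul (hasFDerivAt_id y.2))
  have h2 := (hasFDerivAt_norm_pow_inv m hy).const_mul β
  have h := dir_comp_snd (hasFDerivAt_toTarget h1 h2) i
  refine Eq.trans h ?_
  simp only [ContinuousLinearMap.comp_apply, ContinuousLinearMap.prod_apply,
    ContinuousLinearEquiv.coe_coe]
  congr 1
  ext1
  · simp only [add_apply, smul_apply, ContinuousLinearMap.smulRight_apply, innerSL_apply_apply,
      inner_single_right, ContinuousLinearMap.id_apply, smul_eq_mul, id]
    rw [sub_eq_add_neg, ← neg_smul]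
    congr 2
    push_cast; ring
  · simp only [smul_apply, innerSL_apply_apply, inner_single_right, smul_eq_mul]
    ring

theorem sum_sq_coord (x : Eucl n) : ∑ i, x i * x i = ‖x‖ ^ 2 := by
  rw [EuclideanSpace.norm_sq_eq]
  exact Finset.sum_congr rfl fun i _ => by rw [Real.norm_eq_abs, sq_abs, sq]

theorem sum_coord_smul_single (x : Eucl n) :
    ∑ i, x i • (EuclideanSpace.single i (1 : ℝ) : Eucl n) = x := by
  ext j
  simp [Pi.single_apply]

/-- The Laplacian of `|x|⁻ᵐ (α x/|x|, β)` is a function of the same kind. -/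
theorem sum_dir_dir_radial (α β : ℝ) (m : ℕ) {y : ℝ × Eucl n} (hy : y.2 ≠ 0) :
    ∑ i, dir (eX i) (dir (eX i) (radial α β m)) y =
      radial (α * ((m + 1) * (m + 1 - n))) (β * (m * (m + 2 - n))) (m + 2) y := by
  have hN : ‖y.2‖ ≠ 0 := norm_ne_zero_iff.mpr hy
  have key : ∀ i : Fin n, dir (eX i) (dir (eX i) (radial α β m)) y =
      toTarget n ((-(2 * α * (m + 1) * (‖y.2‖ ^ (m + 3))⁻¹)) •
          (y.2 i • EuclideanSpace.single i (1 : ℝ)) -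
          (α * (m + 1) * (‖y.2‖ ^ (m + 3))⁻¹ -
            α * (m + 1) * (m + 3) * (‖y.2‖ ^ (m + 5))⁻¹ * (y.2 i * y.2 i)) • y.2,
        -(β * m * (‖y.2‖ ^ (m + 2))⁻¹) +
          β * m * (m + 2) * (‖y.2‖ ^ (m + 4))⁻¹ * (y.2 i * y.2 i)) := by
    intro i
    have hp : HasFDerivAt (fun z : Eucl n => z i)
        (EuclideanSpace.proj i : Eucl n →L[ℝ] ℝ) y.2 :=
      (EuclideanSpace.proj i : Eucl n →L[ℝ] ℝ).hasFDerivAt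
    have hpi : (EuclideanSpace.proj i : Eucl n →L[ℝ] ℝ) (EuclideanSpace.single i 1) = 1 := by simp
    have h1 := (((hasFDerivAt_norm_pow_inv (m + 1) hy).const_mul α).smul_const
      (EuclideanSpace.single i (1 : ℝ) : Eucl n)).sub
      ((((hp.const_mul (α * (m + 1))).mul (hasFDerivAt_norm_pow_inv (m + 3) hy))).smul
        (hasFDerivAt_id y.2))
    have h2 := ((hp.const_mul (β * m)).mul (hasFDerivAt_norm_pow_inv (m + 2) hy)).neg
    have h := dir_comp_snd (hasFDerivAt_toTarget h1 h2) i
    rw [dir_congr (fun z hz => dir_radial α β m i hz) (eX i) hy]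
    refine Eq.trans h ?_
    simp only [ContinuousLinearMap.comp_apply, ContinuousLinearMap.prod_apply,
      ContinuousLinearEquiv.coe_coe]
    congr 1
    ext1
    · simp only [add_apply, sub_apply, smul_apply, ContinuousLinearMap.smulRight_apply,
        innerSL_apply_apply, inner_single_right, ContinuousLinearMap.id_apply, smul_eq_mul, id,
        hpi, Pi.mul_apply, smul_smul]
      match_scalars <;> ring
    · simp only [add_apply, neg_apply, smul_apply, innerSL_apply_apply, inner_single_right,
        smul_eq_mul, hpi]
      push_cast; ring
  simp only [key]
  rw [← map_sum, radial]
  congr 1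
  ext1
  · rw [Prod.fst_sum]
    simp only [Finset.sum_sub_distrib, ← Finset.smul_sum, ← Finset.sum_smul, ← Finset.mul_sum,
      sum_sq_coord, sum_coord_smul_single, Finset.sum_const, Finset.card_univ, Fintype.card_fin,
      nsmul_eq_mul]
    rw [← sub_smul]
    congr 1
    field_simp
    ring
  · rw [Prod.snd_sum]
    simp only [Finset.sum_add_distrib, ← Finset.mul_sum, sum_sq_coord, Finset.sum_const,
      Finset.card_univ, Fintype.card_fin, nsmul_eq_mul]
    field_simp
    ring

/-- The tangential part of a radial function is a multiple of the normal section. -/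
theorem tangentProj_radial {a : ℝ} (α β : ℝ) (m : ℕ) {y : ℝ × Eucl n} (hy : y.2 ≠ 0) :
    tangentProj (radial (Real.sin a) (Real.cos a) 0 y) (radial α β m y) =
      -(Real.cos a * α - Real.sin a * β) • radial (-Real.cos a) (Real.sin a) m y := by
  have hN : ‖y.2‖ ≠ 0 := norm_ne_zero_iff.mpr hy
  have hsc := Real.sin_sq_add_cos_sq a
  have hi : (inner ℝ (radial α β m y) (radial (Real.sin a) (Real.cos a) 0 y) : ℝ) =
      (α * Real.sin a + β * Real.cos a) * (‖y.2‖ ^ m)⁻¹ := by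
    rw [radial, radial, inner_toTarget, inner_smul_left, inner_smul_right,
      real_inner_self_eq_norm_sq, RCLike.conj_to_real]
    field_simp
    ring
  rw [tangentProj, hi, radial, radial, radial, ← map_smul, ← map_smul, ← map_sub]
  congr 1
  ext1
  · simp only [Prod.smul_mk, Prod.mk_sub_mk, smul_smul]
    rw [← sub_smul]
    congr 1
    simp only [zero_add, pow_one]
    rw [pow_succ]
    field_simp
    linear_combination (-α) * hsc
  · simp only [Prod.smul_mk, Prod.mk_sub_mk, smul_eq_mul]
    simp only [pow_zero, inv_one, mul_one]
    field_simp
    linear_combination (-β) * hsc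

theorem phi_eq_radial (a t : ℝ) (x : Eucl n) :
    phi n a x = radial (Real.sin a) (Real.cos a) 0 (t, x) := by
  rw [phi, radial, smul_smul]; simp

theorem sphereFamily_radial (K : Set (Eucl n)) (a : ℝ) :
    IsSphereFamily K (radial (n := n) (Real.sin a) (Real.cos a) 0) := by
  refine ⟨conic_radial K _ _ 0, fun y hy => ?_⟩
  have hN : ‖y.2‖ ≠ 0 := norm_ne_zero_iff.mpr hy
  rw [← sq_eq_sq₀ (norm_nonneg _) zero_le_one, ← real_inner_self_eq_norm_sq, radial,
    inner_toTarget, inner_smul_left, inner_smul_right, real_inner_self_eq_norm_sq,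
    RCLike.conj_to_real]
  simp only [zero_add, pow_one, pow_zero, inv_one, mul_one]
  field_simp
  linear_combination Real.sin_sq_add_cos_sq a

/-- The normal sections `|x|⁻ˡ ν` with `ν = (-cos a · x/|x|, sin a)`. -/
def normalSection (n : ℕ) (a : ℝ) (l : ℕ) : ℝ × Eucl n → Target n :=
  radial (-Real.cos a) (Real.sin a) l

/-- The factors by which the rough Laplacian along `φ_a` acts on the normal sections, mapping the
one of order `l` to a multiple of the one of order `l + 2`. -/
def lamb (n : ℕ) (a : ℝ) (l : ℕ) : ℝ := l * (n - 2 - l) + (n - 1) * Real.cos a ^ 2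

theorem sum_const_sub_coord_sq (b d : ℝ) (x : Eucl n) :
    ∑ i, (b - d * (x i * x i)) = n * b - d * ‖x‖ ^ 2 := by
  rw [Finset.sum_sub_distrib, ← Finset.mul_sum, sum_sq_coord]; simp

theorem inner_dir_radial (α β : ℝ) (m : ℕ) (s c : ℝ) (i : Fin n) {y : ℝ × Eucl n}
    (hy : y.2 ≠ 0) :
    (inner ℝ (dir (eX i) (radial s c 0) y) (dir (eX i) (radial α β m) y) : ℝ) =
      s * α * ((‖y.2‖ ^ (m + 2))⁻¹ - (‖y.2‖ ^ (m + 4))⁻¹ * (y.2 i * y.2 i)) := by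
  have hN : ‖y.2‖ ≠ 0 := norm_ne_zero_iff.mpr hy
  rw [dir_radial _ _ _ _ hy, dir_radial _ _ _ _ hy, inner_toTarget]
  simp only [inner_sub_left, inner_sub_right, inner_smul_left, inner_smul_right,
    real_inner_self_eq_norm_sq, inner_single_right, RCLike.conj_to_real,
    real_inner_comm y.2 (EuclideanSpace.single i (1 : ℝ) : Eucl n)]
  simp only [PiLp.norm_single, norm_one]
  push_cast
  field_simp
  ring

/-- The map `φ_a`, as a constant family, satisfies the conditions of `IsModel`. -/
theorem isModel_radial {K : Set (Eucl n)} (hK : IsCompact K) (hKB : K ⊆ unitBall n) (a : ℝ) :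
    IsModel K (radial (Real.sin a) (Real.cos a) 0) (normalSection n a)
      ((n - 1) * Real.sin a * Real.cos a) ((n - 1) * Real.sin a ^ 2) (lamb n a) := by
  have hS := sphereFamily_radial K a
  have hsc := Real.sin_sq_add_cos_sq a
  have htan : ∀ l, IsTangent (radial (Real.sin a) (Real.cos a) 0) (normalSection n a l) := by
    intro l y hy
    have hN : ‖y.2‖ ≠ 0 := norm_ne_zero_iff.mpr hy
    rw [normalSection, radial, radial, inner_toTarget, inner_smul_left, inner_smul_right,
      real_inner_self_eq_norm_sq, RCLike.conj_to_real]
    field_simp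
    ring
  have horth : ∀ l i (y : ℝ × Eucl n), y.2 ≠ 0 →
      inner ℝ (dir (eX i) (radial (Real.sin a) (Real.cos a) 0) y) (normalSection n a l y) = 0 := by
    intro l i y hy
    have hN : ‖y.2‖ ≠ 0 := norm_ne_zero_iff.mpr hy
    rw [normalSection, dir_radial _ _ _ _ hy, radial, inner_toTarget]
    simp only [inner_sub_left, inner_smul_left, inner_smul_right, real_inner_self_eq_norm_sq,
      RCLike.conj_to_real, real_inner_comm y.2 (EuclideanSpace.single i (1 : ℝ) : Eucl n),
      inner_single_right]
    push_cast
    field_simp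
    ring
  -- the tangential part of the derivative is the whole derivative
  have hcov : ∀ l i (y : ℝ × Eucl n), y.2 ≠ 0 →
      cov (radial (Real.sin a) (Real.cos a) 0) (eX i) (normalSection n a l) y =
        dir (eX i) (normalSection n a l) y := by
    intro l i y hy
    rw [hS.cov_eq (A := normalSection n a l) (conic_radial K _ _ l) (htan l) _ hy,
      real_inner_comm, horth l i y hy, zero_smul, add_zero]
  refine ⟨hK, hKB, hS, fun l => conic_radial K _ _ l, fun k l x hx => ?_,
    fun l x hx => htan l (0, x) hx, fun l x i hx => horth l i (0, x) hx, fun x hx => ?_,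
    fun l x hx => ?_, fun l x hx => ?_, fun x hx => ?_⟩
  · rw [normalSection, normalSection, radial, radial, ← map_smul]
    congr 1
    simp only [Prod.smul_mk, smul_smul, smul_eq_mul, pow_add, mul_inv, Prod.mk.injEq]
    exact ⟨by congr 1; ring, by ring⟩
  · have hN : ‖x‖ ≠ 0 := norm_ne_zero_iff.mpr hx
    simp only [inner_dir_radial _ _ _ _ _ _ (y := (0, x)) hx]
    rw [← Finset.mul_sum, sum_const_sub_coord_sq]
    simp only [zero_add]
    field_simp
  · have hN : ‖x‖ ≠ 0 := norm_ne_zero_iff.mpr hx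
    simp only [hcov l _ (0, x) hx]
    simp only [normalSection, inner_dir_radial _ _ _ _ _ _ (y := (0, x)) hx]
    rw [← Finset.mul_sum, sum_const_sub_coord_sq]
    field_simp
    ring
  · have e : ∀ i, cov (radial (Real.sin a) (Real.cos a) 0) (eX i)
        (cov (radial (Real.sin a) (Real.cos a) 0) (eX i) (normalSection n a l)) (0, x) =
        tangentProj (radial (Real.sin a) (Real.cos a) 0 (0, x))
          (dir (eX i) (dir (eX i) (normalSection n a l)) (0, x)) := fun i =>
      cov_congr (hcov l i) hx
    rw [lap]
    simp only [e]
    rw [← tangentProj_sum, normalSection, sum_dir_dir_radial _ _ _ (y := (0, x)) hx,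
      tangentProj_radial _ _ _ hx, normalSection, lamb]
    congr 1
    linear_combination ((l : ℝ) * (l + 2 - n)) * hsc
  · rw [tau]
    simp only [cov]
    rw [← tangentProj_sum, sum_dir_dir_radial _ _ _ (y := (0, x)) hx, tangentProj_radial _ _ _ hx,
      normalSection]
    congr 1
    push_cast; ring

/-- The conditions in `IsModel` only concern the parameter `0`. -/
theorem IsModel.of_eq_zero {F : Type*} [NormedAddCommGroup F] [InnerProductSpace ℝ F]
    {K : Set (Eucl n)} {Φ Ψ : ℝ × Eucl n → F} {N : ℕ → ℝ × Eucl n → F} {c S : ℝ} {lam : ℕ → ℝ}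
    (M : IsModel K Ψ N c S lam) (hΦ : IsSphereFamily K Φ)
    (h : ∀ x, x ≠ 0 → Φ (0, x) = Ψ (0, x)) : IsModel K Φ N c S lam := by
  have hKc := M.compact.isClosed
  have hd : ∀ i x, x ≠ 0 → dir (eX i) Φ (0, x) = dir (eX i) Ψ (0, x) := fun i x hx =>
    dir_slice_congr (hΦ.conic.differentiableAt (y := (0, x)) hx)
      (M.sphere.conic.differentiableAt (y := (0, x)) hx)
      (by filter_upwards [isOpen_ne.mem_nhds hx] with z hz using h z hz) _
  have hc : ∀ i x (A : ℝ × Eucl n → F), x ≠ 0 → cov Φ (eX i) A (0, x) = cov Ψ (eX i) A (0, x) :=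
    fun i x A hx => by rw [cov, cov, h x hx]
  refine ⟨M.compact, M.subset, hΦ, M.conic, M.shift, fun l x hx => ?_, fun l x i hx => ?_,
    fun x hx => ?_, fun l x hx => ?_, fun l x hx => ?_, fun x hx => ?_⟩
  · rw [h x hx]; exact M.tangent l x hx
  · rw [hd i x hx]; exact M.orthogonal l x i hx
  · simp only [hd _ x hx]; exact M.sum_sq x hx
  · simp only [hd _ x hx, hc _ x _ hx]; exact M.sum_inner_cov l x hx
  · rw [← M.lap_eq l x hx, lap, lap]
    refine Finset.sum_congr rfl fun i _ => ?_
    rw [cov_slice_congr (c := 1) (B := cov Ψ (eX i) (N l)) (hΦ.conic_cov_eX hKc (M.conic l) i)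
      (M.sphere.conic_cov_eX hKc (M.conic l) i) (fun z hz => by rw [hc i z _ hz, one_smul]) i hx,
      one_smul, hc i x _ hx]
  · rw [← M.tau_eq x hx, tau, tau]
    refine Finset.sum_congr rfl fun i _ => ?_
    rw [cov_slice_congr (c := 1) (B := dir (eX i) Ψ) (hΦ.conic_dir hKc i)
      (M.sphere.conic_dir hKc i) (fun z hz => by rw [hd i z hz, one_smul]) i hx,
      one_smul, hc i x _ hx]

end

/-! ### Variations of `φ_a` -/

section

variable {n : ℕ}

/-- A bounded reparametrization: the variation only matters for small values of the parameter, and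
composing with `σ` makes it defined and smooth for all of them. -/
theorem exists_smooth_truncation {ε : ℝ} (hε : 0 < ε) :
    ∃ σ : ℝ → ℝ, ContDiff ℝ ∞ σ ∧ (∀ᶠ t in nhds 0, σ t = t) ∧ ∀ t, |σ t| < ε := by
  let f : ContDiffBump (0 : ℝ) := ⟨ε / 4, ε / 2, by linarith, by linarith⟩
  refine ⟨fun t => f t * t, f.contDiff.mul contDiff_id, ?_, fun t => ?_⟩
  · filter_upwards [f.eventuallyEq_one] with t ht
    rw [ht]; simp
  · rcases lt_or_ge |t| (ε / 2) with h | h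
    · rw [abs_mul, abs_of_nonneg f.nonneg]
      calc f t * |t| ≤ 1 * |t| := mul_le_mul_of_nonneg_right f.le_one (abs_nonneg t)
        _ < ε := by linarith
    · show |f t * t| < ε
      rw [f.zero_of_le_dist (by rw [Real.dist_eq, sub_zero]; exact h), zero_mul, abs_zero]
      exact hε

/-- The family `φ_a + σ(t) V`. -/
def perturb (a : ℝ) (σ : ℝ → ℝ) (V : Eucl n → Target n) (y : ℝ × Eucl n) : Target n :=
  radial (Real.sin a) (Real.cos a) 0 y + σ y.1 • V y.2

/-- The family `(φ_a + σ(t) V) / |φ_a + σ(t) V|`. -/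
def variation (a : ℝ) (σ : ℝ → ℝ) (V : Eucl n → Target n) (y : ℝ × Eucl n) : Target n :=
  ‖perturb a σ V y‖⁻¹ • perturb a σ V y

theorem radial_zero_eq (α β t : ℝ) (x : Eucl n) :
    radial α β 0 (t, x) = toTarget n (α • (‖x‖⁻¹ • x), β) := by
  simp [radial, smul_smul]

/-- A perturbation smaller than `cos a` keeps the last coordinate positive. -/
theorem toTarget_add_ne_zero {a : ℝ} (p : Eucl n) {w : Target n} (h : ‖w‖ < Real.cos a) :
    toTarget n (p, Real.cos a) + w ≠ 0 := by
  intro h0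
  have h2 : Real.cos a + w.snd = 0 := by
    have := congrArg WithLp.snd h0
    simpa using this
  have h3 : |w.snd| ≤ ‖w‖ := by
    have := WithLp.prod_norm_sq_eq_of_L2 w
    rw [← Real.norm_eq_abs]
    refine abs_le_of_sq_le_sq' ?_ (norm_nonneg _) |>.2
    nlinarith [sq_nonneg ‖w.fst‖]
  have := neg_abs_le w.snd
  linarith

section

variable {a : ℝ} {σ : ℝ → ℝ} {V : Eucl n → Target n}

theorem norm_smul_lt {C : ℝ} (hC : ∀ x, ‖V x‖ ≤ C) (hC0 : 0 ≤ C)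
    (hσ : ∀ t, |σ t| < Real.cos a / (C + 1)) (t : ℝ) (x : Eucl n) :
    ‖σ t • V x‖ < Real.cos a := by
  rw [norm_smul, Real.norm_eq_abs]
  have h1 : |σ t| * ‖V x‖ ≤ |σ t| * (C + 1) :=
    mul_le_mul_of_nonneg_left (by linarith [hC x]) (abs_nonneg _)
  have h2 : |σ t| * (C + 1) < Real.cos a := (lt_div_iff₀ (by linarith)).mp (hσ t)
  linarith

theorem perturb_ne_zero (hs : ∀ t x, ‖σ t • V x‖ < Real.cos a) (y : ℝ × Eucl n) :
    perturb a σ V y ≠ 0 := by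
  rw [perturb, radial_zero_eq (t := y.1)]
  exact toTarget_add_ne_zero _ (hs _ _)

theorem variation_zero (hσ0 : σ 0 = 0) {x : Eucl n} (hx : x ≠ 0) :
    variation a σ V (0, x) = radial (Real.sin a) (Real.cos a) 0 (0, x) := by
  have h1 : ‖radial (Real.sin a) (Real.cos a) 0 ((0, x) : ℝ × Eucl n)‖ = 1 :=
    (sphereFamily_radial ∅ a).norm_eq (0, x) hx
  rw [variation, perturb]
  simp only [hσ0, zero_smul, add_zero]
  rw [h1, inv_one, one_smul]

theorem sphereFamily_variation (hV : ContDiff ℝ ∞ V) (hσ : ContDiff ℝ ∞ σ)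
    (hs : ∀ t x, ‖σ t • V x‖ < Real.cos a) :
    IsSphereFamily (tsupport V) (variation a σ V) := by
  refine ⟨⟨?_, fun t x hx hx0 => ?_⟩, fun y hy => ?_⟩
  · have hp : ContDiff ℝ ∞ (fun z : ℝ × ℝ × Eucl n =>
        ((Real.sin a • z.2.2, Real.cos a) : Eucl n × ℝ)) := by fun_prop
    have hz : ContDiff ℝ ∞ (fun z : ℝ × ℝ × Eucl n =>
        toTarget n (Real.sin a • z.2.2, Real.cos a) + σ z.1 • V (z.2.1 • z.2.2)) :=
      ((toTarget n).contDiff.comp hp).add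
        ((hσ.comp contDiff_fst).smul (hV.comp (contDiff_snd.fst.smul contDiff_snd.snd)))
    have hne : ∀ z : ℝ × ℝ × Eucl n,
        toTarget n (Real.sin a • z.2.2, Real.cos a) + σ z.1 • V (z.2.1 • z.2.2) ≠ 0 :=
      fun z => toTarget_add_ne_zero _ (hs _ _)
    refine ⟨fun z => ‖toTarget n (Real.sin a • z.2.2, Real.cos a) + σ z.1 • V (z.2.1 • z.2.2)‖⁻¹ •
      (toTarget n (Real.sin a • z.2.2, Real.cos a) + σ z.1 • V (z.2.1 • z.2.2)),
      ((hz.norm ℝ hne).inv fun z => norm_ne_zero_iff.mpr (hne z)).smul hz, fun t x hx => ?_⟩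
    have hx' : ‖x‖ ≠ 0 := norm_ne_zero_iff.mpr hx
    rw [variation, perturb, radial_zero_eq]
    simp only [pow_zero, inv_one, one_smul, smul_inv_smul₀ hx']
  · simp only [variation, perturb, image_eq_zero_of_notMem_tsupport hx, smul_zero, add_zero]
    rfl
  · rw [variation, norm_smul, norm_inv, norm_norm,
      inv_mul_cancel₀ (norm_ne_zero_iff.mpr (perturb_ne_zero hs y))]

/-- Normalizing a variation of a unit vector changes its velocity by a multiple of that vector. -/
theorem hasDerivAt_normalize {F : Type*} [NormedAddCommGroup F] [InnerProductSpace ℝ F] {p : F}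
    (hp : ‖p‖ = 1) (v : F) :
    ∃ d : ℝ, HasDerivAt (fun t : ℝ => ‖p + t • v‖⁻¹ • (p + t • v)) (v + d • p) 0 := by
  have h2 : HasDerivAt (fun t : ℝ => p + t • v) v 0 := by
    simpa using ((hasDerivAt_id (0 : ℝ)).smul_const v).const_add p
  have hd : DifferentiableAt ℝ (fun t : ℝ => ‖p + t • v‖⁻¹) 0 := by
    have hne : p + (0 : ℝ) • v ≠ 0 := by
      rw [zero_smul, add_zero, ← norm_ne_zero_iff, hp]; exact one_ne_zero
    exact (h2.differentiableAt.norm ℝ hne).inv (norm_ne_zero_iff.mpr hne)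
  exact ⟨_, (hd.hasDerivAt.smul h2).congr_deriv (by simp [hp]; rfl)⟩

theorem inner_dir_variation (hV : ContDiff ℝ ∞ V) (hσ : ContDiff ℝ ∞ σ)
    (hσ1 : ∀ᶠ t in nhds 0, σ t = t) (hs : ∀ t x, ‖σ t • V x‖ < Real.cos a) {x : Eucl n}
    (hx : x ≠ 0) {w : Target n}
    (hw : inner ℝ w (radial (Real.sin a) (Real.cos a) 0 ((0, x) : ℝ × Eucl n)) = (0 : ℝ)) :
    inner ℝ (dir eT (variation a σ V) (0, x)) w = (inner ℝ (V x) w : ℝ) := by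
  have hS := sphereFamily_variation hV hσ hs
  have h1 := dir_time (hS.conic.differentiableAt (y := (0, x)) hx)
  obtain ⟨d, hd⟩ := hasDerivAt_normalize ((sphereFamily_radial ∅ a).norm_eq (0, x) hx) (V x)
  have e : (fun t : ℝ => variation a σ V (t, x)) =ᶠ[nhds 0]
      fun t : ℝ => ‖radial (Real.sin a) (Real.cos a) 0 ((0, x) : ℝ × Eucl n) + t • V x‖⁻¹ •
        (radial (Real.sin a) (Real.cos a) 0 ((0, x) : ℝ × Eucl n) + t • V x) := by
    filter_upwards [hσ1] with t ht
    simp only [variation, perturb, ht, radial]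
  rw [h1.unique (hd.congr_of_eventuallyEq e), inner_add_left, inner_smul_left,
    (real_inner_comm w _).trans hw, mul_zero, add_zero]

end

/-- The pairing of a variation field with the normal section `|x|⁻ˡ ν`. -/
def normalPairing (a : ℝ) (l : ℕ) (V : Eucl n → Target n) : ℝ :=
  ∫ x in unitBall n, inner ℝ (V x) (normalSection n a l (0, x))

/-- Every admissible variation of `φ_a` is, for small parameters, a family to which the first
variation formulas apply. -/
theorem exists_model (hn : 1 ≤ n) {a : ℝ} (ha : 0 < Real.cos a) {V : Eucl n → Target n}
    (hV : IsTestFunction (unitBall n) V) :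
    ∃ (K : Set (Eucl n)) (Φ : ℝ × Eucl n → Target n),
      IsModel K Φ (normalSection n a) ((n - 1) * Real.sin a * Real.cos a)
        ((n - 1) * Real.sin a ^ 2) (lamb n a) ∧
      (∀ᶠ t in nhds 0, sphereVariation (phi n a) V t =ᵐ[volume.restrict (unitBall n)]
        fun x => Φ (t, x)) ∧
      ∀ l, IsModel.pairing Φ (normalSection n a) l = normalPairing a l V := by
  obtain ⟨C, hC⟩ := hV.2.1.exists_bound_of_continuous hV.1.continuous
  have hC0 : 0 ≤ C := (norm_nonneg (V 0)).trans (hC 0)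
  obtain ⟨σ, hσ, hσ1, hσb⟩ := exists_smooth_truncation (div_pos ha (by linarith : 0 < C + 1))
  have hs := norm_smul_lt (V := V) hC hC0 hσb
  have hK : IsCompact (tsupport V) := hV.2.1
  have M := isModel_radial hK hV.2.2 a
  refine ⟨tsupport V, variation a σ V, M.of_eq_zero (sphereFamily_variation hV.1 hσ hs)
    fun x hx => variation_zero hσ1.self_of_nhds hx, ?_, fun l => ?_⟩
  · filter_upwards [hσ1] with t ht
    filter_upwards with x
    rw [variation, perturb, sphereVariation, phi_eq_radial a t]
    simp only [ht]
  · rw [IsModel.pairing, normalPairing]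
    refine integral_congr_ae ?_
    filter_upwards [ae_unitBall hn] with x hx
    exact inner_dir_variation hV.1 hσ hσ1 hs hx.1 (M.tangent l x hx.1)

theorem memSobolevSphere_phi {r : ℕ} (hn : 2 * r < n) (a : ℝ) :
    MemSobolevSphere (unitBall n) r (phi n a) := by
  have h := (conic_radial (n := n) ∅ (Real.sin a) (Real.cos a) 0).memSobolev (j := r)
    isClosed_empty (by omega) 0
  refine ⟨h.congr ?_, ?_⟩
  · filter_upwards with x using (phi_eq_radial a 0 x).symm
  · filter_upwards [ae_unitBall (by omega : 1 ≤ n)] with x hx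
    rw [mem_sphere_zero_iff_norm, phi_eq_radial a 0]
    exact (sphereFamily_radial ∅ a).norm_eq (0, x) hx.1

/-- The normal pairings do not all vanish: test with a bump function times the last basis
vector. -/
theorem exists_normalPairing_pos {l : ℕ} (hl : l < n) {a : ℝ} (ha : 0 < Real.sin a) :
    ∃ V : Eucl n → Target n, IsTestFunction (unitBall n) V ∧ 0 < normalPairing a l V := by
  have hn : 1 ≤ n := by omega
  have : NeZero n := ⟨by omega⟩
  let f : ContDiffBump (0 : Eucl n) := ⟨1 / 4, 1 / 2, by norm_num, by norm_num⟩
  have hf : IsTestFunction (unitBall n) (fun x => f x • toTarget n (0, 1)) := by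
    have hsub : tsupport (fun x => f x • toTarget n ((0 : Eucl n), (1 : ℝ))) ⊆ tsupport f :=
      closure_mono fun x hx h0 => hx (by simp only [h0, zero_smul])
    refine ⟨f.contDiff.smul contDiff_const, f.hasCompactSupport.smul_right, hsub.trans ?_⟩
    rw [f.tsupport_eq]
    exact Metric.closedBall_subset_ball (by norm_num)
  refine ⟨_, hf, ?_⟩
  have e : ∀ x : Eucl n, (inner ℝ (f x • toTarget n (0, 1)) (normalSection n a l (0, x)) : ℝ) =
      f x * (Real.sin a * (‖x‖ ^ l)⁻¹) := by
    intro x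
    rw [inner_smul_left, normalSection, radial, inner_toTarget]
    simp
  have hint : IntegrableOn (fun x : Eucl n => f x * (Real.sin a * (‖x‖ ^ l)⁻¹)) (unitBall n) := by
    have h1 := ((integrableOn_norm_pow_inv_iff hn l).mpr hl).const_mul (Real.sin a)
    refine Integrable.bdd_mul (c := 1) h1 f.continuous.aestronglyMeasurable ?_
    filter_upwards with x
    rw [Real.norm_eq_abs, abs_of_nonneg f.nonneg]
    exact f.le_one
  rw [normalPairing]
  simp only [e]
  rw [setIntegral_pos_iff_support_of_nonneg_ae ?_ hint]
  · have hss : Metric.ball (0 : Eucl n) (1 / 2) \ {0} ⊆ Function.support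
        (fun x : Eucl n => f x * (Real.sin a * (‖x‖ ^ l)⁻¹)) ∩ unitBall n := by
      rintro x ⟨hx, hx0⟩
      refine ⟨?_, Metric.ball_subset_ball (by norm_num) hx⟩
      have h1 : 0 < f x := f.pos_of_mem_ball hx
      have h2 : 0 < ‖x‖ := norm_pos_iff.mpr hx0
      rw [Function.mem_support]
      positivity
    refine lt_of_lt_of_le ?_ (measure_mono hss)
    rw [measure_sdiff_null (measure_singleton 0)]
    exact Metric.measure_ball_pos _ _ (by norm_num)
  · filter_upwards with x
    have := f.nonneg (x := x)
    simp only [Pi.zero_apply]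
    positivity

/-- A functional whose first variation at `φ_a` is `κ` times the pairing with a normal section has
`φ_a` as a critical point if and only if `κ = 0`. -/
theorem isWeakCriticalPoint_phi_iff {r l : ℕ} (hr : 2 * r < n) (hl : l < n) {a : ℝ}
    (ha : 0 < Real.sin a) {En : (Eucl n → Target n) → ℝ} {κ : ℝ}
    (h : ∀ V : Eucl n → Target n, IsTestFunction (unitBall n) V →
      HasDerivAt (fun t => En (sphereVariation (phi n a) V t)) (κ * normalPairing a l V) 0) :
    IsWeakCriticalPoint (unitBall n) r En (phi n a) ↔ κ = 0 := by
  constructor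
  · intro hc
    obtain ⟨V, hV, hp⟩ := exists_normalPairing_pos hl ha
    have := (h V hV).unique (hc.2 V hV)
    exact (mul_eq_zero.mp this).resolve_right hp.ne'
  · intro hκ
    refine ⟨memSobolevSphere_phi hr a, fun V hV => ?_⟩
    simpa [hκ] using h V hV

theorem not_isWeaklyHarmonic_phi (hn : 2 < n) {a : ℝ} (hs : 0 < Real.sin a)
    (hc : 0 < Real.cos a) : ¬ IsWeaklyHarmonic (unitBall n) (phi n a) := by
  rw [IsWeaklyHarmonic, isWeakCriticalPoint_phi_iff (l := 2)
    (κ := -(((n : ℝ) - 1) * Real.sin a * Real.cos a)) hn hn hs]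
  · have : (2 : ℝ) < n := by exact_mod_cast hn
    have : 0 < ((n : ℝ) - 1) * Real.sin a * Real.cos a :=
      mul_pos (mul_pos (by linarith) hs) hc
    linarith
  · intro V hV
    obtain ⟨K, Φ, M, hf, hp⟩ := exists_model (by omega) hc hV
    have := M.hasDerivAt_energy hn hf
    rwa [hp] at this

end

/-! ### The Euler–Lagrange equations of `φ_a` -/

section

variable {n : ℕ} {a : ℝ}

theorem isWeakCriticalPoint_three_iff (hn : 6 < n) (hs : 0 < Real.sin a) (hc : 0 < Real.cos a)
    {En : (Eucl n → Target n) → ℝ}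
    (hE : En = rEnergy (unitBall n) 3 ∨ En = esEnergy (unitBall n) 3) :
    IsWeakCriticalPoint (unitBall n) 3 En (phi n a) ↔
      ((n : ℝ) - 1) * Real.sin a * Real.cos a *
        (lamb n a 2 * ((n - 1) * Real.sin a ^ 2 - lamb n a 4) +
          ((n - 1) * Real.sin a * Real.cos a) ^ 2) = 0 := by
  refine isWeakCriticalPoint_phi_iff (l := 6) hn hn hs fun V hV => ?_
  obtain ⟨K, Φ, M, hf, hp⟩ := exists_model (by omega) hc hV
  rw [← hp]
  rcases hE with rfl | rfl
  · exact M.hasDerivAt_rEnergy_three hn hf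
  · exact M.hasDerivAt_esEnergy_three hn hf

theorem isWeakCriticalPoint_four_iff (hn : 8 < n) (hs : 0 < Real.sin a) (hc : 0 < Real.cos a)
    {En : (Eucl n → Target n) → ℝ}
    (hE : En = rEnergy (unitBall n) 4 ∨ En = esEnergy (unitBall n) 4) :
    IsWeakCriticalPoint (unitBall n) 4 En (phi n a) ↔
      ((n : ℝ) - 1) * Real.sin a * Real.cos a * lamb n a 2 *
        (lamb n a 4 * ((n - 1) * Real.sin a ^ 2 - lamb n a 6) +
          2 * ((n - 1) * Real.sin a * Real.cos a) ^ 2) = 0 := by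
  refine isWeakCriticalPoint_phi_iff (l := 8) hn hn hs fun V hV => ?_
  obtain ⟨K, Φ, M, hf, hp⟩ := exists_model (by omega) hc hV
  rw [← hp]
  rcases hE with rfl | rfl
  · exact M.hasDerivAt_rEnergy_four hn hf
  · exact M.hasDerivAt_esEnergy_four hn hf

theorem isWeakCriticalPoint_five_iff (hn : 10 < n) (hs : 0 < Real.sin a) (hc : 0 < Real.cos a)
    {En : (Eucl n → Target n) → ℝ}
    (hE : En = rEnergy (unitBall n) 5 ∨ En = esEnergy (unitBall n) 5) :
    IsWeakCriticalPoint (unitBall n) 5 En (phi n a) ↔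
      ((n : ℝ) - 1) * Real.sin a * Real.cos a * lamb n a 2 *
        (lamb n a 4 * (lamb n a 6 * ((n - 1) * Real.sin a ^ 2 - lamb n a 8) +
          2 * ((n - 1) * Real.sin a * Real.cos a) ^ 2) +
          ((n - 1) * Real.sin a * Real.cos a) ^ 2 * lamb n a 2) = 0 := by
  refine isWeakCriticalPoint_phi_iff (l := 10) hn hn hs fun V hV => ?_
  obtain ⟨K, Φ, M, hf, hp⟩ := exists_model (by omega) hc hV
  rw [← hp]
  rcases hE with rfl | rfl
  · exact M.hasDerivAt_rEnergy_five hn hf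
  · exact M.hasDerivAt_esEnergy_five hn hf

theorem eq_half_arccos_iff (ha0 : 0 < a) (ha1 : a < Real.pi / 2) {y : ℝ} (h1 : -1 ≤ y)
    (h2 : y ≤ 1) : a = 1 / 2 * Real.arccos y ↔ Real.cos a ^ 2 = (1 + y) / 2 := by
  have h := Real.cos_two_mul a
  constructor
  · intro e
    have : 2 * a = Real.arccos y := by rw [e]; ring
    rw [this, Real.cos_arccos h1 h2] at h
    linarith
  · intro e
    have : Real.cos (2 * a) = y := by rw [h, e]; ring
    rw [← this, Real.arccos_cos (by linarith) (by linarith)]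
    ring

/-- A quadratic with roots of opposite signs: a positive number is a root exactly if it is the
positive root. -/
theorem eq_iff_of_factor {C p q : ℝ} (hC : 0 < C) (hq : q ≤ 0) :
    (C - p) * (C - q) = 0 ↔ C = p := by
  rw [mul_eq_zero, sub_eq_zero, or_iff_left (by linarith)]

theorem lamb_pos {l : ℕ} (hn : l + 2 < n) (hc : 0 < Real.cos a) : 0 < lamb n a l := by
  have : ((l : ℝ) + 2) < n := by exact_mod_cast hn
  have h1 : (0 : ℝ) ≤ l * (n - 2 - l) := mul_nonneg (Nat.cast_nonneg l) (by linarith)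
  have h2 : 0 < ((n : ℝ) - 1) * Real.cos a ^ 2 :=
    mul_pos (by linarith [(Nat.cast_nonneg l : (0 : ℝ) ≤ l)]) (by positivity)
  rw [lamb]
  linarith

/-- With `C = cos² a`, for `n = 7` the equation is `9C² + 2C - 1 = 0`; for larger `n` the second
factor is negative. -/
theorem equation_three_iff (hn : 6 < n) (ha0 : 0 < a) (ha1 : a < Real.pi / 2) :
    ((n : ℝ) - 1) * Real.sin a * Real.cos a *
        (lamb n a 2 * ((n - 1) * Real.sin a ^ 2 - lamb n a 4) +
          ((n - 1) * Real.sin a * Real.cos a) ^ 2) = 0 ↔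
      n = 7 ∧ a = 1 / 2 * Real.arccos (1 / 9 * (2 * Real.sqrt 10 - 11)) := by
  have hs : 0 < Real.sin a := Real.sin_pos_of_pos_of_lt_pi ha0 (by linarith)
  have hc : 0 < Real.cos a := Real.cos_pos_of_mem_Ioo ⟨by linarith, ha1⟩
  have hN : (7 : ℝ) ≤ n := by exact_mod_cast hn
  have hC : 0 < Real.cos a ^ 2 := by positivity
  have h10 : Real.sqrt 10 ^ 2 = 10 := Real.sq_sqrt (by norm_num)
  have hr0 := Real.sqrt_nonneg 10
  have hr1 : 3 < Real.sqrt 10 := Real.lt_sqrt_of_sq_lt (by norm_num)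
  have hr2 : Real.sqrt 10 < 4 := by nlinarith
  rw [eq_half_arccos_iff ha0 ha1 (by linarith) (by linarith), mul_eq_zero_iff_left
    (mul_pos (mul_pos (by linarith) hs) hc).ne', mul_pow, mul_pow, lamb, lamb, Real.sin_sq]
  generalize Real.cos a ^ 2 = C at hC ⊢
  rcases Nat.lt_or_ge 7 n with h | h
  · refine iff_of_false (ne_of_lt ?_) (by omega)
    obtain ⟨m, rfl⟩ := Nat.exists_eq_add_of_le (Nat.succ_le_of_lt h)
    have hm : (0 : ℝ) ≤ m := Nat.cast_nonneg m
    -- in terms of `C` and `m`, all coefficients of the polynomial are negative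
    rw [← neg_pos]
    push_cast
    ring_nf
    positivity
  · obtain rfl : n = 7 := by omega
    rw [and_iff_right rfl]
    rw [← eq_iff_of_factor (C := C) (q := (-1 - Real.sqrt 10) / 9) hC (by linarith)]
    refine Iff.trans ?_ (mul_eq_zero_iff_left (by norm_num : (-108 : ℝ) ≠ 0))
    refine Eq.congr ?_ rfl
    push_cast
    linear_combination (-4 / 3) * h10

/-- With `C = cos² a`, for `n = 9` the equation is `32C² + 6C - 3 = 0`; for larger `n` the last
factor is negative. -/
theorem equation_four_iff (hn : 8 < n) (ha0 : 0 < a) (ha1 : a < Real.pi / 2) :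
    ((n : ℝ) - 1) * Real.sin a * Real.cos a * lamb n a 2 *
        (lamb n a 4 * ((n - 1) * Real.sin a ^ 2 - lamb n a 6) +
          2 * ((n - 1) * Real.sin a * Real.cos a) ^ 2) = 0 ↔
      n = 9 ∧ a = 1 / 2 * Real.arccos (1 / 16 * (Real.sqrt 105 - 19)) := by
  have hs : 0 < Real.sin a := Real.sin_pos_of_pos_of_lt_pi ha0 (by linarith)
  have hc : 0 < Real.cos a := Real.cos_pos_of_mem_Ioo ⟨by linarith, ha1⟩
  have hN : (9 : ℝ) ≤ n := by exact_mod_cast hn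
  have hC : 0 < Real.cos a ^ 2 := by positivity
  have h105 : Real.sqrt 105 ^ 2 = 105 := Real.sq_sqrt (by norm_num)
  have hr0 := Real.sqrt_nonneg 105
  have hr1 : 10 < Real.sqrt 105 := Real.lt_sqrt_of_sq_lt (by norm_num)
  have hr2 : Real.sqrt 105 < 11 := by nlinarith
  have hl : 0 < lamb n a 2 := lamb_pos (by omega) hc
  rw [eq_half_arccos_iff ha0 ha1 (by linarith) (by linarith), mul_eq_zero_iff_left
    (mul_pos (mul_pos (mul_pos (by linarith) hs) hc) hl).ne', mul_pow, mul_pow, lamb, lamb,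
    Real.sin_sq]
  generalize Real.cos a ^ 2 = C at hC ⊢
  rcases Nat.lt_or_ge 9 n with h | h
  · refine iff_of_false (ne_of_lt ?_) (by omega)
    obtain ⟨m, rfl⟩ := Nat.exists_eq_add_of_le (Nat.succ_le_of_lt h)
    have hm : (0 : ℝ) ≤ m := Nat.cast_nonneg m
    -- in terms of `C` and `m`, all coefficients of the polynomial are negative
    rw [← neg_pos]
    push_cast
    ring_nf
    positivity
  · obtain rfl : n = 9 := by omega
    rw [and_iff_right rfl]
    rw [← eq_iff_of_factor (C := C) (q := (-3 - Real.sqrt 105) / 32) hC (by linarith)]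
    refine Iff.trans ?_ (mul_eq_zero_iff_left (by norm_num : (-256 : ℝ) ≠ 0))
    refine Eq.congr ?_ rfl
    push_cast
    linear_combination (-1 / 4) * h105

/-- With `C = cos² a`, for `n = 11` the equation is `(5C + 9)(25C² + 4C - 2) = 0`; for larger `n`
the last factor is negative. -/
theorem equation_five_iff (hn : 10 < n) (ha0 : 0 < a) (ha1 : a < Real.pi / 2) :
    ((n : ℝ) - 1) * Real.sin a * Real.cos a * lamb n a 2 *
        (lamb n a 4 * (lamb n a 6 * ((n - 1) * Real.sin a ^ 2 - lamb n a 8) +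
          2 * ((n - 1) * Real.sin a * Real.cos a) ^ 2) +
          ((n - 1) * Real.sin a * Real.cos a) ^ 2 * lamb n a 2) = 0 ↔
      n = 11 ∧ a = 1 / 2 * Real.arccos (1 / 25 * (6 * Real.sqrt 6 - 29)) := by
  have hs : 0 < Real.sin a := Real.sin_pos_of_pos_of_lt_pi ha0 (by linarith)
  have hc : 0 < Real.cos a := Real.cos_pos_of_mem_Ioo ⟨by linarith, ha1⟩
  have hN : (11 : ℝ) ≤ n := by exact_mod_cast hn
  have hC : 0 < Real.cos a ^ 2 := by positivity
  have h6 : Real.sqrt 6 ^ 2 = 6 := Real.sq_sqrt (by norm_num)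
  have hr0 := Real.sqrt_nonneg 6
  have hr1 : 2 < Real.sqrt 6 := Real.lt_sqrt_of_sq_lt (by norm_num)
  have hr2 : Real.sqrt 6 < 3 := by nlinarith
  have hl : 0 < lamb n a 2 := lamb_pos (by omega) hc
  rw [eq_half_arccos_iff ha0 ha1 (by linarith) (by linarith), mul_eq_zero_iff_left
    (mul_pos (mul_pos (mul_pos (by linarith) hs) hc) hl).ne', mul_pow, mul_pow, lamb, lamb, lamb,
    lamb, Real.sin_sq]
  generalize Real.cos a ^ 2 = C at hC ⊢
  rcases Nat.lt_or_ge 11 n with h | h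
  · refine iff_of_false (ne_of_lt ?_) (by omega)
    obtain ⟨m, rfl⟩ := Nat.exists_eq_add_of_le (Nat.succ_le_of_lt h)
    have hm : (0 : ℝ) ≤ m := Nat.cast_nonneg m
    -- in terms of `C` and `m`, all coefficients of the polynomial are negative
    rw [← neg_pos]
    push_cast
    ring_nf
    positivity
  · obtain rfl : n = 11 := by omega
    rw [and_iff_right rfl]
    rw [← eq_iff_of_factor (C := C) (q := (-2 - 3 * Real.sqrt 6) / 25) hC (by linarith)]
    refine Iff.trans ?_ (mul_eq_zero_iff_left (by linarith : -1000 * (5 * C + 9) < 0).ne)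
    refine Eq.congr ?_ rfl
    push_cast
    linear_combination (-1000 * (5 * C + 9) * 9 / 625) * h6

end

/-! ### The maps `φ_a` outside the Sobolev range -/

section

variable {n : ℕ} {F : Type*} [NormedAddCommGroup F] [InnerProductSpace ℝ F]

/-- A conical function of any order is classically, hence weakly, differentiable on the punctured
ball. -/
theorem IsConic.hasWeakPartial_punctured [CompleteSpace F] {K : Set (Eucl n)} {k : ℕ}
    {u : ℝ × Eucl n → F} (hK : IsClosed K) (hu : IsConic K k u) (t : ℝ) (i : Fin n) :
    HasWeakPartial (unitBall n \ {0}) i (fun x => u (t, x)) (fun x => dir (eX i) u (t, x)) := by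
  have hm : MeasurableSet (unitBall n \ {0}) :=
    isOpen_unitBall.measurableSet.diff (measurableSet_singleton 0)
  have hsub : unitBall n \ {0} ⊆ {x | x ≠ 0} := fun x hx => hx.2
  have l1 := ((hu.continuousOn_slice t).mono hsub).locallyIntegrableOn (μ := volume) hm
  have l2 : LocallyIntegrableOn (fun x => dir (eX i) u (t, x)) (unitBall n \ {0}) volume :=
    (((hu.dir_space hK (EuclideanSpace.single i 1)).continuousOn_slice t).mono
      hsub).locallyIntegrableOn hm
  refine ⟨l1, l2, fun ψ hψ => ?_⟩
  have h0 : (0 : Eucl n) ∉ tsupport ψ := fun h => (hψ.2.2 h).2 rfl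
  have hd := hψ.fderiv_apply (EuclideanSpace.single i 1)
  have hslice : ∀ x, x ≠ 0 → ContDiffAt ℝ ∞ (fun z => u (t, z)) x := fun x hx =>
    (hu.contDiffAt (y := (t, x)) hx).comp x (contDiffAt_const.prodMk contDiffAt_id)
  have hz : ∀ x, x ∉ tsupport ψ → (fun z => ψ z • u (t, z)) =ᶠ[nhds x] fun _ => 0 := by
    intro x hx
    filter_upwards [(isClosed_tsupport ψ).isOpen_compl.mem_nhds hx] with z hz
    rw [image_eq_zero_of_notMem_tsupport hz, zero_smul]
  have hg : ContDiff ℝ 1 (fun z => ψ z • u (t, z)) := contDiff_iff_contDiffAt.mpr fun x => by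
    by_cases hx : x ∈ tsupport ψ
    · exact (hψ.1.contDiffAt.smul (hslice x fun h => h0 (h ▸ hx))).of_le (by norm_cast)
    · exact contDiffAt_const.congr_of_eventuallyEq (hz x hx)
  have hint := integral_fderiv_eq_zero_of_hasCompactSupport hg hψ.2.1.smul_right
    (EuclideanSpace.single i 1)
  rw [hd.setIntegral_smul, hψ.setIntegral_smul, eq_neg_iff_add_eq_zero,
    ← integral_add (hd.integrable_smul l1) (hψ.integrable_smul l2), ← hint]
  congr 1
  ext1 x
  by_cases hx : x ∈ tsupport ψ
  · have hx0 : x ≠ 0 := fun h => h0 (h ▸ hx)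
    have h1 := ((hslice x hx0).differentiableAt (by simp)).hasFDerivAt
    have h2 := ((hψ.1.differentiable (by simp) x).hasFDerivAt.smul h1).fderiv
    have h3 : fderiv ℝ (fun z => ψ z • u (t, z)) x = _ := h2
    rw [h3, eX, dir_slice (hu.differentiableAt (y := (t, x)) hx0)]
    simp [add_comm]
  · rw [(hz x hx).fderiv_eq, fderiv_of_notMem_tsupport ℝ hx, image_eq_zero_of_notMem_tsupport hx]
    simp

/-- Whatever the order of the singularity, a weak derivative on the whole ball can only be the
classical derivative. -/
theorem IsConic.ae_eq_dir_of_hasWeakPartial [CompleteSpace F] {K : Set (Eucl n)} {k : ℕ}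
    {u : ℝ × Eucl n → F} (hn : 1 ≤ n) (hK : IsClosed K) (hu : IsConic K k u) {t : ℝ} {i : Fin n}
    {v : Eucl n → F} (h : HasWeakPartial (unitBall n) i (fun x => u (t, x)) v) :
    v =ᵐ[volume.restrict (unitBall n)] fun x => dir (eX i) u (t, x) := by
  have : NeZero n := ⟨by omega⟩
  have h1 := (h.mono Set.sdiff_subset).ae_unique (isOpen_unitBall.sdiff isClosed_singleton)
    (hu.hasWeakPartial_punctured hK t i)
  rwa [Measure.restrict_congr_set (sdiff_null_ae_eq_self (measure_singleton 0))] at h1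

theorem IsConic.memSobolev_dir [CompleteSpace F] {K : Set (Eucl n)} {k j : ℕ}
    {u : ℝ × Eucl n → F} (hn : 1 ≤ n) (hK : IsClosed K) (hu : IsConic K k u) {t : ℝ}
    (h : MemSobolev (unitBall n) (j + 1) (fun x => u (t, x))) (i : Fin n) :
    MemSobolev (unitBall n) j (fun x => dir (eX i) u (t, x)) := by
  obtain ⟨v, hv, hv'⟩ := h.2 i
  exact hv'.congr (hu.ae_eq_dir_of_hasWeakPartial hn hK hv)

theorem two_mul_lt_of_memLp {E : Type*} [NormedAddCommGroup E] (hn : 1 ≤ n) {k : ℕ} {κ : ℝ}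
    (hκ : κ ≠ 0) {f : Eucl n → E}
    (h : MemLp f 2 (volume.restrict (unitBall n)))
    (e : ∀ x, x ≠ 0 → ‖f x‖ ^ 2 = κ * (‖x‖ ^ (2 * k))⁻¹) : 2 * k < n := by
  rw [← integrableOn_norm_pow_inv_iff hn]
  have h1 := ((memLp_two_iff_integrable_sq_norm h.1).mp h).const_mul κ⁻¹
  refine h1.congr ?_
  filter_upwards [ae_unitBall hn] with x hx
  rw [e x hx.1, inv_mul_cancel_left₀ hκ]

/-- Homogeneity suggests that `|x|⁻ᵐ x/|x|` has `j` square integrable derivatives only if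
`2(m + j) < n`. This is proved for the least `j` that violates the inequality: the Laplacian reduces
`j` by two and the divergence reduces it by one, and both are nonzero multiples of functions of the
same kind. -/
theorem not_memSobolev_radial (hn : 2 ≤ n) : ∀ (j m : ℕ) {α : ℝ} (_ : α ≠ 0) (β : ℝ)
    (_ : 2 * (m + j) ≤ n + 1) (_ : n ≤ 2 * (m + j)),
    ¬ MemSobolev (unitBall n) j (fun x => radial α β m (0, x))
  | 0, m, α, hα, β, _, h2, h => by
    have := two_mul_lt_of_memLp (k := m) (κ := α ^ 2 + β ^ 2) (by omega) (by positivity) h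
      fun x hx => by
        have hN : ‖x‖ ≠ 0 := norm_ne_zero_iff.mpr hx
        rw [← real_inner_self_eq_norm_sq, radial, inner_toTarget, inner_smul_left,
          inner_smul_right, real_inner_self_eq_norm_sq, RCLike.conj_to_real]
        field_simp
        ring
    omega
  | 1, m, α, hα, β, h1, h2, h => by
    have hc := conic_radial (n := n) ∅ α β m
    have hs : MemLp (fun x => ∑ i, innerSL ℝ (toTarget n (EuclideanSpace.single i 1, 0))
        (dir (eX i) (radial α β m) (0, x))) 2 (volume.restrict (unitBall n)) :=
      memLp_finsetSum _ fun i _ =>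
        ((hc.memSobolev_dir (j := 0) (by omega) isClosed_empty h i).clm (innerSL ℝ _)).memLp
    -- the divergence of the first component
    have hnm : (m : ℝ) + 1 < n := by exact_mod_cast (by omega : m + 1 < n)
    have := two_mul_lt_of_memLp (k := m + 1) (κ := (α * (n - (m + 1))) ^ 2) (by omega)
      (pow_ne_zero 2 (mul_ne_zero hα (by linarith))) hs fun x hx => by
        have hN : ‖x‖ ≠ 0 := norm_ne_zero_iff.mpr hx
        have e : ∀ i : Fin n, innerSL ℝ (toTarget n (EuclideanSpace.single i 1, 0))
            (dir (eX i) (radial α β m) (0, x)) = α * (‖x‖ ^ (m + 1))⁻¹ -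
              α * (m + 1) * (‖x‖ ^ (m + 3))⁻¹ * (x i * x i) := by
          intro i
          rw [innerSL_apply_apply, dir_radial _ _ _ _ hx, inner_toTarget, real_inner_comm,
            inner_single_right]
          simp
          ring
        simp only [e]
        rw [sum_const_sub_coord_sq, Real.norm_eq_abs, sq_abs]
        field_simp
        ring
    omega
  | j + 2, m, α, hα, β, h1, h2, h => by
    have hc := conic_radial (n := n) ∅ α β m
    have hnm : (m : ℝ) + 1 < n := by exact_mod_cast (by omega : m + 1 < n)
    have hs := MemSobolev.sum Finset.univ fun i _ =>
      (hc.dir_space isClosed_empty (EuclideanSpace.single i 1)).memSobolev_dir (by omega)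
        isClosed_empty (hc.memSobolev_dir (by omega) isClosed_empty h i) i
    refine not_memSobolev_radial hn j (m + 2) (α := α * ((m + 1) * (m + 1 - n)))
      (mul_ne_zero hα (mul_ne_zero (by positivity) (by linarith))) (β * (m * (m + 2 - n)))
      (by omega) (by omega) (hs.congr ?_)
    filter_upwards [ae_unitBall (by omega : 1 ≤ n)] with x hx
    exact sum_dir_dir_radial α β m (y := (0, x)) hx.1

/-- In dimension one, the sign function has no weak derivative: its classical derivative vanishes
away from the origin, but its distributional derivative is twice the Dirac mass. -/
theorem not_memSobolev_radial_one {α β : ℝ} (hα : α ≠ 0) :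
    ¬ MemSobolev (unitBall 1) 1 (fun x => radial α β 0 (0, x)) := by
  intro h
  have hc := conic_radial (n := 1) ∅ α β 0
  obtain ⟨v, hv, -⟩ := h.2 0
  have hv0 := hc.ae_eq_dir_of_hasWeakPartial le_rfl isClosed_empty hv
  have hnorm : ∀ x : Eucl 1, ‖x‖ = |x 0| := fun x => by
    rw [← sq_eq_sq₀ (norm_nonneg _) (abs_nonneg _), sq_abs, ← sum_sq_coord]
    simp [sq]
  let g : ContDiffBump (0 : ℝ) := ⟨1 / 4, 1 / 2, by norm_num, by norm_num⟩
  have hpr : ContDiff ℝ ∞ (fun x : Eucl 1 => x 0) := by fun_prop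
  have hψs : tsupport (fun x : Eucl 1 => g (x 0)) ⊆ Metric.closedBall 0 (1 / 2) := by
    refine closure_minimal (fun x hx => ?_) Metric.isClosed_closedBall
    have : x 0 ∈ Metric.closedBall (0 : ℝ) (1 / 2) := by
      by_contra hn
      refine hx (g.zero_of_le_dist ?_)
      rw [Metric.mem_closedBall, not_le] at hn
      exact hn.le
    rw [Metric.mem_closedBall, dist_zero_right] at this ⊢
    rwa [hnorm]
  have hψ : IsTestFunction (unitBall 1) (fun x : Eucl 1 => g (x 0)) :=
    ⟨g.contDiff.comp hpr, HasCompactSupport.of_support_subset_isCompact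
      (isCompact_closedBall 0 (1 / 2)) ((subset_tsupport _).trans hψs),
      hψs.trans (Metric.closedBall_subset_ball (by norm_num))⟩
  have h1 := (hv.clm (innerSL ℝ (toTarget 1 (EuclideanSpace.single 0 1, 0)))).2.2 _ hψ
  have h2 : ∫ x in unitBall 1, g (x 0) •
      innerSL ℝ (toTarget 1 (EuclideanSpace.single 0 1, 0)) (v x) = 0 := by
    refine integral_eq_zero_of_ae ?_
    filter_upwards [hv0, ae_unitBall le_rfl] with x hx hx0
    have hN : ‖x‖ ≠ 0 := norm_ne_zero_iff.mpr hx0.1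
    have hx2 : x 0 * x 0 = ‖x‖ ^ 2 := by rw [hnorm, sq_abs, sq]
    rw [hx, dir_radial _ _ _ _ hx0.1, innerSL_apply_apply, inner_toTarget, real_inner_comm,
      inner_single_right]
    have h3 : (‖x‖ ^ 1)⁻¹ - x 0 * (‖x‖ ^ 3)⁻¹ * x 0 = 0 := by
      field_simp
      linarith
    suffices α * ‖x‖⁻¹ - α * x 0 * (‖x‖ ^ 3)⁻¹ * x 0 = 0 by simp [this]
    linear_combination α * h3
  rw [h2, neg_zero, (hψ.fderiv_apply _).setIntegral_smul] at h1
  -- the remaining integral is computed on the two half-lines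
  have e1 : ∀ x : Eucl 1, fderiv ℝ (fun x : Eucl 1 => g (x 0)) x (EuclideanSpace.single 0 1) =
      deriv g (x 0) := fun x => by
    have hp : HasFDerivAt (fun z : Eucl 1 => z 0)
        (EuclideanSpace.proj 0 : Eucl 1 →L[ℝ] ℝ) x :=
      (EuclideanSpace.proj 0 : Eucl 1 →L[ℝ] ℝ).hasFDerivAt
    have := ((g.contDiff (n := 1)).differentiable (by simp) (x 0)).hasDerivAt.comp_hasFDerivAt x hp
    have h3 : fderiv ℝ (fun z : Eucl 1 => g (z 0)) x = _ := this.fderiv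
    rw [h3]; simp
  have e2 : ∀ x : Eucl 1, innerSL ℝ (toTarget 1 (EuclideanSpace.single 0 1, 0))
      (radial α β 0 (0, x)) = α * (|x 0|⁻¹ * x 0) := fun x => by
    rw [innerSL_apply_apply, radial, inner_toTarget, inner_smul_right, real_inner_comm,
      inner_single_right, hnorm]
    simp [mul_assoc]
  simp only [e1, e2] at h1
  have hmp := (volume_preserving_funUnique (Fin 1) ℝ).comp
    (PiLp.volume_preserving_ofLp (Fin 1))
  have h4 : ∫ s : ℝ, deriv g s • (α * (|s|⁻¹ * s)) = 0 := by
    refine Eq.trans ?_ h1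
    exact (hmp.integral_comp ((MeasurableEquiv.funUnique (Fin 1) ℝ).measurableEmbedding.comp
      (MeasurableEquiv.toLp 2 (Fin 1 → ℝ)).symm.measurableEmbedding)
      fun s : ℝ => deriv g s • (α * (|s|⁻¹ * s))).symm
  have hdc : Continuous (deriv g) := (g.contDiff (n := 1)).continuous_deriv (by simp)
  have hdi : Integrable (deriv g) := hdc.integrable_of_hasCompactSupport g.hasCompactSupport.deriv
  have r1 : Set.EqOn (fun s => α * deriv g s) (fun s => deriv g s • (α * (|s|⁻¹ * s)))
      (Set.Ioi 0) := fun s hs => by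
    have hs : 0 < s := hs
    simp only [abs_of_pos hs, inv_mul_cancel₀ hs.ne', smul_eq_mul]; ring
  have r2 : Set.EqOn (fun s => -α * deriv g s) (fun s => deriv g s • (α * (|s|⁻¹ * s)))
      (Set.Iio 0) := fun s hs => by
    have hs : s < 0 := hs
    simp only [abs_of_neg hs, inv_neg, neg_mul, inv_mul_cancel₀ hs.ne, smul_eq_mul]; ring
  have g0 : g 0 = 1 := g.one_of_mem_closedBall (by simp [g])
  have i1 : ∫ s in Set.Ioi 0, deriv g s • (α * (|s|⁻¹ * s)) = -α := by
    rw [← setIntegral_congr_fun measurableSet_Ioi r1, integral_const_mul,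
      HasCompactSupport.integral_Ioi_deriv_eq g.contDiff g.hasCompactSupport, g0]
    ring
  have i2 : ∫ s in Set.Iic 0, deriv g s • (α * (|s|⁻¹ * s)) = -α := by
    rw [integral_Iic_eq_integral_Iio, ← setIntegral_congr_fun measurableSet_Iio r2,
      integral_const_mul, ← integral_Iic_eq_integral_Iio,
      HasCompactSupport.integral_Iic_deriv_eq g.contDiff g.hasCompactSupport, g0]
    ring
  rw [← intervalIntegral.integral_Iic_add_Ioi (b := 0), i1, i2] at h4
  · exact hα (by linarith)
  · rw [integrableOn_Iic_iff_integrableOn_Iio]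
    exact ((hdi.const_mul (-α)).integrableOn).congr_fun r2 measurableSet_Iio
  · exact ((hdi.const_mul α).integrableOn).congr_fun r1 measurableSet_Ioi

/-- `φ_a` does not belong to `W^{r,2}` if `n ≤ 2r`. -/
theorem not_memSobolevSphere_phi {r : ℕ} (hn : 1 ≤ n) (hr : n ≤ 2 * r) {a : ℝ}
    (ha : 0 < Real.sin a) : ¬ MemSobolevSphere (unitBall n) r (phi n a) := by
  rintro ⟨h, -⟩
  have h' : MemSobolev (unitBall n) r (fun x => radial (Real.sin a) (Real.cos a) 0 (0, x)) := by
    convert h using 2 with x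
    exact (phi_eq_radial a 0 x).symm
  rcases Nat.lt_or_ge 1 n with h2 | h2
  -- the least `j` with `n ≤ 2 j`
  · exact not_memSobolev_radial h2 ((n + 1) / 2) 0 ha.ne' _ (by omega) (by omega)
      (h'.mono (by omega))
  · obtain rfl : n = 1 := by omega
    exact not_memSobolev_radial_one ha.ne' (h'.mono (by omega))

end

/-! ### Proper critical points -/

section

variable {n : ℕ}

/-- It suffices to determine when `φ_a` is critical for `n > 2r`: for `n ≤ 2r` it does not lie in
the Sobolev space, and for `n > 2` it is never weakly harmonic. -/
theorem isProper_phi_iff {r : ℕ} (hr : 1 ≤ r) (hn : 1 ≤ n) {a : ℝ} (ha0 : 0 < a)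
    (ha1 : a < Real.pi / 2) {En : (Eucl n → Target n) → ℝ} {P : Prop} (hP : P → 2 * r < n)
    (h : 2 * r < n → 0 < Real.sin a → 0 < Real.cos a →
      (IsWeakCriticalPoint (unitBall n) r En (phi n a) ↔ P)) :
    (IsWeakCriticalPoint (unitBall n) r En (phi n a) ∧ ¬ IsWeaklyHarmonic (unitBall n) (phi n a)) ↔
      P := by
  have hs : 0 < Real.sin a := Real.sin_pos_of_pos_of_lt_pi ha0 (by linarith)
  have hc : 0 < Real.cos a := Real.cos_pos_of_mem_Ioo ⟨by linarith, ha1⟩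
  rcases Nat.lt_or_ge (2 * r) n with hrn | hrn
  · rw [h hrn hs hc, and_iff_left (not_isWeaklyHarmonic_phi (by omega) hs hc)]
  · exact iff_of_false (fun hcr => not_memSobolevSphere_phi hn hrn hs hcr.1.1)
      fun hp => absurd (hP hp) (by omega)

end

end PolyHarm

end

theorem mainTheorem1 (n : ℕ) (hn : 1 ≤ n) (a : ℝ) (ha0 : 0 < a) (ha1 : a < Real.pi / 2) :
    ((PolyHarm.IsProperWeaklyESHarmonic (PolyHarm.unitBall n) 3 (PolyHarm.phi n a) ↔
        n = 7 ∧ a = 1 / 2 * Real.arccos (1 / 9 * (2 * Real.sqrt 10 - 11))) ∧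
      (PolyHarm.IsProperWeaklyRHarmonic (PolyHarm.unitBall n) 3 (PolyHarm.phi n a) ↔
        n = 7 ∧ a = 1 / 2 * Real.arccos (1 / 9 * (2 * Real.sqrt 10 - 11)))) ∧
    ((PolyHarm.IsProperWeaklyESHarmonic (PolyHarm.unitBall n) 4 (PolyHarm.phi n a) ↔
        n = 9 ∧ a = 1 / 2 * Real.arccos (1 / 16 * (Real.sqrt 105 - 19))) ∧
      (PolyHarm.IsProperWeaklyRHarmonic (PolyHarm.unitBall n) 4 (PolyHarm.phi n a) ↔
        n = 9 ∧ a = 1 / 2 * Real.arccos (1 / 16 * (Real.sqrt 105 - 19)))) ∧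
    ((PolyHarm.IsProperWeaklyESHarmonic (PolyHarm.unitBall n) 5 (PolyHarm.phi n a) ↔
        n = 11 ∧ a = 1 / 2 * Real.arccos (1 / 25 * (6 * Real.sqrt 6 - 29))) ∧
      (PolyHarm.IsProperWeaklyRHarmonic (PolyHarm.unitBall n) 5 (PolyHarm.phi n a) ↔
        n = 11 ∧ a = 1 / 2 * Real.arccos (1 / 25 * (6 * Real.sqrt 6 - 29)))) := by
  refine ⟨⟨?_, ?_⟩, ⟨?_, ?_⟩, ⟨?_, ?_⟩⟩ <;>
    refine PolyHarm.isProper_phi_iff (by norm_num) hn ha0 ha1 (by omega) fun hr hs hc => ?_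
  · exact (PolyHarm.isWeakCriticalPoint_three_iff hr hs hc (Or.inr rfl)).trans
      (PolyHarm.equation_three_iff hr ha0 ha1)
  · exact (PolyHarm.isWeakCriticalPoint_three_iff hr hs hc (Or.inl rfl)).trans
      (PolyHarm.equation_three_iff hr ha0 ha1)
  · exact (PolyHarm.isWeakCriticalPoint_four_iff hr hs hc (Or.inr rfl)).trans
      (PolyHarm.equation_four_iff hr ha0 ha1)
  · exact (PolyHarm.isWeakCriticalPoint_four_iff hr hs hc (Or.inl rfl)).trans
      (PolyHarm.equation_four_iff hr ha0 ha1)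
  · exact (PolyHarm.isWeakCriticalPoint_five_iff hr hs hc (Or.inr rfl)).trans
      (PolyHarm.equation_five_iff hr ha0 ha1)
  · exact (PolyHarm.isWeakCriticalPoint_five_iff hr hs hc (Or.inl rfl)).trans
      (PolyHarm.equation_five_iff hr ha0 ha1)
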